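/- Let $(\Xi,\nu)$ be a probability space and $\ell:\mathbb R^p\times\Xi\to\mathbb R$ a jointly measurable oracle with $\ell(\theta,\cdot)\in L^1(\nu)$ for all $\theta$; put $L(\theta)=\int \ell(\theta,\xi)\,d\nu(\xi)$, with gradient $g$ and Hessian $H$. Let $\hat\theta_0$ be a random vector, $\overline H_0$ a matrix, and for $k\ge 0$ let $$\hat\theta_{k+1}=\hat\theta_k-a_k\,\frac{\ell(\hat\theta_k+c_k\Delta_k,\omega_k^+)-\ell(\hat\theta_k-c_k\Delta_k,\omega_k^-)}{2c_k}\,m_k(\Delta_k),$$ $$\overline H_{k+1}=(1-w_k)\overline H_k+w_k\,\frac{\bar\ell_k}{4c_k\tilde c_k}\Big\{m_k(\tilde\Delta_k)m_k(\Delta_k)^T+m_k(\Delta_k)m_k(\tilde\Delta_k)^T\Big\},$$ $$\bar\ell_k=\ell(\hat\theta_k+c_k\Delta_k+\tilde c_k\tilde\Delta_k,\omega_k^{+,+})-\ell(\hat\theta_k+c_k\Delta_k,\omega_k^+)-\ell(\hat\theta_k-c_k\Delta_k+\tilde c_k\tilde\Delta_k,\omega_k^{-,+})+\ell(\hat\theta_k-c_k\Delta_k,\omega_k^-).$$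 Let $\mathcal F_k$ be the $\sigma$-algebra generated by $\hat\theta_0$ and by $\Delta_i,\tilde\Delta_i,\omega_i^{\pm},\omega_i^{\pm,+}$, $i<k$. Let $\theta^*\in\mathbb R^p$ and assume the following. (1) Loss. There are an open set $U$, constants $D_1$, $r>0$ and an index $K$ such that $L$ is $C^3$ on $U$ with all third-order partial derivatives bounded by $D_1$ there, and for every $k\ge K$, almost surely, $U$ contains the closed ball of radius $r$ about $\hat\theta_k$ and all points $\hat\theta_k+s c_k\Delta_k+t\tilde c_k\tilde\Delta_k$ with $|s|\le 1$, $0\le t\le 1$. (2) Perturbations. $m_k$ is an $\mathcal F_k$-measurable random odd mapping $\mathbb R^p\to\mathbb R^p$ and $\Sigma_k$ an $\mathcal F_k$-measurable random positive definite matrix. $\Delta_k$ is square integrable and, conditionally on $\mathcal F_k$, has mean $0$ and covariance $\Sigma_k^{-1}$, and a.s. $\mathbb E_k[m_k(\Delta_k)\Delta_k^T]=I$, $\mathbb E_k[\|\Delta_k\|^6\|m_k(\Delta_k)\|^2]\le D_2$ and $\mathbb E_k[\|m_k(\Delta_k)\|^2]\le D_2$, with $D_2$ independent of $k$. The same holds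 for $\tilde\Delta_k$ conditionally on $\mathcal F_k$ and $\Delta_k$. (3) IID noise. For each $k$, $\omega_k^+,\omega_k^-,\omega_k^{+,+},\omega_k^{-,+}$ are independent with law $\nu$, and jointly independent of $(\mathcal F_k,\Delta_k,\tilde\Delta_k)$. With $\varepsilon_k^{\pm}$, $\varepsilon_k^{\pm,+}$ the differences between $\ell$ and $L$ in the four queries, $\varepsilon_k^+-\varepsilon_k^-$ has, given $(\hat\theta_k,\Delta_k)$, conditional mean $0$ and conditional second moment at most $D_3$ a.s.; likewise $\varepsilon_k^{+,+}-\varepsilon_k^{-,+}$ given $(\hat\theta_k,\Delta_k,\tilde\Delta_k)$, with $D_3$ independent of $k$. (4) Either (a) $\sup_k\|\hat\theta_k\|<\infty$ a.s., $\theta^*$ is an asymptotically stable equilibrium of $\dot x=-g(x)$, and there is a compact subset of its domain of attraction which a.s. contains $\hat\theta_k$ for infinitely many $k$; or (b) $\theta^*$ is the unique minimizer of $L$, the set $\{L\le L(\theta^*)+C\}$ is bounded for every $C>0$, $\inf_{\|\theta-\theta^*\|>C}[L(\theta)-L(\theta^*)]>0$ and $\inf_{\|\theta-\theta^*\|>C}\|g(\theta)\|>0$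 for every $C>0$, and there are an open set $V$, a constant $D_4$ and an index $K'$ such that $L$ is $C^2$ on $V$, the entries of $H$ are bounded by $D_4$ in absolute value on $V$, and for every $k\ge K'$ a.s. $V$ contains the segment from $\hat\theta_k$ to $\hat\theta_{k+1}$. (5) Gains. $a_k>0$, $c_k>0$, $a_k\to0$, $c_k\to0$, $\sum_k a_k=\infty$, $\sum_k a_k^2c_k^{-2}<\infty$; $\tilde c_k>0$ and $\tilde c_k=O(c_k)$; $w_k\ge 0$, $\sum_k w_k=\infty$, $\sum_k w_k^2c_k^{-2}\tilde c_k^{-2}<\infty$. Then $L$ is $C^2$ near $\theta^*$ and $\overline H_k\to H(\theta^*)$ almost surely. -/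

import Mathlib

open MeasureTheory ProbabilityTheory Filter Topology

noncomputable section

namespace HARP

/-- The parameter space: real `p`-vectors with the Euclidean norm. -/
abbrev E (p : ℕ) := EuclideanSpace ℝ (Fin p)

/-- The matrix of second-order partial derivatives of `f` at `θ`. -/
def hessian {p : ℕ} (f : E p → ℝ) (θ : E p) : Matrix (Fin p) (Fin p) ℝ :=
  Matrix.of fun i j =>
    iteratedFDeriv ℝ 2 f θ ![EuclideanSpace.single i 1, EuclideanSpace.single j 1]

/-- The third-order partial derivative of `f` at `θ` with respect to the coordinates `i`, `j`, `l`. -/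
def thirdPartial {p : ℕ} (f : E p → ℝ) (θ : E p) (i j l : Fin p) : ℝ :=
  iteratedFDeriv ℝ 3 f θ
    ![EuclideanSpace.single i 1, EuclideanSpace.single j 1, EuclideanSpace.single l 1]

/-- Everything that is fed into the four-query recursion, on a sample space `Ω`, for an oracle
whose internal randomness takes values in `Ξ`. -/
structure Data (p : ℕ) (Ω Ξ : Type*) where
  /-- the noisy zeroth-order oracle -/
  ell : E p → Ξ → ℝ
  /-- initial parameter -/
  θ₀ : Ω → E p
  /-- initial smoothed Hessian estimate -/
  H₀ : Matrix (Fin p) (Fin p) ℝ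
  /-- stepsizes -/
  a : ℕ → ℝ
  /-- first differencing magnitudes -/
  c : ℕ → ℝ
  /-- second differencing magnitudes -/
  ct : ℕ → ℝ
  /-- weights of the Hessian recursion -/
  w : ℕ → ℝ
  /-- first perturbations -/
  Δ : ℕ → Ω → E p
  /-- second perturbations -/
  Δt : ℕ → Ω → E p
  /-- the (random) mappings applied to the perturbations -/
  m : ℕ → Ω → E p → E p
  /-- the (random) matrices whose inverses are the perturbation covariances -/
  S : ℕ → Ω → Matrix (Fin p) (Fin p) ℝ
  /-- oracle randomness of the query at `θ + c Δ` -/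
  ξp : ℕ → Ω → Ξ
  /-- oracle randomness of the query at `θ - c Δ` -/
  ξm : ℕ → Ω → Ξ
  /-- oracle randomness of the query at `θ + c Δ + ct Δt` -/
  ξpp : ℕ → Ω → Ξ
  /-- oracle randomness of the query at `θ - c Δ + ct Δt` -/
  ξmp : ℕ → Ω → Ξ

namespace Data

variable {p : ℕ} {Ω Ξ : Type*}

/-- The two-query gradient estimate of step `k` at the parameter `θ`. -/
def gradEst (D : Data p Ω Ξ) (k : ℕ) (ω : Ω) (θ : E p) : E p :=
  ((D.ell (θ + D.c k • D.Δ k ω) (D.ξp k ω) - D.ell (θ - D.c k • D.Δ k ω) (D.ξm k ω))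
    / (2 * D.c k)) • D.m k ω (D.Δ k ω)

/-- The parameter iterates. -/
def iter (D : Data p Ω Ξ) : ℕ → Ω → E p
  | 0, ω => D.θ₀ ω
  | k + 1, ω => D.iter k ω - D.a k • D.gradEst k ω (D.iter k ω)

/-- The first query point of step `k`. -/
def qp (D : Data p Ω Ξ) (k : ℕ) (ω : Ω) : E p := D.iter k ω + D.c k • D.Δ k ω

/-- The second query point of step `k`. -/
def qm (D : Data p Ω Ξ) (k : ℕ) (ω : Ω) : E p := D.iter k ω - D.c k • D.Δ k ω

/-- The third query point of step `k`. -/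
def qpp (D : Data p Ω Ξ) (k : ℕ) (ω : Ω) : E p :=
  D.iter k ω + D.c k • D.Δ k ω + D.ct k • D.Δt k ω

/-- The fourth query point of step `k`. -/
def qmp (D : Data p Ω Ξ) (k : ℕ) (ω : Ω) : E p :=
  D.iter k ω - D.c k • D.Δ k ω + D.ct k • D.Δt k ω

/-- The second-order difference of the four noisy query results of step `k`. -/
def ellBar (D : Data p Ω Ξ) (k : ℕ) (ω : Ω) : ℝ :=
  D.ell (D.qpp k ω) (D.ξpp k ω) - D.ell (D.qp k ω) (D.ξp k ω)
    - D.ell (D.qmp k ω) (D.ξmp k ω) + D.ell (D.qm k ω) (D.ξm k ω)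

/-- The smoothed Hessian estimates. -/
def hBar (D : Data p Ω Ξ) : ℕ → Ω → Matrix (Fin p) (Fin p) ℝ
  | 0, _ => D.H₀
  | k + 1, ω =>
      (1 - D.w k) • D.hBar k ω +
        (D.w k * (D.ellBar k ω / (4 * D.c k * D.ct k))) •
          (Matrix.vecMulVec (D.m k ω (D.Δt k ω)) (D.m k ω (D.Δ k ω)) +
            Matrix.vecMulVec (D.m k ω (D.Δ k ω)) (D.m k ω (D.Δt k ω)))

/-- The history before step `k`: the σ-algebra generated by the initial parameter and all
perturbations and all oracle randomness of the steps before `k`. -/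
def history [MeasurableSpace Ξ] (D : Data p Ω Ξ) (k : ℕ) : MeasurableSpace Ω :=
  MeasurableSpace.comap D.θ₀ inferInstance ⊔
    ⨆ (i : ℕ) (_ : i < k), MeasurableSpace.comap
      (fun ω => (D.Δ i ω, D.Δt i ω, D.ξp i ω, D.ξm i ω, D.ξpp i ω, D.ξmp i ω)) inferInstance

/-- The loss: the expectation of the oracle. -/
def loss [MeasurableSpace Ξ] (D : Data p Ω Ξ) (ν : Measure Ξ) (θ : E p) : ℝ :=
  ∫ ξ, D.ell θ ξ ∂ν

/-- Observation noise of a query at the random point `q` with oracle randomness `ξ`. -/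
def noise [MeasurableSpace Ξ] (D : Data p Ω Ξ) (ν : Measure Ξ) (q : Ω → E p) (ξ : Ω → Ξ)
    (ω : Ω) : ℝ :=
  D.ell (q ω) (ξ ω) - D.loss ν (q ω)

end Data

variable {p : ℕ} {Ω Ξ : Type*} [MeasurableSpace Ω] [MeasurableSpace Ξ]

/-- Loss function: `L` is three times continuously differentiable with bounded third-order partial
derivatives on an open set that, from some step on, is almost surely a neighborhood of the iterate,
of a radius not depending on the step, and contains the points at which the oracle is queried
(together with the parallelogram that they span). -/
def SmoothLoss (P : Measure Ω) (ν : Measure Ξ) (D : Data p Ω Ξ) : Prop :=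
  ∃ (U : Set (E p)) (D₁ r : ℝ) (K : ℕ), IsOpen U ∧ 0 < r ∧
    ContDiffOn ℝ 3 (D.loss ν) U ∧
    (∀ θ ∈ U, ∀ i j l, |thirdPartial (D.loss ν) θ i j l| ≤ D₁) ∧
    ∀ k ≥ K, ∀ᵐ ω ∂P, Metric.closedBall (D.iter k ω) r ⊆ U ∧
      ∀ s ∈ Set.Icc (-1 : ℝ) 1, ∀ t ∈ Set.Icc (0 : ℝ) 1,
        D.iter k ω + (s * D.c k) • D.Δ k ω + (t * D.ct k) • D.Δt k ω ∈ U

/-- Conditions on one perturbation `δ` and one mapping `M`, conditionally on the σ-algebra `𝓖`: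
mean zero, covariance the inverse of `S`, and normalization and moment bounds for `M δ`. -/
structure PerturbationCond (P : Measure Ω) (𝓖 : MeasurableSpace Ω) (D₂ : ℝ)
    (S : Ω → Matrix (Fin p) (Fin p) ℝ) (M : Ω → E p → E p) (δ : Ω → E p) : Prop where
  memLp : MemLp δ 2 P
  mean : P[δ | 𝓖] =ᵐ[P] 0
  cov : ∀ i j, P[fun ω => δ ω i * δ ω j | 𝓖] =ᵐ[P] fun ω => (S ω)⁻¹ i j
  unit : ∀ i j, P[fun ω => M ω (δ ω) i * δ ω j | 𝓖] =ᵐ[P]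
    fun _ => (1 : Matrix (Fin p) (Fin p) ℝ) i j
  integrable_six : Integrable (fun ω => ‖δ ω‖ ^ 6 * ‖M ω (δ ω)‖ ^ 2) P
  bound_six : ∀ᵐ ω ∂P, (P[fun ω => ‖δ ω‖ ^ 6 * ‖M ω (δ ω)‖ ^ 2 | 𝓖]) ω ≤ D₂
  integrable_sq : Integrable (fun ω => ‖M ω (δ ω)‖ ^ 2) P
  bound_sq : ∀ᵐ ω ∂P, (P[fun ω => ‖M ω (δ ω)‖ ^ 2 | 𝓖]) ω ≤ D₂

/-- Perturbations: `m k` is an odd mapping and `S k` a positive definite matrix, both measurable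
with respect to the history; the first perturbation satisfies the moment conditions given the
history, and the second one satisfies them given the history and the first perturbation. -/
structure Perturbation (P : Measure Ω) (D : Data p Ω Ξ) : Prop where
  measurable_Δ : ∀ k, Measurable (D.Δ k)
  measurable_Δt : ∀ k, Measurable (D.Δt k)
  measurable_m : ∀ k, @Measurable (Ω × E p) (E p)
    (@Prod.instMeasurableSpace Ω (E p) (D.history k) inferInstance) inferInstance
    (fun q => D.m k q.1 q.2)
  odd_m : ∀ k ω x, D.m k ω (-x) = -D.m k ω x
  measurable_S : ∀ k i j, Measurable[D.history k] fun ω => D.S k ω i j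
  posDef_S : ∀ k ω, (D.S k ω).PosDef
  moments : ∃ D₂ : ℝ, ∀ k,
    PerturbationCond P (D.history k) D₂ (D.S k) (D.m k) (D.Δ k) ∧
    PerturbationCond P (D.history k ⊔ MeasurableSpace.comap (D.Δ k) inferInstance) D₂
      (D.S k) (D.m k) (D.Δt k)

/-- I.i.d. oracle noise: in every step the oracle randomness of the four queries is a sample of
four independent draws from `ν`, independent of the history and of the perturbations of that step;
the noise differences of the two pairs of queries have conditional mean zero and bounded
conditional second moments. -/
structure IIDNoise (P : Measure Ω) (ν : Measure Ξ) (D : Data p Ω Ξ) : Prop where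
  measurable_ell : Measurable (Function.uncurry D.ell)
  integrable_ell : ∀ θ, Integrable (D.ell θ) ν
  measurable_θ₀ : Measurable D.θ₀
  measurable_ξp : ∀ k, Measurable (D.ξp k)
  measurable_ξm : ∀ k, Measurable (D.ξm k)
  measurable_ξpp : ∀ k, Measurable (D.ξpp k)
  measurable_ξmp : ∀ k, Measurable (D.ξmp k)
  law : ∀ k, P.map (fun ω => (D.ξp k ω, D.ξm k ω, D.ξpp k ω, D.ξmp k ω)) =
    ν.prod (ν.prod (ν.prod ν))
  indep : ∀ k, Indep
    (MeasurableSpace.comap (fun ω => (D.ξp k ω, D.ξm k ω, D.ξpp k ω, D.ξmp k ω)) inferInstance)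
    (D.history k ⊔ MeasurableSpace.comap (fun ω => (D.Δ k ω, D.Δt k ω)) inferInstance) P
  moments : ∃ D₃ : ℝ, ∀ k,
    (MemLp (fun ω => D.noise ν (D.qp k) (D.ξp k) ω - D.noise ν (D.qm k) (D.ξm k) ω) 2 P ∧
      P[fun ω => D.noise ν (D.qp k) (D.ξp k) ω - D.noise ν (D.qm k) (D.ξm k) ω |
        MeasurableSpace.comap (fun ω => (D.iter k ω, D.Δ k ω)) inferInstance] =ᵐ[P] 0 ∧
      ∀ᵐ ω ∂P, (P[fun ω =>
        (D.noise ν (D.qp k) (D.ξp k) ω - D.noise ν (D.qm k) (D.ξm k) ω) ^ 2 |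
        MeasurableSpace.comap (fun ω => (D.iter k ω, D.Δ k ω)) inferInstance]) ω ≤ D₃) ∧
    (MemLp (fun ω => D.noise ν (D.qpp k) (D.ξpp k) ω - D.noise ν (D.qmp k) (D.ξmp k) ω) 2 P ∧
      P[fun ω => D.noise ν (D.qpp k) (D.ξpp k) ω - D.noise ν (D.qmp k) (D.ξmp k) ω |
        MeasurableSpace.comap (fun ω => (D.iter k ω, D.Δ k ω, D.Δt k ω)) inferInstance] =ᵐ[P] 0 ∧
      ∀ᵐ ω ∂P, (P[fun ω =>
        (D.noise ν (D.qpp k) (D.ξpp k) ω - D.noise ν (D.qmp k) (D.ξmp k) ω) ^ 2 |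
        MeasurableSpace.comap (fun ω => (D.iter k ω, D.Δ k ω, D.Δt k ω)) inferInstance]) ω ≤ D₃)

/-- `x` solves `x' = -g(x)` on `[0, ∞)`. -/
def IsDescentFlow (g : E p → E p) (x : ℝ → E p) : Prop :=
  ∀ t ∈ Set.Ici (0 : ℝ), HasDerivWithinAt x (-(g (x t))) (Set.Ici 0) t

/-- `z` is an asymptotically stable equilibrium (in the sense of Lyapunov) of `x' = -g(x)`. -/
def AsymptoticallyStable (g : E p → E p) (z : E p) : Prop :=
  g z = 0 ∧
  (∀ ε > 0, ∃ δ > 0, ∀ x, IsDescentFlow g x → ‖x 0 - z‖ < δ → ∀ t ≥ 0, ‖x t - z‖ < ε) ∧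
  ∃ δ > 0, ∀ x, IsDescentFlow g x → ‖x 0 - z‖ < δ → Tendsto x atTop (𝓝 z)

/-- The domain of attraction of `z` for `x' = -g(x)`. -/
def attractionDomain (g : E p → E p) (z : E p) : Set (E p) :=
  {x₀ | ∃ x, IsDescentFlow g x ∧ x 0 = x₀ ∧ Tendsto x atTop (𝓝 z)}

/-- Iterate boundedness and ODE condition. -/
def BoundedODE (P : Measure Ω) (ν : Measure Ξ) (D : Data p Ω Ξ) (θs : E p) : Prop :=
  (∀ᵐ ω ∂P, ∃ R : ℝ, ∀ k, ‖D.iter k ω‖ ≤ R) ∧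
  AsymptoticallyStable (gradient (D.loss ν)) θs ∧
  ∃ A : Set (E p), IsCompact A ∧ A ⊆ attractionDomain (gradient (D.loss ν)) θs ∧
    ∀ᵐ ω ∂P, ∃ᶠ k in atTop, D.iter k ω ∈ A

/-- Unique minimum condition. The Hessian is bounded on an open set that, from some step on, almost
surely contains the segment joining the iterate to its successor. -/
structure UniqueMin (P : Measure Ω) (ν : Measure Ξ) (D : Data p Ω Ξ) (θs : E p) : Prop where
  unique_min : ∀ θ, θ ≠ θs → D.loss ν θs < D.loss ν θ
  sublevel : ∀ C₁ > 0, Bornology.IsBounded {θ | D.loss ν θ ≤ D.loss ν θs + C₁}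
  gap : ∀ C₂ > 0, ∃ η > 0, ∀ θ, ‖θ - θs‖ > C₂ → η ≤ D.loss ν θ - D.loss ν θs
  grad : ∀ C₃ > 0, ∃ η > 0, ∀ θ, ‖θ - θs‖ > C₃ → η ≤ ‖gradient (D.loss ν) θ‖
  hess : ∃ (V : Set (E p)) (D₄ : ℝ) (K : ℕ), IsOpen V ∧ ContDiffOn ℝ 2 (D.loss ν) V ∧
    (∀ θ ∈ V, ∀ i j, |hessian (D.loss ν) θ i j| < D₄) ∧
    ∀ k ≥ K, ∀ᵐ ω ∂P, segment ℝ (D.iter k ω) (D.iter (k + 1) ω) ⊆ V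

/-- Conditions on the stepsizes and the first differencing magnitudes. -/
structure Stepsize (D : Data p Ω Ξ) : Prop where
  a_pos : ∀ k, 0 < D.a k
  c_pos : ∀ k, 0 < D.c k
  a_lim : Tendsto D.a atTop (𝓝 0)
  c_lim : Tendsto D.c atTop (𝓝 0)
  a_sum : Tendsto (fun n => ∑ k ∈ Finset.range n, D.a k) atTop atTop
  ac_sum : Summable fun k => D.a k ^ 2 / D.c k ^ 2

/-- Conditions on the weights of the Hessian recursion. -/
structure Weights (D : Data p Ω Ξ) : Prop where
  w_nonneg : ∀ k, 0 ≤ D.w k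
  w_sum : Tendsto (fun n => ∑ k ∈ Finset.range n, D.w k) atTop atTop
  wc_sum : Summable fun k => D.w k ^ 2 / (D.c k ^ 2 * D.ct k ^ 2)

end HARP

end

noncomputable section

namespace HARP

/-! The gradient estimate at step k is split exactly into the gradient, a bias and a noise
(`gradEst_eq`). The bias is the conditional mean of the finite difference error, hence O(c_k²) by
the third-order Taylor bound and the sixth-moment condition. The noise is a martingale difference
with three parts: the gradient multiplied by m(Δ)Δᵀ - I, the oracle noise with variance O(1/c_k²),
and the centred finite difference error. No global bound on the gradient is available, so the noise
is summed only over visits to the compact sets `core U r R`. There the first part has bounded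
coefficients, and Σ a_k²/c_k² < ∞ makes the series converge by L² martingale convergence
(`ae_tendsto_noise_series`).

The rest of the convergence of the iterates is mostly pathwise (`DescentPath`). On a core, the loss
is replaced by a compactly supported C² function, and the tail of the convergent noise series is
added to the iterates. This leaves a deterministic Euler scheme with vanishing perturbations
(`frame`). In case (a), such a scheme shadows the flow over bounded time intervals, so its limit set
is invariant; a shadowing argument at an asymptotically stable equilibrium excludes repeated
excursions (`EulerScheme.tendsto_of_asymptoticallyStable`). In case (b), the loss decreases along
the scheme wherever it exceeds its minimum by a fixed amount. A path that visits a sublevel set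
infinitely often is therefore trapped in a slightly larger one, and a bounded path descends to every
level above the minimum because Σ a_k = ∞.

What remains in case (b) is that the values do not tend to infinity, and this needs expectations.
While the loss exceeds its minimum by at least 1, the gradient is bounded below, so its drift
dominates both the bias and the part of the second-order term proportional to the squared gradient.
The mean of the excess then grows by at most a constant times a_k²/c_k²
(`exists_lintegral_succ_le`), and Fatou's lemma concludes (`ae_frequently_lt`).

The Hessian estimate has the same decomposition: a mixed second difference has bias O(c_k + c̃_k),
the two perturbations are integrated out one after the other, and the oracle noise has variance
O(1/(c_k c̃_k)²). Once the iterates converge, the recursion is a weighted average of a convergent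
sequence and a noise with convergent weighted sum, and `tendsto_of_averaging` gives the limit. -/

lemma mapClusterPt_iff_norm {F : Type*} [SeminormedAddCommGroup F] {y : ℕ → F} {z : F} :
    MapClusterPt z atTop y ↔ ∀ ε > 0, ∃ᶠ n in atTop, ‖y n - z‖ < ε := by
  rw [(Metric.nhds_basis_ball (x := z)).mapClusterPt_iff_frequently]
  simp [dist_eq_norm]

/-! ### Perturbed Euler schemes shadow the flow of a bounded Lipschitz field. -/

section Shadowing

variable {F : Type*} [NormedAddCommGroup F] [NormedSpace ℝ F]

lemma flow_lipschitz {v : F → F} {M T : ℝ} (hM : ∀ x, ‖v x‖ ≤ M) {X : ℝ → F}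
    (hX : ∀ t ∈ Set.Icc (0 : ℝ) T, HasDerivWithinAt X (-(v (X t))) (Set.Icc 0 T) t)
    {s t : ℝ} (hs : s ∈ Set.Icc (0 : ℝ) T) (ht : t ∈ Set.Icc (0 : ℝ) T) :
    ‖X t - X s‖ ≤ M * |t - s| := by
  have := (convex_Icc (0 : ℝ) T).norm_image_sub_le_of_norm_hasDerivWithin_le hX
    (C := M) (fun x _ => by simpa using hM (X x)) hs ht
  simpa using this

/-- Over a time h the flow moves by at most M h, so its velocity changes by at most K M h, and
integrating over the step gives the local error. -/
lemma flow_euler_step {v : F → F} {K M T : ℝ} (hK0 : 0 ≤ K)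
    (hK : ∀ x y, ‖v x - v y‖ ≤ K * ‖x - y‖) (hM : ∀ x, ‖v x‖ ≤ M) {X : ℝ → F}
    (hX : ∀ t ∈ Set.Icc (0 : ℝ) T, HasDerivWithinAt X (-(v (X t))) (Set.Icc 0 T) t)
    {s h : ℝ} (hs : 0 ≤ s) (hh : 0 ≤ h) (hsh : s + h ≤ T) :
    ‖X (s + h) - X s + h • v (X s)‖ ≤ K * M * h * h := by
  have hM0 : 0 ≤ M := (norm_nonneg _).trans (hM 0)
  have hsub : Set.Icc s (s + h) ⊆ Set.Icc 0 T := Set.Icc_subset_Icc hs hsh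
  have hd : ∀ t ∈ Set.Icc s (s + h), HasDerivWithinAt (fun t => X t + (t - s) • v (X s))
      (-(v (X t)) + (1 : ℝ) • v (X s)) (Set.Icc s (s + h)) t := fun t ht =>
    ((hX t (hsub ht)).mono hsub).add
      ((((hasDerivAt_id t).sub_const s).smul_const (v (X s))).hasDerivWithinAt)
  have hb : ∀ t ∈ Set.Icc s (s + h), ‖-(v (X t)) + (1 : ℝ) • v (X s)‖ ≤ K * (M * h) := by
    intro t ht
    have h1 : -(v (X t)) + (1 : ℝ) • v (X s) = v (X s) - v (X t) := by rw [one_smul]; abel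
    rw [h1]
    refine (hK _ _).trans (mul_le_mul_of_nonneg_left ?_ hK0)
    refine (flow_lipschitz hM hX (hsub ht) (hsub ⟨le_rfl, by linarith⟩)).trans ?_
    refine mul_le_mul_of_nonneg_left ?_ hM0
    rw [abs_sub_comm, abs_of_nonneg] <;> linarith [ht.1, ht.2]
  have := (convex_Icc s (s + h)).norm_image_sub_le_of_norm_hasDerivWithin_le hd hb
    (x := s) (y := s + h) ⟨le_rfl, by linarith⟩ ⟨by linarith, le_rfl⟩
  simp only [sub_self, zero_smul, add_zero, add_sub_cancel_left, Real.norm_eq_abs,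
    abs_of_nonneg hh] at this
  calc _ = ‖X (s + h) + h • v (X s) - X s‖ := by congr 1; abel
    _ ≤ _ := by linarith

/-- Discrete Gronwall estimate between a perturbed Euler scheme and a flow. -/
lemma shadow_bound {v : F → F} {K M T : ℝ} (hK0 : 0 ≤ K)
    (hK : ∀ x y, ‖v x - v y‖ ≤ K * ‖x - y‖) (hM : ∀ x, ‖v x‖ ≤ M) {X : ℝ → F}
    (hX : ∀ t ∈ Set.Icc (0 : ℝ) T, HasDerivWithinAt X (-(v (X t))) (Set.Icc 0 T) t)
    {y β : ℕ → F} {a : ℕ → ℝ} (ha : ∀ n, 0 < a n) {m : ℕ} {γ : ℝ}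
    (hy : ∀ n ≥ m, y (n + 1) = y n - a n • (v (y n) + β n))
    (hγ : ∀ n ≥ m, ‖β n‖ + K * M * a n ≤ γ) {t : ℕ → ℝ} (ht : ∀ n, t (n + 1) = t n + a n)
    {n : ℕ} (hn : m ≤ n) (hT : t n - t m ≤ T) :
    ‖y n - X (t n - t m)‖ ≤
      Real.exp (K * (t n - t m)) * (‖y m - X 0‖ + γ * (t n - t m)) := by
  have hM0 : 0 ≤ M := (norm_nonneg _).trans (hM 0)
  have hγ0 : 0 ≤ γ := by
    refine le_trans ?_ (hγ m le_rfl)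
    have := (ha m).le
    positivity
  have hmono : Monotone t := monotone_nat_of_le_succ fun n => by rw [ht]; linarith [ha n]
  induction n, hn using Nat.le_induction with
  | base => simp
  | succ n hn ih =>
    have htn := hmono hn
    have h1 := ht n
    have han := ha n
    specialize ih (by linarith)
    set τ := t n - t m with hτ
    have hτ0 : 0 ≤ τ := by linarith
    have hτ1 : t (n + 1) - t m = τ + a n := by rw [h1, hτ]; ring
    rw [hτ1] at hT ⊢
    have hstep := flow_euler_step hK0 hK hM hX hτ0 han.le hT
    have hdec : y (n + 1) - X (τ + a n) = (y n - X τ) - a n • (v (y n) - v (X τ)) - a n • β n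
        - (X (τ + a n) - X τ + a n • v (X τ)) := by
      rw [hy n hn, smul_add, smul_sub]; abel
    set u := ‖y n - X τ‖ with hu
    have hn1 : ‖a n • (v (y n) - v (X τ))‖ ≤ a n * (K * u) := by
      rw [norm_smul, Real.norm_of_nonneg han.le]
      exact mul_le_mul_of_nonneg_left (hK _ _) han.le
    have hn2 : ‖a n • β n‖ = a n * ‖β n‖ := by rw [norm_smul, Real.norm_of_nonneg han.le]
    -- The local Euler error K M a² and the perturbation a‖β‖ together are at most a γ, which is why
    -- `γ` was chosen to bound their sum divided by a.
    have hle : ‖y (n + 1) - X (τ + a n)‖ ≤ u + a n * (K * u) + a n * γ := by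
      rw [hdec]
      have e1 := norm_sub_le ((y n - X τ) - a n • (v (y n) - v (X τ)) - a n • β n)
        (X (τ + a n) - X τ + a n • v (X τ))
      have e2 := norm_sub_le ((y n - X τ) - a n • (v (y n) - v (X τ))) (a n • β n)
      have e3 := norm_sub_le (y n - X τ) (a n • (v (y n) - v (X τ)))
      have e4 : a n * (‖β n‖ + K * M * a n) ≤ a n * γ :=
        mul_le_mul_of_nonneg_left (hγ n hn) han.le
      nlinarith
    set d := ‖y m - X 0‖ with hd
    have hd0 : 0 ≤ d := norm_nonneg _
    have hexp : Real.exp (K * (τ + a n)) = Real.exp (K * τ) * Real.exp (K * a n) := by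
      rw [← Real.exp_add]; ring_nf
    have hE1 : 1 ≤ Real.exp (K * τ) := Real.one_le_exp (by positivity)
    have hE2 : 1 + K * a n ≤ Real.exp (K * a n) := by linarith [Real.add_one_le_exp (K * a n)]
    have hE3 : 1 ≤ Real.exp (K * (τ + a n)) := Real.one_le_exp (by positivity)
    have hB : 0 ≤ Real.exp (K * τ) * (d + γ * τ) := by positivity
    calc _ ≤ u * (1 + K * a n) + a n * γ := by linarith
      _ ≤ (Real.exp (K * τ) * (d + γ * τ)) * Real.exp (K * a n)
          + Real.exp (K * (τ + a n)) * (γ * a n) := by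
        refine add_le_add (mul_le_mul ih hE2 (by positivity) hB) ?_
        nlinarith [mul_nonneg hγ0 han.le]
      _ = _ := by rw [hexp]; ring

/-- A bounded Lipschitz vector field has a flow line on every interval `[0, T]`. -/
lemma exists_flow_Icc [CompleteSpace F] {v : F → F} {K M : NNReal} (hK : LipschitzWith K v)
    (hM : ∀ x, ‖v x‖ ≤ M) (q : F) {T : ℝ} (hT : 0 ≤ T) :
    ∃ X : ℝ → F, X 0 = q ∧
      ∀ t ∈ Set.Icc (0 : ℝ) T, HasDerivWithinAt X (-(v (X t))) (Set.Icc 0 T) t := by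
  -- The ball of radius M T is large enough for a flow line of speed at most M to live on the whole
  -- interval.
  have hpl : IsPicardLindelof (fun _ x => -(v x)) (tmin := 0) (tmax := T)
      ⟨0, le_rfl, hT⟩ q (M * T.toNNReal) 0 M K :=
    { lipschitzOnWith := fun _ _ => (hK.neg).lipschitzOnWith
      continuousOn := fun _ _ => continuousOn_const
      norm_le := fun _ _ x _ => by simpa using hM x
      mul_max_le := by simp [hT] }
  obtain ⟨X, h0, hX⟩ := hpl.exists_eq_forall_mem_Icc_hasDerivWithinAt₀
  exact ⟨X, h0, hX⟩

/-- The flow lines on [0, n] agree on common intervals by uniqueness and are glued together. -/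
lemma exists_flow [CompleteSpace F] {v : F → F} {K M : NNReal} (hK : LipschitzWith K v)
    (hM : ∀ x, ‖v x‖ ≤ M) (q : F) :
    ∃ X : ℝ → F, X 0 = q ∧
      ∀ t ∈ Set.Ici (0 : ℝ), HasDerivWithinAt X (-(v (X t))) (Set.Ici 0) t := by
  choose X h0 hX using fun n : ℕ => exists_flow_Icc hK hM q (T := n) n.cast_nonneg
  have hK' : ∀ t : ℝ, LipschitzWith K (fun x => -(v x)) := fun _ => hK.neg
  have huniq : ∀ m n : ℕ, m ≤ n → Set.EqOn (X m) (X n) (Set.Icc 0 (m : ℝ)) := by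
    intro m n hmn
    have hsub : Set.Icc (0 : ℝ) m ⊆ Set.Icc 0 (n : ℝ) :=
      Set.Icc_subset_Icc le_rfl (by exact_mod_cast hmn)
    refine ODE_solution_unique (v := fun _ x => -(v x)) (fun t => hK' t) ?_ ?_ ?_ ?_ ?_
    · exact fun t ht => (hX m t ht).continuousWithinAt
    · intro t ht
      exact (hX m t ⟨ht.1, ht.2.le⟩).mono_of_mem_nhdsWithin
        (Icc_mem_nhdsGE_of_mem ⟨ht.1, ht.2⟩)
    · exact fun t ht => (hX n t (hsub ht)).continuousWithinAt.mono hsub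
    · intro t ht
      exact (hX n t (hsub ⟨ht.1, ht.2.le⟩)).mono_of_mem_nhdsWithin
        (Icc_mem_nhdsGE_of_mem ⟨ht.1, ht.2.trans_le (by exact_mod_cast hmn)⟩)
    · rw [h0, h0]
  -- The extra 1 puts t strictly inside the interval of the chosen flow line, so that the derivative
  -- at t is taken relative to the whole half-line.
  refine ⟨fun t => X (⌈t⌉₊ + 1) t, by simpa using h0 _, ?_⟩
  intro t ht
  set N := ⌈t⌉₊ + 1 with hN
  have htN : t < N := by
    have := Nat.le_ceil t
    rw [hN]; push_cast; linarith
  have hder : HasDerivWithinAt (X N) (-(v (X N t))) (Set.Ici 0) t :=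
    (hX N t ⟨ht, htN.le⟩).mono_of_mem_nhdsWithin (by
      have : Set.Iic (N : ℝ) ∈ 𝓝[Set.Ici 0] t := mem_nhdsWithin_of_mem_nhds (Iic_mem_nhds htN)
      filter_upwards [this, self_mem_nhdsWithin] with x hx1 hx2 using ⟨hx2, hx1⟩)
  refine hder.congr_of_eventuallyEq ?_ rfl
  have : Set.Iio (N : ℝ) ∈ 𝓝[Set.Ici 0] t := mem_nhdsWithin_of_mem_nhds (Iio_mem_nhds htN)
  filter_upwards [this, self_mem_nhdsWithin] with x hx1 hx2
  have hx3 : ⌈x⌉₊ + 1 ≤ N + 1 := by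
    have : ⌈x⌉₊ ≤ N := Nat.ceil_le.2 (le_of_lt hx1)
    omega
  have e1 := huniq _ _ hx3 (x := x) ⟨hx2, by have := Nat.le_ceil x; push_cast; linarith⟩
  have e2 := huniq N (N + 1) (by omega) (x := x) ⟨hx2, le_of_lt hx1⟩
  rw [e1, ← e2]

/-- A perturbed Euler scheme for `x' = -v(x)` with vanishing perturbations and stepsizes. -/
structure EulerScheme (v : F → F) (a : ℕ → ℝ) (y β : ℕ → F) : Prop where
  a_pos : ∀ n, 0 < a n
  a_lim : Tendsto a atTop (𝓝 0)
  a_sum : Tendsto (fun n => ∑ k ∈ Finset.range n, a k) atTop atTop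
  step : ∀ᶠ n in atTop, y (n + 1) = y n - a n • (v (y n) + β n)
  β_lim : Tendsto β atTop (𝓝 0)

namespace EulerScheme

variable {v : F → F} {a : ℕ → ℝ} {y β : ℕ → F} {K M : NNReal}

/-- This is the Gronwall bound on a window of length T with all late perturbations below one
constant. The closeness required at the start is the same for every late starting index, so the
lemma can be used along subsequences. -/
lemma shadow (h : EulerScheme v a y β) (hK : LipschitzWith K v) (hM : ∀ x, ‖v x‖ ≤ M)
    {T : ℝ} (hT : 0 ≤ T) {X : ℝ → F}
    (hX : ∀ t ∈ Set.Icc (0 : ℝ) T, HasDerivWithinAt X (-(v (X t))) (Set.Icc 0 T) t)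
    {ε : ℝ} (hε : 0 < ε) :
    ∃ δ > 0, ∀ᶠ m in atTop, ‖y m - X 0‖ < δ → ∀ n ≥ m,
      ∑ k ∈ Finset.range n, a k - ∑ k ∈ Finset.range m, a k ≤ T →
      ‖y n - X (∑ k ∈ Finset.range n, a k - ∑ k ∈ Finset.range m, a k)‖ < ε := by
  have hE := Real.exp_pos (K * T)
  -- The initial error and the accumulated perturbation may each contribute ε/2 after multiplication
  -- by exp(K T); T + 1 instead of T avoids dividing by zero and gives strictness.
  set γ : ℝ := ε / (2 * (T + 1) * Real.exp (K * T)) with hγ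
  have hγ0 : 0 < γ := by positivity
  refine ⟨ε / (2 * Real.exp (K * T)), by positivity, ?_⟩
  have hlim : Tendsto (fun n => ‖β n‖ + K * M * a n) atTop (𝓝 0) := by
    simpa using h.β_lim.norm.add (h.a_lim.const_mul ((K : ℝ) * M))
  have hev : ∀ᶠ n in atTop, ‖β n‖ + K * M * a n ≤ γ ∧ y (n + 1) = y n - a n • (v (y n) + β n) := by
    filter_upwards [hlim.eventually (gt_mem_nhds hγ0), h.step] with n hn h2 using ⟨hn.le, h2⟩
  filter_upwards [eventually_forall_ge_atTop.2 hev] with m hm hd n hn hnT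
  have hKl : ∀ x y, ‖v x - v y‖ ≤ K * ‖x - y‖ := fun x y => by
    simpa [dist_eq_norm] using hK.dist_le_mul x y
  have hb := shadow_bound K.2 hKl hM hX h.a_pos (fun n hn => (hm n hn).2)
    (fun n hn => (hm n hn).1) (t := fun n => ∑ k ∈ Finset.range n, a k)
    (fun n => Finset.sum_range_succ a n) hn hnT
  refine hb.trans_lt ?_
  set τ := ∑ k ∈ Finset.range n, a k - ∑ k ∈ Finset.range m, a k
  have hτ0 : 0 ≤ τ := sub_nonneg.2 (Finset.sum_le_sum_of_subset_of_nonneg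
    (Finset.range_mono hn) fun i _ _ => (h.a_pos i).le)
  calc Real.exp (K * τ) * (‖y m - X 0‖ + γ * τ)
      ≤ Real.exp (K * T) * (‖y m - X 0‖ + γ * T) := by
        refine mul_le_mul (Real.exp_le_exp.2 (mul_le_mul_of_nonneg_left hnT K.2))
          (by gcongr) (by positivity) hE.le
    _ < Real.exp (K * T) * (ε / (2 * Real.exp (K * T)) + γ * (T + 1)) := by
        gcongr
        linarith
    _ = ε := by rw [hγ]; field_simp; ring

/-- An index at which the elapsed time since `m` is just below `t`. -/
lemma exists_index (h : EulerScheme v a y β) (m : ℕ) {t : ℝ} (ht : 0 ≤ t) :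
    ∃ n ≥ m, ∑ k ∈ Finset.range n, a k - ∑ k ∈ Finset.range m, a k ≤ t ∧
      t < ∑ k ∈ Finset.range n, a k - ∑ k ∈ Finset.range m, a k + a n := by
  classical
  have hex : ∃ n, t + ∑ k ∈ Finset.range m, a k < ∑ k ∈ Finset.range n, a k :=
    (h.a_sum.eventually_gt_atTop _).exists
  have hmono : Monotone fun n => ∑ k ∈ Finset.range n, a k := monotone_nat_of_le_succ fun n => by
    rw [Finset.sum_range_succ]; linarith [h.a_pos n]
  have hspec := Nat.find_spec hex
  have hlt : m < Nat.find hex := by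
    by_contra hcon
    have := hmono (not_lt.1 hcon)
    simp only at this
    linarith
  obtain ⟨n, hn⟩ : ∃ n, Nat.find hex = n + 1 := ⟨Nat.find hex - 1, by omega⟩
  have hmin := Nat.find_min hex (m := n) (by omega)
  rw [hn, Finset.sum_range_succ] at hspec
  refine ⟨n, by omega, by linarith, by linarith⟩

/-- The set of cluster points of a perturbed Euler scheme is invariant under the flow. -/
lemma mapClusterPt_flow (h : EulerScheme v a y β) (hK : LipschitzWith K v) (hM : ∀ x, ‖v x‖ ≤ M)
    {T : ℝ} {X : ℝ → F}
    (hX : ∀ t ∈ Set.Icc (0 : ℝ) T, HasDerivWithinAt X (-(v (X t))) (Set.Icc 0 T) t)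
    (h0 : MapClusterPt (X 0) atTop y) {t : ℝ} (ht : t ∈ Set.Icc (0 : ℝ) T) :
    MapClusterPt (X t) atTop y := by
  rw [mapClusterPt_iff_norm] at h0 ⊢
  intro ε hε
  obtain ⟨δ, hδ, hsh⟩ := h.shadow hK hM (ht.1.trans ht.2) hX (half_pos hε)
  have hsmall : ∀ᶠ n in atTop, (M : ℝ) * a n < ε / 2 := by
    have : Tendsto (fun n => (M : ℝ) * a n) atTop (𝓝 0) := by simpa using h.a_lim.const_mul (M : ℝ)
    exact this.eventually (gt_mem_nhds (half_pos hε))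
  rw [frequently_atTop]
  intro N
  obtain ⟨m, ⟨hm1, hm2, hm3⟩, hmN⟩ :=
    (((h0 δ hδ).and_eventually (hsh.and (eventually_forall_ge_atTop.2 hsmall))).and_eventually
      (eventually_ge_atTop N)).exists
  -- The elapsed time at `n` misses t by at most a step, and during that time the flow moves by at
  -- most M a_n < ε/2.
  obtain ⟨n, hn, hn1, hn2⟩ := h.exists_index m ht.1
  refine ⟨n, hmN.trans hn, ?_⟩
  set τ := ∑ k ∈ Finset.range n, a k - ∑ k ∈ Finset.range m, a k with hτ
  have hτ0 : 0 ≤ τ := sub_nonneg.2 (Finset.sum_le_sum_of_subset_of_nonneg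
    (Finset.range_mono hn) fun i _ _ => (h.a_pos i).le)
  have e1 := hm2 hm1 n hn (hn1.trans ht.2)
  have e2 := flow_lipschitz hM hX ht (s := t) (t := τ) ⟨hτ0, hn1.trans ht.2⟩
  have e3 : |τ - t| ≤ a n := by rw [abs_sub_comm, abs_of_nonneg] <;> linarith
  have e4 : (M : ℝ) * |τ - t| ≤ M * a n := mul_le_mul_of_nonneg_left e3 M.2
  calc ‖y n - X t‖ ≤ ‖y n - X τ‖ + ‖X τ - X t‖ := norm_sub_le_norm_sub_add_norm_sub ..
    _ < ε := by linarith [hm3 n hn]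

end EulerScheme

end Shadowing

/-! ### Limit sets of Euler schemes and asymptotically stable equilibria. -/

section Stability

variable {p : ℕ} {g v : E p → E p} {a : ℕ → ℝ} {y β : ℕ → E p} {K M : NNReal} {N : Set (E p)}
  {z : E p}

/-- A flow line of `g` that starts in the limit set of an Euler scheme for a field that agrees
with `g` near the limit set stays in the limit set. -/
lemma EulerScheme.mapClusterPt_descentFlow (h : EulerScheme v a y β) (hK : LipschitzWith K v)
    (hM : ∀ x, ‖v x‖ ≤ M) (hN : IsOpen N) (hgv : Set.EqOn g v N)
    (hcl : ∀ q, MapClusterPt q atTop y → q ∈ N) {x : ℝ → E p} (hx : IsDescentFlow g x)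
    (h0 : MapClusterPt (x 0) atTop y) {t : ℝ} (ht : 0 ≤ t) : MapClusterPt (x t) atTop y := by
  have hcont : ContinuousOn x (Set.Ici 0) := fun t ht => (hx t ht).continuousWithinAt
  have hclosed : IsClosed {q | MapClusterPt q atTop y} := isClosed_setOfPred_clusterPt
  have key : Set.Icc 0 t ⊆ {s | MapClusterPt (x s) atTop y} := by
    -- Continuous induction along the interval: the set of good times is closed, and from a good
    -- time the flow line stays in `N` for a while, where it solves the equation of `v`, so
    -- invariance of the limit set applies.
    refine IsClosed.Icc_subset_of_forall_mem_nhdsWithin ?_ h0 ?_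
    · rw [Set.inter_comm]
      exact (hcont.mono Set.Icc_subset_Ici_self).preimage_isClosed_of_isClosed isClosed_Icc hclosed
    · rintro s ⟨hs, hs0, -⟩
      have hsN : x s ∈ N := hcl _ hs
      have h1 : ∀ᶠ u in 𝓝[≥] s, x u ∈ N :=
        ((hcont s hs0).mono (Set.Ici_subset_Ici.2 hs0)) (hN.mem_nhds hsN)
      obtain ⟨b, hb, hbN⟩ := (mem_nhdsGE_iff_exists_Icc_subset).1 h1
      have hb : s < b := hb
      have hflow : ∀ u ∈ Set.Icc 0 (b - s), HasDerivWithinAt (fun u => x (s + u))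
          (-(v (x (s + u)))) (Set.Icc 0 (b - s)) u := by
        intro u hu
        have hmem : s + u ∈ Set.Icc s b := ⟨by linarith [hu.1], by linarith [hu.2]⟩
        rw [← hgv (hbN hmem)]
        have h2 := (hx (s + u) (show (0 : ℝ) ≤ s + u by linarith [hu.1]))
        have h3 : HasDerivWithinAt (fun u : ℝ => s + u) 1 (Set.Icc 0 (b - s)) u :=
          ((hasDerivAt_id u).const_add s).hasDerivWithinAt
        have h4 := HasDerivWithinAt.scomp u h2 h3 (fun u' hu' => show (0 : ℝ) ≤ s + u' by
          linarith [hu'.1])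
        simpa [Function.comp_def] using h4
      have h5 : ∀ u ∈ Set.Icc s b, MapClusterPt (x u) atTop y := by
        intro u hu
        have := h.mapClusterPt_flow hK hM hflow (by simpa using hs) (t := u - s)
          ⟨by linarith [hu.1], by linarith [hu.2]⟩
        simpa using this
      filter_upwards [Ioc_mem_nhdsGT hb] with u hu using h5 u ⟨hu.1.le, hu.2⟩
  exact key ⟨ht, le_rfl⟩

/-- Invariance and closedness make z a cluster point. If the scheme did not converge, it would leave
a small ball about z infinitely often. The last exits have a limit point q, and the scheme shadows
the flow from q, which stays near z by stability and re-enters the small ball by attraction. Hence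
the scheme either returns too early or never gets far. -/
lemma EulerScheme.tendsto_of_asymptoticallyStable (h : EulerScheme v a y β)
    (hK : LipschitzWith K v) (hM : ∀ x, ‖v x‖ ≤ M) (hN : IsOpen N) (hgv : Set.EqOn g v N)
    (hcl : ∀ q, MapClusterPt q atTop y → q ∈ N) {B : Set (E p)} (hB : IsCompact B)
    (hyB : ∀ᶠ n in atTop, y n ∈ B) (hz : AsymptoticallyStable g z) {x₀ : E p}
    (hx₀ : x₀ ∈ attractionDomain g z) (hclx : MapClusterPt x₀ atTop y) :
    Tendsto y atTop (𝓝 z) := by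
  have hclosed : IsClosed {q | MapClusterPt q atTop y} := isClosed_setOfPred_clusterPt
  have hzcl : MapClusterPt z atTop y := by
    obtain ⟨x, hx, hx0, hxz⟩ := hx₀
    refine hclosed.mem_of_tendsto hxz ?_
    filter_upwards [eventually_ge_atTop 0] with t ht
    exact h.mapClusterPt_descentFlow hK hM hN hgv hcl hx (by rwa [hx0]) ht
  by_contra hnot
  obtain ⟨ε, hε, hfreq⟩ : ∃ ε > 0, ∃ᶠ n in atTop, ε ≤ ‖y n - z‖ := by
    rw [Metric.tendsto_nhds] at hnot
    push Not at hnot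
    obtain ⟨ε, hε, hf⟩ := hnot
    exact ⟨ε, hε, by simpa [dist_eq_norm] using hf⟩
  obtain ⟨-, hstab, δ₂, hδ₂, hattr⟩ := hz
  obtain ⟨δ₁, hδ₁, hstab⟩ := hstab (ε / 2) (half_pos hε)
  set δ := min (min δ₁ δ₂) ε / 2 with hδ
  have hδ0 : 0 < δ := by positivity
  have hδ1 : δ < δ₁ := by
    have := min_le_left (min δ₁ δ₂) ε; have := min_le_left δ₁ δ₂
    have : 0 < min (min δ₁ δ₂) ε := by positivity
    linarith
  have hδ2 : δ < δ₂ := by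
    have := min_le_left (min δ₁ δ₂) ε; have := min_le_right δ₁ δ₂
    have : 0 < min (min δ₁ δ₂) ε := by positivity
    linarith
  have hδε : δ ≤ ε / 2 := by
    have := min_le_right (min δ₁ δ₂) ε
    linarith
  -- Here m is the last index before the far point n at which the scheme is in the δ-ball.
  have hexc : ∀ k : ℕ, ∃ m n, k ≤ m ∧ m < n ∧ ‖y m - z‖ < δ ∧ ε ≤ ‖y n - z‖ ∧
      ∀ j, m < j → j ≤ n → δ ≤ ‖y j - z‖ := by
    classical
    intro k
    obtain ⟨m', hm', hm'δ⟩ := frequently_atTop.1 (mapClusterPt_iff_norm.1 hzcl δ hδ0) k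
    obtain ⟨n, hn, hnε⟩ := frequently_atTop.1 hfreq m'
    have hle := Nat.findGreatest_le (P := fun j => ‖y j - z‖ < δ) n
    have hge := Nat.le_findGreatest (P := fun j => ‖y j - z‖ < δ) hn hm'δ
    have hsp := Nat.findGreatest_spec (P := fun j => ‖y j - z‖ < δ) hn hm'δ
    refine ⟨_, n, hm'.trans hge, lt_of_le_of_ne hle ?_, hsp, hnε, fun j hj hjn => ?_⟩
    · intro heq
      rw [heq] at hsp
      linarith
    · exact not_lt.1 (Nat.findGreatest_is_greatest hj hjn)
  choose m n hkm hmn hmδ hnε hbtw using hexc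
  have hmtop : Tendsto m atTop atTop := tendsto_atTop_mono hkm tendsto_id
  obtain ⟨q, -, φ, hφ, hφq⟩ := hB.tendsto_subseq' (hmtop.eventually hyB).frequently
  have hmφ := hmtop.comp hφ.tendsto_atTop
  have hqcl : MapClusterPt q atTop y := (hφq.mapClusterPt).of_comp hmφ
  have hqz : ‖q - z‖ ≤ δ := le_of_tendsto ((hφq.sub_const z).norm)
    (Eventually.of_forall fun k => (hmδ (φ k)).le)
  -- Only the auxiliary field is known to have global flow lines; this one stays in the limit set,
  -- where both fields agree, so it is a flow line of `g` as well.
  obtain ⟨X, hX0, hX⟩ := exists_flow hK hM q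
  have hXcl : ∀ t ≥ 0, MapClusterPt (X t) atTop y := fun t ht =>
    h.mapClusterPt_flow hK hM (T := t)
      (fun s hs => (hX s hs.1).mono Set.Icc_subset_Ici_self) (by rwa [hX0]) ⟨ht, le_rfl⟩
  have hXg : IsDescentFlow g X := fun t ht => by
    rw [hgv (hcl _ (hXcl t ht))]
    exact hX t ht
  have hXε := hstab X hXg (by rw [hX0]; linarith)
  have hXz := hattr X hXg (by rw [hX0]; linarith)
  obtain ⟨T, hT0, hT⟩ : ∃ T > 0, ∀ t ≥ T, ‖X t - z‖ < δ / 2 := by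
    have := Metric.tendsto_nhds.1 hXz (δ / 2) (by positivity)
    obtain ⟨T, hT⟩ := eventually_atTop.1 this
    refine ⟨max T 1, by positivity, fun t ht => ?_⟩
    simpa [dist_eq_norm] using hT t ((le_max_left _ _).trans ht)
  obtain ⟨η, hη, hsh⟩ := h.shadow hK hM (T := T + 1) (by linarith) (X := X)
    (fun s hs => (hX s hs.1).mono Set.Icc_subset_Ici_self) (half_pos hδ0)
  have ha1 := h.a_lim.eventually (gt_mem_nhds one_pos)
  have hclose : ∀ᶠ k in atTop, ‖y (m (φ k)) - X 0‖ < η := by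
    have := Metric.tendsto_nhds.1 hφq η hη
    simpa [dist_eq_norm, hX0] using this
  obtain ⟨k, hk1, hk2, hk3⟩ := (hclose.and ((hmφ.eventually hsh).and
    (hmφ.eventually (eventually_forall_ge_atTop.2 ha1)))).exists
  simp only [Function.comp_apply] at hk2 hk3
  set m' := m (φ k)
  set n' := n (φ k)
  have hk2 := hk2 hk1
  -- With steps below 1, the last index within time T + 1 lies beyond time T, where the flow is
  -- within δ/2 of z.
  obtain ⟨l, hl, hl1, hl2⟩ := h.exists_index m' (t := T + 1) (by linarith)
  have hlT : T < ∑ i ∈ Finset.range l, a i - ∑ i ∈ Finset.range m', a i := by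
    linarith [hk3 l hl]
  have hlm : m' < l := by
    refine lt_of_le_of_ne hl fun heq => ?_
    rw [heq, sub_self] at hlT
    linarith
  have hnear : ‖y l - z‖ < δ := by
    have e1 := hk2 l hl hl1
    have e2 := hT _ hlT.le
    calc _ ≤ _ := norm_sub_le_norm_sub_add_norm_sub (y l)
          (X (∑ i ∈ Finset.range l, a i - ∑ i ∈ Finset.range m', a i)) z
      _ < δ := by linarith
  -- If the return happens by the far point, it contradicts the choice of the last exit. Otherwise
  -- the far point lies in the shadowing window and is within ε/2 + δ/2 < ε of z.
  rcases le_or_gt l n' with hln | hln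
  · exact absurd (hbtw (φ k) l hlm hln) (not_le.2 hnear)
  · have hmono : Monotone fun n => ∑ k ∈ Finset.range n, a k :=
      monotone_nat_of_le_succ fun n => by
        rw [Finset.sum_range_succ]; linarith [h.a_pos n]
    have h1 := hmono hln.le
    have h2 := hmono (hmn (φ k)).le
    simp only at h1 h2
    have e1 := hk2 n' (hmn _).le (by linarith)
    have e2 := hXε (∑ i ∈ Finset.range n', a i - ∑ i ∈ Finset.range m', a i) (by
      exact sub_nonneg.2 h2)
    have e3 := norm_sub_le_norm_sub_add_norm_sub (y n')
          (X (∑ i ∈ Finset.range n', a i - ∑ i ∈ Finset.range m', a i)) z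
    have := hnε (φ k)
    linarith

end Stability

/-! ### Absorbing the noise into the iterates. -/

section Denoise

variable {F : Type*} [NormedAddCommGroup F] [NormedSpace ℝ F]

open Classical in
/-- Absorbing a convergent noise series into the iterates of a stochastic approximation. -/
lemma exists_denoised {v : F → F} {K : NNReal} (hK : LipschitzWith K v) {a : ℕ → ℝ}
    {θ b e : ℕ → F} {C : ℕ → Prop}
    (hstep : ∀ᶠ n in atTop, C n → θ (n + 1) = θ n - a n • (v (θ n) + b n + e n))
    (hb : Tendsto b atTop (𝓝 0)) {s : F}
    (hs : Tendsto (fun n => ∑ k ∈ Finset.range n, if C k then a k • e k else 0) atTop (𝓝 s)) :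
    ∃ y β : ℕ → F, Tendsto β atTop (𝓝 0) ∧ Tendsto (fun n => y n - θ n) atTop (𝓝 0) ∧
      ∀ᶠ n in atTop, C n → y (n + 1) = y n - a n • (v (y n) + β n) := by
  set S := fun n => ∑ k ∈ Finset.range n, if C k then a k • e k else 0 with hS
  have hy : Tendsto (fun n => S n - s) atTop (𝓝 0) := by simpa using hs.sub_const s
  have hv : Tendsto (fun n => v (θ n) - v (θ n + (S n - s))) atTop (𝓝 0) := by
    refine squeeze_zero_norm (a := fun n => K * ‖S n - s‖) (fun n => ?_)
      (by simpa using hy.norm.const_mul (K : ℝ))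
    have := hK.dist_le_mul (θ n) (θ n + (S n - s))
    rwa [dist_eq_norm, dist_comm, dist_eq_norm, add_sub_cancel_left] at this
  -- Adding the partial sum minus its limit cancels the noise of each step; the field is then
  -- evaluated at a shifted point, and the Lipschitz property turns this into a vanishing
  -- perturbation.
  refine ⟨fun n => θ n + (S n - s), fun n => v (θ n) - v (θ n + (S n - s)) + b n,
    by simpa using hv.add hb, by simpa using hy, ?_⟩
  filter_upwards [hstep] with n hn hC
  have h1 : S (n + 1) = S n + a n • e n := by
    simp only [hS]; rw [Finset.sum_range_succ, if_pos hC]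
  rw [hn hC, h1]
  have : v (θ n + (S n - s)) + (v (θ n) - v (θ n + (S n - s)) + b n) = v (θ n) + b n := by abel
  rw [this, smul_add _ _ (e n)]
  abel

end Denoise

/-! ### Taylor and finite difference estimates, and smooth cut-offs. -/

section Calculus

set_option maxSynthPendingDepth 3

variable {p : ℕ} {F : Type*} [NormedAddCommGroup F] [NormedSpace ℝ F]

lemma opNorm_le_of_single {T : E p →L[ℝ] F} {B : ℝ}
    (h : ∀ i, ‖T (EuclideanSpace.single i 1)‖ ≤ B) : ‖T‖ ≤ p * B := by
  rcases Nat.eq_zero_or_pos p with rfl | hp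
  · have : T = 0 := by
      ext x
      rw [Subsingleton.elim x 0, map_zero, map_zero]
    simp [this]
  have hB : 0 ≤ B := (norm_nonneg _).trans (h ⟨0, hp⟩)
  refine T.opNorm_le_bound (by positivity) fun x => ?_
  have hx : x = ∑ i, x i • EuclideanSpace.single i (1 : ℝ) := by
    ext j
    simp [Finset.sum_apply, Pi.single_apply]
  calc ‖T x‖ = ‖∑ i, x i • T (EuclideanSpace.single i 1)‖ := by
        conv_lhs => rw [hx]
        rw [map_sum]
        simp only [map_smul]
    _ ≤ ∑ i : Fin p, ‖x‖ * B := by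
        refine norm_sum_le_of_le _ fun i _ => ?_
        rw [norm_smul]
        exact mul_le_mul (PiLp.norm_apply_le x i) (h i) (norm_nonneg _) (norm_nonneg _)
    _ = _ := by simp; ring

lemma norm_fderiv_fderiv_le {f : E p → ℝ} {x : E p} {B : ℝ}
    (h : ∀ i j, |hessian f x i j| ≤ B) : ‖fderiv ℝ (fderiv ℝ f) x‖ ≤ p * (p * B) := by
  refine opNorm_le_of_single fun i => opNorm_le_of_single fun j => ?_
  have := h i j
  rw [hessian, Matrix.of_apply, iteratedFDeriv_two_apply] at this
  simpa using this

lemma norm_fderiv_fderiv_fderiv_le {f : E p → ℝ} {x : E p} {B : ℝ}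
    (h : ∀ i j l, |thirdPartial f x i j l| ≤ B) :
    ‖fderiv ℝ (fderiv ℝ (fderiv ℝ f)) x‖ ≤ p * (p * (p * B)) := by
  refine opNorm_le_of_single fun i => opNorm_le_of_single fun j => opNorm_le_of_single fun l => ?_
  have := h i j l
  rw [thirdPartial, iteratedFDeriv_succ_apply_right, iteratedFDeriv_two_apply] at this
  simpa [Fin.init] using this

variable {G : Type*} [NormedAddCommGroup G] [NormedSpace ℝ G] {L : G → ℝ} {U : Set G}

lemma contDiffAt_of_contDiffOn_isOpen {n : WithTop ℕ∞} (hU : IsOpen U) (hL : ContDiffOn ℝ n L U)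
    {x : G} (hx : x ∈ U) : ContDiffAt ℝ n L x := hL.contDiffAt (hU.mem_nhds hx)

lemma hasFDerivAt_fderiv (hU : IsOpen U) (hL : ContDiffOn ℝ 2 L U) {x : G} (hx : x ∈ U) :
    HasFDerivAt (fderiv ℝ L) (fderiv ℝ (fderiv ℝ L) x) x :=
  (((contDiffAt_of_contDiffOn_isOpen hU hL hx).fderiv_right (m := 1)
    (by norm_num)).differentiableAt (by norm_num)).hasFDerivAt

lemma hasFDerivAt_fderiv_fderiv (hU : IsOpen U) (hL : ContDiffOn ℝ 3 L U) {x : G} (hx : x ∈ U) :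
    HasFDerivAt (fderiv ℝ (fderiv ℝ L)) (fderiv ℝ (fderiv ℝ (fderiv ℝ L)) x) x :=
  ((((contDiffAt_of_contDiffOn_isOpen hU hL hx).fderiv_right (m := 2)
    (by norm_num)).fderiv_right (m := 1) (by norm_num)).differentiableAt (by norm_num)).hasFDerivAt

lemma hasFDerivAt_of_contDiffOn {n : WithTop ℕ∞} (hU : IsOpen U) (hn : n ≠ 0)
    (hL : ContDiffOn ℝ n L U) {x : G} (hx : x ∈ U) : HasFDerivAt L (fderiv ℝ L x) x :=
  ((contDiffAt_of_contDiffOn_isOpen hU hL hx).differentiableAt hn).hasFDerivAt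

/-- First-order Taylor estimate along a segment on which the second derivative is bounded. -/
lemma taylor_one_segment (hU : IsOpen U) (hL : ContDiffOn ℝ 2 L U) {x y : G} {B : ℝ}
    (hseg : segment ℝ x y ⊆ U) (hB : ∀ z ∈ segment ℝ x y, ‖fderiv ℝ (fderiv ℝ L) z‖ ≤ B) :
    |L y - L x - fderiv ℝ L x (y - x)| ≤ B * ‖y - x‖ ^ 2 := by
  have hconv := convex_segment (𝕜 := ℝ) x y
  have hB0 : 0 ≤ B := (norm_nonneg _).trans (hB x (left_mem_segment ℝ x y))
  have h1 : ∀ z ∈ segment ℝ x y, ‖fderiv ℝ L z - fderiv ℝ L x‖ ≤ B * ‖y - x‖ := fun z hz => by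
    refine (hconv.norm_image_sub_le_of_norm_hasFDerivWithin_le
      (fun w hw => (hasFDerivAt_fderiv hU hL (hseg hw)).hasFDerivWithinAt) hB
      (left_mem_segment ℝ x y) hz).trans ?_
    exact mul_le_mul_of_nonneg_left (norm_sub_le_of_mem_segment hz) hB0
  have := hconv.norm_image_sub_le_of_norm_hasFDerivWithin_le' (f := L)
    (fun w hw => (hasFDerivAt_of_contDiffOn hU (by norm_num) hL (hseg hw)).hasFDerivWithinAt) h1
    (left_mem_segment ℝ x y) (right_mem_segment ℝ x y)
  rw [Real.norm_eq_abs] at this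
  linarith

set_option maxHeartbeats 800000 in
/-- The central difference approximates the derivative to third order. -/
lemma central_difference_le (hU : IsOpen U) (hL : ContDiffOn ℝ 3 L U) {x u : G} {B : ℝ}
    (hseg : ∀ s ∈ Set.Icc (-1 : ℝ) 1, x + s • u ∈ U)
    (hB : ∀ z ∈ U, ‖fderiv ℝ (fderiv ℝ (fderiv ℝ L)) z‖ ≤ B) :
    |L (x + u) - L (x - u) - 2 * fderiv ℝ L x u| ≤ 2 * B * ‖u‖ ^ 3 := by
  have hL2 : ContDiffOn ℝ 2 L U := hL.of_le (by norm_num)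
  have hline : ∀ s : ℝ, HasDerivAt (fun s : ℝ => x + s • u) u s := fun s => by
    simpa using ((hasDerivAt_id s).smul_const u).const_add x
  have d2 : ∀ s ∈ Set.Icc (-1 : ℝ) 1, HasDerivAt (fun s : ℝ => fderiv ℝ (fderiv ℝ L) (x + s • u))
      (fderiv ℝ (fderiv ℝ (fderiv ℝ L)) (x + s • u) u) s := fun s hs =>
    (hasFDerivAt_fderiv_fderiv hU hL (hseg s hs)).comp_hasDerivAt s (hline s)
  have d1 : ∀ s ∈ Set.Icc (-1 : ℝ) 1, HasDerivAt (fun s : ℝ => fderiv ℝ L (x + s • u) u)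
      (fderiv ℝ (fderiv ℝ L) (x + s • u) u u) s := fun s hs =>
    ((hasFDerivAt_fderiv hU hL2 (hseg s hs)).comp_hasDerivAt s (hline s)).clm_apply
      (hasDerivAt_const s u) |>.congr_deriv (by simp)
  have d0 : ∀ s ∈ Set.Icc (-1 : ℝ) 1, HasDerivAt (fun s : ℝ => L (x + s • u))
      (fderiv ℝ L (x + s • u) u) s := fun s hs =>
    (hasFDerivAt_of_contDiffOn hU (by norm_num) hL (hseg s hs)).comp_hasDerivAt s (hline s)
  have hsub : ∀ s ∈ Set.Icc (0 : ℝ) 1, s ∈ Set.Icc (-1 : ℝ) 1 ∧ -s ∈ Set.Icc (-1 : ℝ) 1 :=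
    fun s hs => ⟨⟨by linarith [hs.1], hs.2⟩, ⟨by linarith [hs.2], by linarith [hs.1]⟩⟩
  have b2 : ∀ s ∈ Set.Icc (-1 : ℝ) 1, ∀ s' ∈ Set.Icc (-1 : ℝ) 1,
      ‖fderiv ℝ (fderiv ℝ L) (x + s • u) - fderiv ℝ (fderiv ℝ L) (x + s' • u)‖
        ≤ (B * ‖u‖) * ‖s - s'‖ := fun s hs s' hs' =>
    (convex_Icc (-1 : ℝ) 1).norm_image_sub_le_of_norm_hasDerivWithin_le
      (fun t ht => (d2 t ht).hasDerivWithinAt)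
      (fun t ht => (ContinuousLinearMap.le_opNorm _ _).trans
        (mul_le_mul_of_nonneg_right (hB _ (hseg t ht)) (norm_nonneg _))) hs' hs
  have hB0 : 0 ≤ B := (norm_nonneg _).trans (hB _ (hseg 0 (by norm_num)))
  -- The symmetrized first derivative has derivative D²L(x+tu)uu - D²L(x-tu)uu: the second-order
  -- terms cancel, and the bound on the third derivative remains.
  have b1 : ∀ s ∈ Set.Icc (0 : ℝ) 1, ‖fderiv ℝ L (x + s • u) u + fderiv ℝ L (x + (-s) • u) u
      - 2 * fderiv ℝ L x u‖ ≤ 2 * B * ‖u‖ ^ 3 := by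
    intro s hs
    have hd : ∀ t ∈ Set.Icc (0 : ℝ) 1, HasDerivWithinAt
        (fun t : ℝ => fderiv ℝ L (x + t • u) u + fderiv ℝ L (x + (-t) • u) u)
        (fderiv ℝ (fderiv ℝ L) (x + t • u) u u - fderiv ℝ (fderiv ℝ L) (x + (-t) • u) u u)
        (Set.Icc 0 1) t := fun t ht => by
      have e := (d1 (-t) (hsub t ht).2).scomp t (hasDerivAt_neg t)
      have := (d1 t (hsub t ht).1).add e
      exact (this.congr_deriv (by simp; ring)).hasDerivWithinAt
    have hb : ∀ t ∈ Set.Icc (0 : ℝ) 1, ‖fderiv ℝ (fderiv ℝ L) (x + t • u) u u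
        - fderiv ℝ (fderiv ℝ L) (x + (-t) • u) u u‖ ≤ 2 * B * ‖u‖ ^ 3 := fun t ht => by
      have e1 := b2 t (hsub t ht).1 (-t) (hsub t ht).2
      have e2 : ‖t - -t‖ ≤ 2 := by
        rw [Real.norm_eq_abs, abs_le]; constructor <;> linarith [ht.1, ht.2]
      have e3 := ContinuousLinearMap.le_opNorm₂
        (fderiv ℝ (fderiv ℝ L) (x + t • u) - fderiv ℝ (fderiv ℝ L) (x + (-t) • u)) u u
      simp only [sub_apply] at e3
      refine e3.trans ?_
      calc _ ≤ (B * ‖u‖ * 2) * ‖u‖ * ‖u‖ := by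
            gcongr
            exact e1.trans (by gcongr)
        _ = _ := by ring
    have := (convex_Icc (0 : ℝ) 1).norm_image_sub_le_of_norm_hasDerivWithin_le hd hb
      (x := 0) (y := s) (by norm_num) hs
    simp only [neg_zero, zero_smul, add_zero, sub_zero, Real.norm_of_nonneg hs.1] at this
    rw [two_mul (fderiv ℝ L x u)]
    refine this.trans ?_
    nlinarith [hs.2, show 0 ≤ 2 * B * ‖u‖ ^ 3 by positivity]
  have hd : ∀ t ∈ Set.Icc (0 : ℝ) 1, HasDerivWithinAt
      (fun t : ℝ => L (x + t • u) - L (x + (-t) • u) - t * (2 * fderiv ℝ L x u))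
      (fderiv ℝ L (x + t • u) u + fderiv ℝ L (x + (-t) • u) u - 2 * fderiv ℝ L x u)
      (Set.Icc 0 1) t := fun t ht => by
    have e := (d0 (-t) (hsub t ht).2).scomp t (hasDerivAt_neg t)
    have := ((d0 t (hsub t ht).1).sub e).sub ((hasDerivAt_id t).mul_const (2 * fderiv ℝ L x u))
    exact (this.congr_deriv (by simp)).hasDerivWithinAt
  have := (convex_Icc (0 : ℝ) 1).norm_image_sub_le_of_norm_hasDerivWithin_le hd b1
    (x := 0) (y := 1) (by norm_num) (by norm_num)
  simpa [sub_eq_add_neg] using this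

/-- The mixed second difference approximates the second derivative. -/
lemma mixed_difference_le (hU : IsOpen U) (hL : ContDiffOn ℝ 3 L U) {x u w : G} {B : ℝ}
    (hmem : ∀ s ∈ Set.Icc (-1 : ℝ) 1, ∀ t ∈ Set.Icc (0 : ℝ) 1, x + s • u + t • w ∈ U)
    (hB : ∀ z ∈ U, ‖fderiv ℝ (fderiv ℝ (fderiv ℝ L)) z‖ ≤ B) :
    |L (x + u + w) - L (x + u) - L (x - u + w) + L (x - u) - 2 * fderiv ℝ (fderiv ℝ L) x w u|
      ≤ 2 * B * (‖u‖ + ‖w‖) * ‖u‖ * ‖w‖ := by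
  have hL2 : ContDiffOn ℝ 2 L U := hL.of_le (by norm_num)
  have hB0 : 0 ≤ B := (norm_nonneg _).trans (hB _ (hmem 0 (by norm_num) 0 (by norm_num)))
  have b2 : ∀ s ∈ Set.Icc (-1 : ℝ) 1, ∀ t ∈ Set.Icc (0 : ℝ) 1,
      ‖fderiv ℝ (fderiv ℝ L) (x + s • u + t • w) - fderiv ℝ (fderiv ℝ L) x‖
        ≤ B * (‖u‖ + ‖w‖) := by
    intro s hs t ht
    -- `U` need not be convex, but the parallelogram is star-shaped about x, so the mean value
    -- inequality can be used along rays from x.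
    have hseg : segment ℝ x (x + s • u + t • w) ⊆ U := by
      rw [segment_eq_image']
      rintro _ ⟨r, hr, rfl⟩
      have : x + r • (x + s • u + t • w - x) = x + (r * s) • u + (r * t) • w := by module
      simp only [this]
      refine hmem _ ⟨?_, ?_⟩ _ ⟨mul_nonneg hr.1 ht.1, ?_⟩ <;> nlinarith [hs.1, hs.2, hr.1, hr.2, ht.1, ht.2]
    refine ((convex_segment x _).norm_image_sub_le_of_norm_hasFDerivWithin_le
      (fun w hw => (hasFDerivAt_fderiv_fderiv hU hL (hseg hw)).hasFDerivWithinAt)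
      (fun z hz => hB z (hseg hz)) (left_mem_segment ℝ _ _) (right_mem_segment ℝ _ _)).trans ?_
    refine mul_le_mul_of_nonneg_left ?_ hB0
    have : x + s • u + t • w - x = s • u + t • w := by abel
    rw [this]
    refine (norm_add_le _ _).trans (add_le_add ?_ ?_)
    · rw [norm_smul, Real.norm_eq_abs]
      exact mul_le_of_le_one_left (norm_nonneg _) (abs_le.2 hs)
    · rw [norm_smul, Real.norm_eq_abs]
      exact mul_le_of_le_one_left (norm_nonneg _) (abs_le.2 ⟨by linarith [ht.1], ht.2⟩)
  have b1 : ∀ s ∈ Set.Icc (-1 : ℝ) 1, ‖fderiv ℝ L (x + s • u + w) - fderiv ℝ L (x + s • u)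
      - fderiv ℝ (fderiv ℝ L) x w‖ ≤ B * (‖u‖ + ‖w‖) * ‖w‖ := by
    intro s hs
    have hd : ∀ t ∈ Set.Icc (0 : ℝ) 1, HasDerivWithinAt
        (fun t : ℝ => fderiv ℝ L (x + s • u + t • w) - t • fderiv ℝ (fderiv ℝ L) x w)
        (fderiv ℝ (fderiv ℝ L) (x + s • u + t • w) w - fderiv ℝ (fderiv ℝ L) x w)
        (Set.Icc 0 1) t := fun t ht => by
      have hline : HasDerivAt (fun t : ℝ => x + s • u + t • w) w t := by
        simpa using ((hasDerivAt_id t).smul_const w).const_add (x + s • u)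
      have := ((hasFDerivAt_fderiv hU hL2 (hmem s hs t ht)).comp_hasDerivAt t hline).sub
        ((hasDerivAt_id t).smul_const (fderiv ℝ (fderiv ℝ L) x w))
      exact (this.congr_deriv (by simp)).hasDerivWithinAt
    have hb : ∀ t ∈ Set.Icc (0 : ℝ) 1, ‖fderiv ℝ (fderiv ℝ L) (x + s • u + t • w) w
        - fderiv ℝ (fderiv ℝ L) x w‖ ≤ B * (‖u‖ + ‖w‖) * ‖w‖ := fun t ht => by
      rw [← sub_apply]
      exact (ContinuousLinearMap.le_opNorm _ _).trans
        (mul_le_mul_of_nonneg_right (b2 s hs t ht) (norm_nonneg _))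
    have := (convex_Icc (0 : ℝ) 1).norm_image_sub_le_of_norm_hasDerivWithin_le hd hb
      (x := 0) (y := 1) (by norm_num) (by norm_num)
    simp only [one_smul, zero_smul, add_zero, sub_zero, norm_one, mul_one] at this
    rwa [sub_right_comm] at this
  -- The increment of this function from -1 to 1 is the mixed difference minus its main term, so the
  -- interval length 2 gives the factor 2.
  have hd : ∀ s ∈ Set.Icc (-1 : ℝ) 1, HasDerivWithinAt
      (fun s : ℝ => L (x + s • u + w) - L (x + s • u) - s * fderiv ℝ (fderiv ℝ L) x w u)
      ((fderiv ℝ L (x + s • u + w) - fderiv ℝ L (x + s • u)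
      - fderiv ℝ (fderiv ℝ L) x w) u) (Set.Icc (-1) 1) s := fun s hs => by
    have hline : HasDerivAt (fun s : ℝ => x + s • u) u s := by
      simpa using ((hasDerivAt_id s).smul_const u).const_add x
    have hU0 : x + s • u ∈ U := by simpa using hmem s hs 0 (by norm_num)
    have hU1 : x + s • u + w ∈ U := by simpa using hmem s hs 1 (by norm_num)
    have e1 := (hasFDerivAt_of_contDiffOn hU (by norm_num) hL hU1).comp_hasDerivAt s
      (hline.add_const w)
    have e2 := (hasFDerivAt_of_contDiffOn hU (by norm_num) hL hU0).comp_hasDerivAt s hline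
    have := (e1.sub e2).sub ((hasDerivAt_id s).mul_const (fderiv ℝ (fderiv ℝ L) x w u))
    exact (this.congr_deriv (by simp)).hasDerivWithinAt
  have hb : ∀ s ∈ Set.Icc (-1 : ℝ) 1, ‖(fderiv ℝ L (x + s • u + w) - fderiv ℝ L (x + s • u)
      - fderiv ℝ (fderiv ℝ L) x w) u‖ ≤ B * (‖u‖ + ‖w‖) * ‖w‖ * ‖u‖ := fun s hs =>
    (ContinuousLinearMap.le_opNorm _ _).trans
        (mul_le_mul_of_nonneg_right (b1 s hs) (norm_nonneg _))
  have := (convex_Icc (-1 : ℝ) 1).norm_image_sub_le_of_norm_hasDerivWithin_le hd hb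
    (x := -1) (y := 1) (by norm_num) (by norm_num)
  rw [Real.norm_eq_abs] at this
  have h2 : ‖(1 : ℝ) - -1‖ = 2 := by norm_num
  rw [h2] at this
  have h3 : L (x + u + w) - L (x + u) - L (x - u + w) + L (x - u)
      - 2 * fderiv ℝ (fderiv ℝ L) x w u = L (x + (1 : ℝ) • u + w) - L (x + (1 : ℝ) • u)
        - 1 * fderiv ℝ (fderiv ℝ L) x w u - (L (x + (-1 : ℝ) • u + w) - L (x + (-1 : ℝ) • u)
        - (-1) * fderiv ℝ (fderiv ℝ L) x w u) := by
    rw [one_smul, neg_one_smul, ← sub_eq_add_neg]; ring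
  rw [h3]
  linarith

/-- A function that is `C^n` on an open set agrees near any compact subset with a compactly
supported `C^n` function. -/
lemma exists_contDiff_hasCompactSupport_eqOn [FiniteDimensional ℝ G] {n : ℕ∞} (hU : IsOpen U)
    (hL : ContDiffOn ℝ n L U) {C : Set G} (hC : IsCompact C) (hCU : C ⊆ U) :
    ∃ (f : G → ℝ) (N : Set G), IsOpen N ∧ C ⊆ N ∧ N ⊆ U ∧ Set.EqOn f L N ∧ ContDiff ℝ n f ∧
      HasCompactSupport f := by
  obtain ⟨K, hK, hCK, hKU⟩ := exists_compact_between hC hU hCU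
  obtain ⟨χ, hχ0, hχ1, -⟩ := exists_contMDiffMap_zero_one_nhds_of_isClosed (n := n)
    (modelWithCornersSelf ℝ G) (s := (interior K)ᶜ) (t := C) isOpen_interior.isClosed_compl
    hC.isClosed (Set.disjoint_left.2 fun x hx hxC => hx (hCK hxC))
  have hχ : ContDiff ℝ n χ := χ.contMDiff.contDiff
  obtain ⟨N, hN, hCN, hN1⟩ := eventually_nhdsSet_iff_exists.1 hχ1
  obtain ⟨O, hO, hKO, hO0⟩ := eventually_nhdsSet_iff_exists.1 hχ0
  refine ⟨fun x => χ x * L x, N ∩ interior K, hN.inter isOpen_interior, ?_, ?_, ?_, ?_, ?_⟩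
  · exact fun x hx => ⟨hCN hx, hCK hx⟩
  · exact fun x hx => hKU (interior_subset hx.2)
  · intro x hx
    simp [hN1 x hx.1]
  -- Outside `U` nothing is known about `L`, but there the cut-off vanishes in a whole
  -- neighbourhood.
  · rw [contDiff_iff_contDiffAt]
    intro x
    by_cases hx : x ∈ U
    · exact hχ.contDiffAt.mul (hL.contDiffAt (hU.mem_nhds hx))
    · have hxO : x ∈ O := hKO fun h => hx (hKU (interior_subset h))
      refine (contDiffAt_const (c := (0 : ℝ))).congr_of_eventuallyEq ?_
      filter_upwards [hO.mem_nhds hxO] with z hz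
      simp [hO0 z hz]
  · refine HasCompactSupport.intro hK fun x hx => ?_
    simp [hO0 x (hKO fun h => hx (interior_subset h))]

end Calculus

/-! ### Globally Lipschitz gradients and the descent inequality. -/

section GradientCutoff

variable {G : Type*} [NormedAddCommGroup G] [InnerProductSpace ℝ G] [FiniteDimensional ℝ G]

lemma exists_lipschitz_bounded_gradient {f : G → ℝ} (hf : ContDiff ℝ 2 f)
    (hc : HasCompactSupport f) :
    ∃ K M : NNReal, LipschitzWith K (gradient f) ∧ ∀ x, ‖gradient f x‖ ≤ M := by
  have h1 : ContDiff ℝ 1 (fderiv ℝ f) := hf.fderiv_right (by norm_num)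
  obtain ⟨K, hK⟩ := ContDiff.lipschitzWith_of_hasCompactSupport (hc.fderiv ℝ) h1 (by norm_num)
  obtain ⟨M, hM⟩ := h1.continuous.bounded_above_of_compact_support (hc.fderiv ℝ)
  refine ⟨K, M.toNNReal, ?_, fun x => ?_⟩
  · have := (InnerProductSpace.toDual ℝ G).symm.lipschitz.comp hK
    rw [one_mul] at this
    exact this
  · have h0 : 0 ≤ M := (norm_nonneg _).trans (hM 0)
    rw [Real.coe_toNNReal _ h0, gradient, LinearIsometryEquiv.norm_map]
    exact hM x

lemma inner_gradient (f : G → ℝ) (x u : G) : inner ℝ (gradient f x) u = fderiv ℝ f x u := by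
  rw [gradient, InnerProductSpace.toDual_symm_apply]

lemma gradient_eqOn {f h : G → ℝ} {N : Set G} (hN : IsOpen N) (hfh : Set.EqOn f h N) :
    Set.EqOn (gradient f) (gradient h) N := fun x hx => by
  have : f =ᶠ[𝓝 x] h := hfh.eventuallyEq_of_mem (hN.mem_nhds hx)
  rw [gradient, gradient, this.fderiv_eq]

lemma descent_of_lipschitz_gradient {f : G → ℝ} (hf : ContDiff ℝ 2 f) {K : NNReal}
    (hK : LipschitzWith K (gradient f)) (x y : G) :
    |f y - f x - inner ℝ (gradient f x) (y - x)| ≤ K * ‖y - x‖ ^ 2 := by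
  have hK' : LipschitzWith K (fderiv ℝ f) := by
    have := (InnerProductSpace.toDual ℝ G).lipschitz.comp hK
    rw [one_mul] at this
    have h : fderiv ℝ f = InnerProductSpace.toDual ℝ G ∘ gradient f := by
      ext1 x
      simp [gradient]
    rw [h]
    exact this
  rw [inner_gradient]
  refine taylor_one_segment isOpen_univ hf.contDiffOn (Set.subset_univ _) fun z _ => ?_
  exact norm_fderiv_le_of_lipschitz ℝ hK'

end GradientCutoff

/-! ### Compact parts of the smoothness region. -/

section Core

variable {G : Type*} [NormedAddCommGroup G] {U : Set G} {r : ℝ}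

/-- The points of norm at most `R` in the closure of the set of points at distance more than `r`
from the complement of `U`. -/
def core (U : Set G) (r R : ℝ) : Set G :=
  closure {x | Metric.closedBall x r ⊆ U} ∩ Metric.closedBall 0 R

/-- A limit point is within r of a point whose closed r-ball lies in `U`. This uniform margin keeps
limits of iterates inside the smoothness region. -/
lemma closure_subset_of_pos (hr : 0 < r) : closure {x | Metric.closedBall x r ⊆ U} ⊆ U := by
  intro x hx
  obtain ⟨z, hz, hxz⟩ := Metric.mem_closure_iff.1 hx r hr
  exact hz (Metric.mem_closedBall.2 hxz.le)

lemma core_subset (hr : 0 < r) (R : ℝ) : core U r R ⊆ U :=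
  Set.inter_subset_left.trans (closure_subset_of_pos hr)

lemma isCompact_core [ProperSpace G] (R : ℝ) : IsCompact (core U r R) :=
  (isCompact_closedBall 0 R).inter_left isClosed_closure

lemma mem_core {x : G} {R : ℝ} (hx : Metric.closedBall x r ⊆ U) (hR : ‖x‖ ≤ R) : x ∈ core U r R :=
  ⟨subset_closure hx, by simpa using hR⟩

end Core

/-! ### Pathwise convergence of the parameter iterates. -/

section Path

variable {p : ℕ}

open Classical in
/-- A path of a stochastic gradient recursion with bias `b` and noise `e` whose noise series
converges along the visits to every compact set. -/
structure DescentPath (L : E p → ℝ) (U : Set (E p)) (r : ℝ) (K : ℕ) (a : ℕ → ℝ)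
    (θ b e : ℕ → E p) : Prop where
  isOpen : IsOpen U
  contDiffOn : ContDiffOn ℝ 3 L U
  r_pos : 0 < r
  ball_subset : ∀ k ≥ K, Metric.closedBall (θ k) r ⊆ U
  a_pos : ∀ n, 0 < a n
  a_lim : Tendsto a atTop (𝓝 0)
  a_sum : Tendsto (fun n => ∑ k ∈ Finset.range n, a k) atTop atTop
  step : ∀ k ≥ K, θ (k + 1) = θ k - a k • (gradient L (θ k) + b k + e k)
  b_lim : Tendsto b atTop (𝓝 0)
  noise : ∀ R : ℕ, ∃ s, Tendsto (fun n => ∑ k ∈ Finset.range n,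
    if K ≤ k ∧ θ k ∈ core U r R then a k • e k else 0) atTop (𝓝 s)

namespace DescentPath

variable {L : E p → ℝ} {U : Set (E p)} {r : ℝ} {K : ℕ} {a : ℕ → ℝ} {θ b e : ℕ → E p} {z : E p}

/-- A cut-off loss with bounded Lipschitz gradient and the denoised iterates are produced together.
Agreement with the loss is needed on a thickening of the core because the denoised iterates are only
close to the actual ones. The recursion is claimed only at steps in the core, so no boundedness of
the path is presupposed. -/
lemma frame (h : DescentPath L U r K a θ b e) (R : ℕ) :
    ∃ (f : E p → ℝ) (y β : ℕ → E p) (κ M : NNReal) (δ : ℝ), 0 < δ ∧ ContDiff ℝ 2 f ∧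
      LipschitzWith κ (gradient f) ∧ (∀ x, ‖gradient f x‖ ≤ M) ∧
      (∀ x ∈ Metric.thickening δ (core U r R), f x = L x ∧ gradient f x = gradient L x) ∧
      Tendsto β atTop (𝓝 0) ∧ Tendsto (fun n => y n - θ n) atTop (𝓝 0) ∧
      ∀ᶠ n in atTop, θ n ∈ core U r R → y (n + 1) = y n - a n • (gradient f (y n) + β n) := by
  classical
  have hC := isCompact_core (U := U) (r := r) (R : ℝ)
  obtain ⟨f, N, hN, hCN, -, hfL, hf, hfc⟩ := exists_contDiff_hasCompactSupport_eqOn (n := 2)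
    h.isOpen (h.contDiffOn.of_le (by norm_num)) hC (core_subset h.r_pos _)
  obtain ⟨κ, M, hκ, hM⟩ := exists_lipschitz_bounded_gradient hf hfc
  obtain ⟨δ, hδ, hδN⟩ := hC.exists_thickening_subset_open hN hCN
  have hg := gradient_eqOn hN hfL
  obtain ⟨s, hs⟩ := h.noise R
  have hstep : ∀ᶠ n in atTop, (K ≤ n ∧ θ n ∈ core U r R) →
      θ (n + 1) = θ n - a n • (gradient f (θ n) + b n + e n) :=
    Eventually.of_forall fun n hn => by rw [hg (hCN hn.2)]; exact h.step n hn.1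
  obtain ⟨y, β, hβ, hy, hyβ⟩ := exists_denoised hκ hstep h.b_lim (by convert hs)
  refine ⟨f, y, β, κ, M, δ, hδ, hf, hκ, hM, fun x hx => ⟨hfL (hδN hx), hg (hδN hx)⟩, hβ, hy, ?_⟩
  filter_upwards [hyβ, eventually_ge_atTop K] with n hn hK hθ using hn ⟨hK, hθ⟩

lemma eventually_mem_core (h : DescentPath L U r K a θ b e) {R : ℝ}
    (hR : ∀ᶠ k in atTop, ‖θ k‖ ≤ R) : ∀ᶠ k in atTop, θ k ∈ core U r R := by
  filter_upwards [hR, eventually_ge_atTop K] with k h1 h2 using mem_core (h.ball_subset k h2) h1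

lemma mapClusterPt_of_tendsto_sub {x y : ℕ → E p} (h : Tendsto (fun n => y n - x n) atTop (𝓝 0))
    {q : E p} (hq : MapClusterPt q atTop x) : MapClusterPt q atTop y := by
  rw [mapClusterPt_iff_norm] at hq ⊢
  intro ε hε
  have h1 : ∀ᶠ n in atTop, ‖y n - x n‖ < ε / 2 := by
    simpa [dist_eq_norm] using Metric.tendsto_nhds.1 h (ε / 2) (half_pos hε)
  refine ((hq (ε / 2) (half_pos hε)).and_eventually h1).mono fun n hn => ?_
  calc _ ≤ _ := norm_sub_le_norm_sub_add_norm_sub (y n) (x n) q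
    _ < ε := by linarith [hn.1, hn.2]

/-- Convergence of a bounded path to an asymptotically stable equilibrium. -/
theorem tendsto_of_bounded (h : DescentPath L U r K a θ b e) {R : ℝ} (hR : ∀ k, ‖θ k‖ ≤ R)
    (hz : AsymptoticallyStable (gradient L) z) {A : Set (E p)} (hA : IsCompact A)
    (hAz : A ⊆ attractionDomain (gradient L) z) (hfreq : ∃ᶠ k in atTop, θ k ∈ A) :
    Tendsto θ atTop (𝓝 z) := by
  obtain ⟨R', hR'⟩ := exists_nat_ge R
  obtain ⟨f, y, β, κ, M, δ, hδ, -, hκ, hM, hfL, hβ, hyθ, hstep⟩ := h.frame R'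
  have hθC := h.eventually_mem_core (R := R') (Eventually.of_forall fun k => (hR k).trans hR')
  have hθy : Tendsto (fun n => θ n - y n) atTop (𝓝 0) := by simpa using hyθ.neg
  have hE : EulerScheme (gradient f) a y β :=
    { a_pos := h.a_pos
      a_lim := h.a_lim
      a_sum := h.a_sum
      step := by filter_upwards [hstep, hθC] with n h1 h2 using h1 h2
      β_lim := hβ }
  -- Both sequences have the same cluster points, and those of the iterates stay in the closed core.
  have hcl : ∀ q, MapClusterPt q atTop y → q ∈ Metric.thickening δ (core U r R') := fun q hq => by
    have hq' := mapClusterPt_of_tendsto_sub hθy hq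
    exact Metric.self_subset_thickening hδ _
      ((isCompact_core (R' : ℝ)).isClosed.mem_of_mapClusterPt hq' hθC)
  obtain ⟨x₀, hx₀, hx₀c⟩ := hA.exists_mapClusterPt_of_frequently hfreq
  have hyb : ∀ᶠ n in atTop, y n ∈ Metric.closedBall (0 : E p) (R + 1) := by
    have h1 : ∀ᶠ n in atTop, ‖y n - θ n‖ < 1 := by
      simpa [dist_eq_norm] using Metric.tendsto_nhds.1 hyθ 1 one_pos
    filter_upwards [h1] with n hn
    rw [mem_closedBall_zero_iff]
    have := norm_le_norm_add_norm_sub' (y n) (θ n)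
    linarith [hR n]
  have hy := hE.tendsto_of_asymptoticallyStable hκ hM Metric.isOpen_thickening
    (fun x hx => (hfL x hx).2.symm) hcl (isCompact_closedBall 0 (R + 1)) hyb hz (hAz hx₀)
    (mapClusterPt_of_tendsto_sub hyθ hx₀c)
  simpa using hθy.add hy

/-- High values keep x away from z, and then the gradient assumption applies. If z is a limit of
admissible points, it lies in `U` and continuity at z separates them; otherwise the admissible
points already stay away from z. Thus z need not be known to lie in `U`. -/
lemma exists_gradient_bound (hU : IsOpen U) (hL : ContinuousOn L U) (hr : 0 < r)
    (hgrad : ∀ C > 0, ∃ η > 0, ∀ x, ‖x - z‖ > C → η ≤ ‖gradient L x‖) {c : ℝ} (hc : 0 < c) :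
    ∃ η > 0, ∀ x, Metric.closedBall x r ⊆ U → L z + c ≤ L x → η ≤ ‖gradient L x‖ := by
  obtain ⟨ρ, hρ, hρx⟩ : ∃ ρ > 0, ∀ x, Metric.closedBall x r ⊆ U → L z + c ≤ L x →
      ρ < ‖x - z‖ := by
    by_cases hz : z ∈ closure {x | Metric.closedBall x r ⊆ U}
    · have hzU := closure_subset_of_pos hr hz
      have := (hL.continuousAt (hU.mem_nhds hzU)).eventually
        (gt_mem_nhds (show L z < L z + c by linarith))
      obtain ⟨ρ, hρ, hρx⟩ := Metric.eventually_nhds_iff.1 this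
      refine ⟨ρ / 2, half_pos hρ, fun x _ hx => ?_⟩
      by_contra hcon
      have := hρx (y := x) (by rw [dist_eq_norm]; linarith)
      linarith
    · obtain ⟨ρ, hρ, hρx⟩ := Metric.mem_nhds_iff.1 (isClosed_closure.isOpen_compl.mem_nhds hz)
      refine ⟨ρ / 2, half_pos hρ, fun x hx _ => ?_⟩
      by_contra hcon
      exact hρx (show x ∈ Metric.ball z ρ by rw [Metric.mem_ball, dist_eq_norm]; linarith)
        (subset_closure hx)
  obtain ⟨η, hη, hηx⟩ := hgrad ρ hρ
  exact ⟨η, hη, fun x h1 h2 => hηx x (hρx x h1 h2)⟩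

/-- A perturbation of at most half the gradient norm leaves a first-order decrease of at least α
η²/2, of which the quadratic error, controlled by (M + 1)², consumes at most half. -/
lemma descent_step {f : E p → ℝ} (hf : ContDiff ℝ 2 f) {κ M : NNReal}
    (hκ : LipschitzWith κ (gradient f)) (hM : ∀ x, ‖gradient f x‖ ≤ M) {x β : E p} {α η : ℝ}
    (hα : 0 < α) (hη : η ≤ ‖gradient f x‖) (hη0 : 0 < η) (hβ1 : ‖β‖ ≤ 1) (hβ : ‖β‖ ≤ η / 2)
    (hα' : κ * α * (M + 1) ^ 2 ≤ η ^ 2 / 4) :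
    f (x - α • (gradient f x + β)) ≤ f x - α * (η ^ 2 / 4) := by
  have h1 := (abs_le.1 (descent_of_lipschitz_gradient hf hκ x (x - α • (gradient f x + β)))).2
  rw [sub_sub_cancel_left, norm_neg, norm_smul, Real.norm_of_nonneg hα.le, inner_neg_right,
    inner_smul_right, inner_add_right, real_inner_self_eq_norm_sq] at h1
  have h2 : |inner ℝ (gradient f x) β| ≤ ‖gradient f x‖ * ‖β‖ := abs_real_inner_le_norm _ _
  have h3 : ‖gradient f x + β‖ ≤ M + 1 := (norm_add_le _ _).trans (add_le_add (hM x) hβ1)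
  have h4 : ‖gradient f x + β‖ ^ 2 ≤ (M + 1) ^ 2 := pow_le_pow_left₀ (norm_nonneg _) h3 2
  have h5 : κ * (α * ‖gradient f x + β‖) ^ 2 ≤ α * (η ^ 2 / 4) := by
    calc _ = κ * α * α * ‖gradient f x + β‖ ^ 2 := by ring
      _ ≤ κ * α * α * (M + 1) ^ 2 := by gcongr
      _ = α * (κ * α * (M + 1) ^ 2) := by ring
      _ ≤ _ := by gcongr
  have h6 : η ^ 2 / 2 ≤ ‖gradient f x‖ ^ 2 + inner ℝ (gradient f x) β := by
    have := (abs_le.1 h2).1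
    nlinarith [norm_nonneg (gradient f x)]
  have h7 := mul_le_mul_of_nonneg_left h6 hα.le
  linarith

lemma abs_sub_le_of_gradient_bound {f : E p → ℝ} (hf : ContDiff ℝ 2 f) {M : NNReal}
    (hM : ∀ x, ‖gradient f x‖ ≤ M) (x y : E p) : |f x - f y| ≤ M * ‖x - y‖ := by
  refine convex_univ.norm_image_sub_le_of_norm_fderiv_le (𝕜 := ℝ) (f := f)
    (fun z _ => (hf.differentiable (by norm_num)).differentiableAt) (fun z _ => ?_)
    (Set.mem_univ y) (Set.mem_univ x)
  have := hM z
  rwa [gradient, LinearIsometryEquiv.norm_map] at this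

/-- Eventual smallness of the quantities that control one step of the denoised recursion. -/
lemma eventually_small (h : DescentPath L U r K a θ b e) {y β : ℕ → E p} {R : ℕ}
    {f : E p → ℝ} {κ M : NNReal} (hM : ∀ x, ‖gradient f x‖ ≤ M)
    (hβ : Tendsto β atTop (𝓝 0)) (hyθ : Tendsto (fun n => y n - θ n) atTop (𝓝 0))
    (hstep : ∀ᶠ n in atTop, θ n ∈ core U r R →
      y (n + 1) = y n - a n • (gradient f (y n) + β n)) {η ε : ℝ} (hη : 0 < η) (hε : 0 < ε) :
    ∀ᶠ n in atTop, K ≤ n ∧ ‖y n - θ n‖ < ε ∧ ‖β n‖ ≤ 1 ∧ ‖β n‖ ≤ η / 2 ∧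
      κ * a n * (M + 1) ^ 2 ≤ η ^ 2 / 4 ∧ (θ n ∈ core U r R →
      ‖y (n + 1) - y n‖ < ε ∧ y (n + 1) = y n - a n • (gradient f (y n) + β n)) := by
  have e1 : ∀ᶠ n in atTop, ‖y n - θ n‖ < ε := by
    simpa [dist_eq_norm] using Metric.tendsto_nhds.1 hyθ ε hε
  have e2 : ∀ᶠ n in atTop, ‖β n‖ < min 1 (η / 2) := by
    simpa [dist_eq_norm] using Metric.tendsto_nhds.1 hβ (min 1 (η / 2)) (by positivity)
  have e3 : ∀ᶠ n in atTop, κ * a n * (M + 1) ^ 2 < η ^ 2 / 4 := by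
    have : Tendsto (fun n => κ * a n * ((M : ℝ) + 1) ^ 2) atTop (𝓝 0) := by
      simpa using (h.a_lim.const_mul (κ : ℝ)).mul_const (((M : ℝ) + 1) ^ 2)
    exact this.eventually (gt_mem_nhds (by positivity))
  have e4 : ∀ᶠ n in atTop, a n * (M + 1) < ε := by
    have : Tendsto (fun n => a n * ((M : ℝ) + 1)) atTop (𝓝 0) := by
      simpa using h.a_lim.mul_const ((M : ℝ) + 1)
    exact this.eventually (gt_mem_nhds hε)
  filter_upwards [e1, e2, e3, e4, eventually_ge_atTop K, hstep] with n h1 h2 h3 h4 h5 h6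
  have hb1 := h2.le.trans (min_le_left _ _)
  refine ⟨h5, h1, hb1, h2.le.trans (min_le_right _ _), h3.le, fun hθ => ⟨?_, h6 hθ⟩⟩
  rw [h6 hθ, sub_sub_cancel_left, norm_neg, norm_smul, Real.norm_of_nonneg (h.a_pos n).le]
  refine lt_of_le_of_lt ?_ h4
  exact mul_le_mul_of_nonneg_left ((norm_add_le _ _).trans (add_le_add (hM _) hb1)) (h.a_pos n).le

lemma closedBall_half_subset {x y : E p} (hx : Metric.closedBall x r ⊆ U) (h : ‖y - x‖ ≤ r / 2) :
    Metric.closedBall y (r / 2) ⊆ U := by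
  refine (Metric.closedBall_subset_closedBall' ?_).trans hx
  rw [dist_eq_norm]
  linarith

/-- A path that visits a sublevel set infinitely often finally stays in a larger one. -/
lemma eventually_lt_of_frequently_lt (h : DescentPath L U r K a θ b e)
    (hgrad : ∀ C > 0, ∃ η > 0, ∀ x, ‖x - z‖ > C → η ≤ ‖gradient L x‖)
    (hsub : ∀ C > 0, Bornology.IsBounded {x | L x ≤ L z + C}) {c : ℝ} (hc : 0 < c)
    (hfreq : ∃ᶠ k in atTop, L (θ k) < L z + c) : ∀ᶠ k in atTop, L (θ k) < L z + 4 * c := by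
  obtain ⟨η, hη, hηx⟩ := exists_gradient_bound h.isOpen h.contDiffOn.continuousOn
    (half_pos h.r_pos) hgrad hc
  obtain ⟨R₀, hR₀⟩ := (hsub (4 * c) (by positivity)).exists_norm_le
  -- The margin 2 covers one step of the denoised path and its distance to the iterate, each below
  -- 1, so that membership in the core persists.
  obtain ⟨R, hR⟩ := exists_nat_ge (R₀ + 2)
  obtain ⟨f, y, β, κ, M, δ, hδ, hf, hκ, hM, hfL, hβ, hyθ, hstep⟩ := h.frame R
  set ε := min (min δ (r / 2)) (min 1 (c / (4 * (M + 1)))) with hε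
  have hr := h.r_pos
  have hε0 : 0 < ε := by positivity
  have hεδ : ε ≤ δ := (min_le_left _ _).trans (min_le_left _ _)
  have hεr : ε ≤ r / 2 := (min_le_left _ _).trans (min_le_right _ _)
  have hε1 : ε ≤ 1 := (min_le_right _ _).trans (min_le_left _ _)
  have hεM : (M : ℝ) * ε ≤ c / 4 := by
    have : ε ≤ c / (4 * (M + 1)) := (min_le_right _ _).trans (min_le_right _ _)
    rw [le_div_iff₀ (by positivity)] at this
    linarith
  have hsm := h.eventually_small (κ := κ) hM hβ hyθ hstep hη hε0
  obtain ⟨n₀, hn₀⟩ := eventually_atTop.1 hsm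
  have hlip := abs_sub_le_of_gradient_bound hf hM
  have hyc : ∀ k ≥ n₀, |f (y k) - f (θ k)| ≤ c / 4 := fun k hk => by
    refine (hlip _ _).trans (le_trans ?_ hεM)
    exact mul_le_mul_of_nonneg_left (hn₀ k hk).2.1.le M.2
  obtain ⟨n₁, hn₁, hlt⟩ := frequently_atTop.1 hfreq n₀
  have hfθ : ∀ k, θ k ∈ core U r R → f (θ k) = L (θ k) := fun k hk =>
    (hfL _ (Metric.self_subset_thickening hδ _ hk)).1
  have hthick : ∀ k ≥ n₀, θ k ∈ core U r R → y k ∈ Metric.thickening δ (core U r R) :=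
    fun k hk hC => Metric.mem_thickening_iff.2 ⟨θ k, hC, by
      rw [dist_eq_norm]; linarith [(hn₀ k hk).2.1]⟩
  -- Core membership and the bound on the values are carried along together: the recursion is
  -- available only in the core, and the sublevel bound keeps the path there.
  have hmain : ∀ k ≥ n₁, θ k ∈ core U r R ∧ f (y k) ≤ L z + 2 * c := by
    intro k hk
    induction k, hk using Nat.le_induction with
    | base =>
      have hC : θ n₁ ∈ core U r R := mem_core (h.ball_subset _ (hn₀ n₁ hn₁).1) (by
        have := hR₀ (θ n₁) (show L (θ n₁) ≤ L z + 4 * c by linarith)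
        linarith)
      refine ⟨hC, ?_⟩
      have := (abs_le.1 (hyc n₁ hn₁)).2
      rw [hfθ _ hC] at this
      linarith
    | succ k hk ih =>
      obtain ⟨hC, hle⟩ := ih
      have hk0 := hn₁.trans hk
      obtain ⟨hKk, hyk, hb1, hb2, hak, hst⟩ := hn₀ k hk0
      obtain ⟨hs1, hs2⟩ := hst hC
      have hyL := hfL _ (hthick k hk0 hC)
      have hyR := hR₀ (y k) (show L (y k) ≤ L z + 4 * c by rw [← hyL.1]; linarith)
      have hn' := (hn₀ (k + 1) (by omega)).2.1
      have hC' : θ (k + 1) ∈ core U r R := by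
        refine mem_core (h.ball_subset _ (by omega)) ?_
        have e1 := norm_le_norm_add_norm_sub' (y (k + 1)) (y k)
        have e2 := norm_le_norm_add_norm_sub (y (k + 1)) (θ (k + 1))
        linarith
      refine ⟨hC', ?_⟩
      -- Below level c a single step raises the value by at most c/4; above it the step is a
      -- descent. Neither can cross level 2c.
      rcases le_or_gt (f (y k)) (L z + c) with hlow | hhigh
      · have e1 := (abs_le.1 (hlip (y (k + 1)) (y k))).2
        have e2 : (M : ℝ) * ‖y (k + 1) - y k‖ ≤ M * ε := mul_le_mul_of_nonneg_left hs1.le M.2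
        linarith
      · have hg := hηx (y k) (closedBall_half_subset (h.ball_subset k hKk) (by linarith))
          (by rw [← hyL.1]; exact hhigh.le)
        rw [← hyL.2] at hg
        have := descent_step hf hκ hM (h.a_pos k) hg hη hb1 hb2 hak
        rw [← hs2] at this
        have := mul_pos (h.a_pos k) (show 0 < η ^ 2 / 4 by positivity)
        linarith
  filter_upwards [eventually_ge_atTop n₁] with k hk
  obtain ⟨hC, hle⟩ := hmain k hk
  have := (abs_le.1 (hyc k (hn₁.trans hk))).1
  rw [hfθ _ hC] at this
  linarith

/-- A bounded path comes close to the minimal value infinitely often. -/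
lemma frequently_lt_of_bounded (h : DescentPath L U r K a θ b e)
    (hgrad : ∀ C > 0, ∃ η > 0, ∀ x, ‖x - z‖ > C → η ≤ ‖gradient L x‖) {R : ℝ}
    (hR : ∀ᶠ k in atTop, ‖θ k‖ ≤ R) {c : ℝ} (hc : 0 < c) :
    ∃ᶠ k in atTop, L (θ k) < L z + c := by
  by_contra hnot
  rw [not_frequently] at hnot
  simp only [not_lt] at hnot
  obtain ⟨η, hη, hηx⟩ := exists_gradient_bound h.isOpen h.contDiffOn.continuousOn
    (half_pos h.r_pos) hgrad (half_pos hc)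
  obtain ⟨R', hR'⟩ := exists_nat_ge R
  obtain ⟨f, y, β, κ, M, δ, hδ, hf, hκ, hM, hfL, hβ, hyθ, hstep⟩ := h.frame R'
  have hθC := h.eventually_mem_core (R := R') (hR.mono fun k hk => hk.trans hR')
  have hr := h.r_pos
  set ε := min (min δ (r / 2)) (c / (2 * (M + 1))) with hε
  have hε0 : 0 < ε := by positivity
  have hεδ : ε ≤ δ := (min_le_left _ _).trans (min_le_left _ _)
  have hεr : ε ≤ r / 2 := (min_le_left _ _).trans (min_le_right _ _)
  have hεM : (M : ℝ) * ε ≤ c / 2 := by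
    have : ε ≤ c / (2 * (M + 1)) := min_le_right _ _
    rw [le_div_iff₀ (by positivity)] at this
    linarith
  have hsm := h.eventually_small (κ := κ) hM hβ hyθ hstep hη hε0
  have hlip := abs_sub_le_of_gradient_bound hf hM
  obtain ⟨n₀, hn₀⟩ := eventually_atTop.1 (hsm.and (hθC.and hnot))
  have hlow : ∀ k ≥ n₀, L z + c / 2 ≤ f (y k) ∧ y k ∈ Metric.thickening δ (core U r R') := by
    intro k hk
    obtain ⟨⟨hKk, hyk, -⟩, hC, hL⟩ := hn₀ k hk
    refine ⟨?_, Metric.mem_thickening_iff.2 ⟨θ k, hC, by rw [dist_eq_norm]; linarith⟩⟩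
    have e1 := (abs_le.1 (hlip (y k) (θ k))).1
    have e2 : (M : ℝ) * ‖y k - θ k‖ ≤ M * ε := mul_le_mul_of_nonneg_left hyk.le M.2
    rw [(hfL _ (Metric.self_subset_thickening hδ _ hC)).1] at e1
    linarith
  -- If the values stayed above level c, every step would decrease f by a fixed multiple of its
  -- stepsize, and the divergent sum of stepsizes would contradict the lower bound.
  have hdec : ∀ k ≥ n₀, f (y k) ≤ f (y n₀) -
      (∑ i ∈ Finset.range k, a i - ∑ i ∈ Finset.range n₀, a i) * (η ^ 2 / 4) := by
    intro k hk
    induction k, hk using Nat.le_induction with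
    | base => simp
    | succ k hk ih =>
      obtain ⟨⟨hKk, hyk, hb1, hb2, hak, hst⟩, hC, hL⟩ := hn₀ k hk
      obtain ⟨hs1, hs2⟩ := hst hC
      obtain ⟨hl1, hl2⟩ := hlow k hk
      have hyL := hfL _ hl2
      have hg := hηx (y k) (closedBall_half_subset (h.ball_subset k hKk) (by linarith))
          (by rw [← hyL.1]; exact hl1)
      rw [← hyL.2] at hg
      have := descent_step hf hκ hM (h.a_pos k) hg hη hb1 hb2 hak
      rw [← hs2] at this
      rw [Finset.sum_range_succ]
      linarith
  have htop : Tendsto (fun k => (∑ i ∈ Finset.range k, a i - ∑ i ∈ Finset.range n₀, a i)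
      * (η ^ 2 / 4)) atTop atTop :=
    (tendsto_atTop_add_const_right _ _ h.a_sum).atTop_mul_const (by positivity)
  obtain ⟨k, hk1, hk2⟩ := ((htop.eventually_gt_atTop (f (y n₀) - L z)).and
    (eventually_ge_atTop n₀)).exists
  have := hdec k hk2
  have := (hlow k hk2).1
  linarith

/-- Convergence to a unique minimizer of a path along which the values do not tend to infinity. -/
theorem tendsto_of_frequently_lt (h : DescentPath L U r K a θ b e)
    (hgrad : ∀ C > 0, ∃ η > 0, ∀ x, ‖x - z‖ > C → η ≤ ‖gradient L x‖)
    (hsub : ∀ C > 0, Bornology.IsBounded {x | L x ≤ L z + C})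
    (hgap : ∀ C > 0, ∃ η > 0, ∀ x, ‖x - z‖ > C → η ≤ L x - L z) {c : ℝ} (hc : 0 < c)
    (hfreq : ∃ᶠ k in atTop, L (θ k) < L z + c) : Tendsto θ atTop (𝓝 z) := by
  obtain ⟨R, hR⟩ := (hsub (4 * c) (by positivity)).exists_norm_le
  have hbdd : ∀ᶠ k in atTop, ‖θ k‖ ≤ R :=
    (h.eventually_lt_of_frequently_lt hgrad hsub hc hfreq).mono fun k hk => hR _ hk.le
  rw [Metric.tendsto_nhds]
  intro ε hε
  obtain ⟨η, hη, hηx⟩ := hgap (ε / 2) (half_pos hε)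
  -- The trapping lemma loses a factor 4, so level η/4 keeps the values below the gap η.
  filter_upwards [h.eventually_lt_of_frequently_lt hgrad hsub (show 0 < η / 4 by positivity)
    (h.frequently_lt_of_bounded hgrad hbdd (by positivity))] with k hk
  rw [dist_eq_norm]
  by_contra hcon
  have := hηx (θ k) (by linarith)
  linarith

end DescentPath

end Path

/-! ### Conditional means and variances of products. -/

section ConditionalMoments

variable {Ω : Type*} {m m₁ m₀ : MeasurableSpace Ω} {P : Measure[m₀] Ω} {X Y : Ω → ℝ}

lemma condExp_mul_eq_zero (hm₁ : m₁ ≤ m) (hm : m ≤ m₀) [IsFiniteMeasure P]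
    (hY : StronglyMeasurable[m] Y) (hX : Integrable X P) (hYX : Integrable (Y * X) P)
    (h0 : P[X | m] =ᵐ[P] 0) : P[Y * X | m₁] =ᵐ[P] 0 := by
  have h1 : P[Y * X | m] =ᵐ[P] 0 := by
    filter_upwards [condExp_mul_of_stronglyMeasurable_left hY hYX hX, h0] with ω h1 h2
    rw [h1, Pi.mul_apply, h2, Pi.zero_apply, mul_zero]
  refine (condExp_condExp_of_le hm₁ hm).symm.trans ((condExp_congr_ae h1).trans ?_)
  rw [condExp_zero]

lemma integral_mul_eq_zero (hm : m ≤ m₀) [IsFiniteMeasure P]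
    (hY : StronglyMeasurable[m] Y) (hX : Integrable X P) (hYX : Integrable (Y * X) P)
    (h0 : P[X | m] =ᵐ[P] 0) : ∫ ω, Y ω * X ω ∂P = 0 := by
  have h1 := condExp_mul_eq_zero le_rfl hm hY hX hYX h0
  have h2 : ∫ ω, (P[Y * X | m]) ω ∂P = ∫ ω, (Y * X) ω ∂P := integral_condExp hm
  rw [integral_congr_ae h1] at h2
  simpa using h2.symm

/-- The measure with density X, restricted to the smaller σ-algebra, is dominated by D times the
restricted measure, as seen on measurable sets. Hence f needs no integrability. -/
lemma lintegral_mul_le_of_condExp_le (hm : m ≤ m₀) [IsFiniteMeasure P] {D : ℝ}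
    (hX0 : ∀ ω, 0 ≤ X ω) (hX : Integrable X P) (hD : ∀ᵐ ω ∂P, (P[X | m]) ω ≤ D)
    {f : Ω → ENNReal} (hf : Measurable[m] f) :
    ∫⁻ ω, f ω * ENNReal.ofReal (X ω) ∂P ≤ ENNReal.ofReal D * ∫⁻ ω, f ω ∂P := by
  set ν := P.withDensity fun ω => ENNReal.ofReal (X ω) with hν
  have hXm : AEMeasurable (fun ω => ENNReal.ofReal (X ω)) P :=
    hX.aestronglyMeasurable.aemeasurable.ennreal_ofReal
  have hle : ν.trim hm ≤ ENNReal.ofReal D • P.trim hm := by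
    refine Measure.le_iff.2 fun s hs => ?_
    rw [Measure.smul_apply, trim_measurableSet_eq hm hs, trim_measurableSet_eq hm hs, hν,
      withDensity_apply _ (hm s hs), ← ofReal_integral_eq_lintegral_ofReal hX.integrableOn
      (Eventually.of_forall hX0), ← setIntegral_condExp hm hX hs, smul_eq_mul]
    have h1 : ∫ ω in s, (P[X | m]) ω ∂P ≤ ∫ _ in s, D ∂P :=
      setIntegral_mono_ae integrable_condExp.integrableOn (integrable_const D).integrableOn hD
    rw [setIntegral_const, smul_eq_mul] at h1
    refine (ENNReal.ofReal_le_ofReal h1).trans ?_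
    rw [ENNReal.ofReal_mul measureReal_nonneg, ofReal_measureReal, mul_comm]
  calc ∫⁻ ω, f ω * ENNReal.ofReal (X ω) ∂P = ∫⁻ ω, f ω ∂ν := by
        rw [hν, lintegral_withDensity_eq_lintegral_mul₀ hXm (hf.mono hm le_rfl).aemeasurable]
        refine lintegral_congr fun ω => ?_
        rw [Pi.mul_apply, mul_comm]
    _ = ∫⁻ ω, f ω ∂(ν.trim hm) := (lintegral_trim hm hf).symm
    _ ≤ ∫⁻ ω, f ω ∂(ENNReal.ofReal D • P.trim hm) := lintegral_mono' hle le_rfl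
    _ = _ := by rw [lintegral_smul_measure, lintegral_trim hm hf, smul_eq_mul]

lemma lintegral_ofReal_sq (hY : MemLp Y 2 P) :
    ∫⁻ ω, ENNReal.ofReal (Y ω ^ 2) ∂P = ENNReal.ofReal (∫ ω, Y ω ^ 2 ∂P) :=
  (ofReal_integral_eq_lintegral_ofReal hY.integrable_sq
    (Eventually.of_forall fun ω => sq_nonneg (Y ω))).symm

/-- A factor with bounded conditional second moment can be integrated out. -/
lemma memLp_mul_of_condExp_sq_le (hm : m ≤ m₀) [IsFiniteMeasure P] {D : ℝ}
    (hX : MemLp X 2 P) (hD : ∀ᵐ ω ∂P, (P[fun ω => X ω ^ 2 | m]) ω ≤ D)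
    (hY : StronglyMeasurable[m] Y) (hY2 : MemLp Y 2 P) :
    MemLp (Y * X) 2 P ∧ ∫ ω, (Y ω * X ω) ^ 2 ∂P ≤ max D 0 * ∫ ω, Y ω ^ 2 ∂P := by
  have hb := lintegral_mul_le_of_condExp_le hm (fun ω => sq_nonneg (X ω)) hX.integrable_sq hD
    (f := fun ω => ENNReal.ofReal (Y ω ^ 2)) ((hY.measurable.pow_const 2).ennreal_ofReal)
  have hYX : AEStronglyMeasurable (Y * X) P :=
    (hY.mono hm).aestronglyMeasurable.mul hX.aestronglyMeasurable
  have hb' : ∫⁻ ω, ENNReal.ofReal ((Y ω * X ω) ^ 2) ∂P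
      ≤ ENNReal.ofReal (max D 0 * ∫ ω, Y ω ^ 2 ∂P) := by
    calc _ = ∫⁻ ω, ENNReal.ofReal (Y ω ^ 2) * ENNReal.ofReal (X ω ^ 2) ∂P := by
          refine lintegral_congr fun ω => ?_
          rw [mul_pow, ENNReal.ofReal_mul (sq_nonneg _)]
      _ ≤ _ := hb
      _ = ENNReal.ofReal (max D 0) * ENNReal.ofReal (∫ ω, Y ω ^ 2 ∂P) := by
          rw [lintegral_ofReal_sq hY2, max_comm, ENNReal.ofReal_max]
          simp
      _ = _ := by rw [ENNReal.ofReal_mul (le_max_right _ _)]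
  have hint : Integrable (fun ω => (Y ω * X ω) ^ 2) P := by
    refine ⟨hYX.pow 2, ?_⟩
    rw [hasFiniteIntegral_iff_ofReal (Eventually.of_forall fun ω => sq_nonneg _)]
    exact hb'.trans_lt ENNReal.ofReal_lt_top
  refine ⟨(memLp_two_iff_integrable_sq hYX).2 hint, ?_⟩
  rw [← ofReal_integral_eq_lintegral_ofReal hint (Eventually.of_forall fun ω => sq_nonneg _)] at hb'
  exact (ENNReal.ofReal_le_ofReal_iff (mul_nonneg (le_max_right _ _)
    (integral_nonneg fun ω => sq_nonneg _))).1 hb'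

lemma integral_le_of_condExp_le (hm : m ≤ m₀) [IsProbabilityMeasure P] {D : ℝ}
    (hD : ∀ᵐ ω ∂P, (P[X | m]) ω ≤ D) : ∫ ω, X ω ∂P ≤ D := by
  rw [← integral_condExp hm]
  calc _ ≤ ∫ _, D ∂P := integral_mono_ae integrable_condExp (integrable_const D) hD
    _ = D := by simp

lemma integral_condExp_sq_le [IsProbabilityMeasure P] (hX : MemLp X 2 P) :
    ∫ ω, (P[X | m]) ω ^ 2 ∂P ≤ ∫ ω, X ω ^ 2 ∂P := by
  have h1 : eLpNorm (P[X | m]) 2 P ≤ eLpNorm X 2 P := eLpNorm_condExp_le_eLpNorm X (by norm_num)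
  have hC : MemLp (P[X | m]) 2 P := hX.condExp (by norm_num)
  rw [hC.eLpNorm_eq_integral_rpow_norm (by norm_num) (by norm_num),
    hX.eLpNorm_eq_integral_rpow_norm (by norm_num) (by norm_num)] at h1
  have h2 := (ENNReal.ofReal_le_ofReal_iff (by positivity)).1 h1
  have h3 := (Real.rpow_le_rpow_iff (integral_nonneg fun ω => by positivity)
    (integral_nonneg fun ω => by positivity) (by norm_num)).1 h2
  simpa using h3

end ConditionalMoments

/-! ### Conditioning on a σ-algebra independent of the noise source. -/

section Independence

variable {Ω Ξ α : Type*} {m m₁ m₀ : MeasurableSpace Ω} [MeasurableSpace Ξ] [MeasurableSpace α]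
  {P : Measure[m₀] Ω}

/-- Conditional expectation of a function of a measurable part and an independent part. -/
lemma condExp_eq_integral_of_indep (hm : m ≤ m₀) [IsProbabilityMeasure P] {ξ : Ω → Ξ}
    (hξ : Measurable ξ) (hind : Indep (MeasurableSpace.comap ξ inferInstance) m P) {X : Ω → α}
    (hX : Measurable[m] X) {f : α × Ξ → ℝ} (hf : Measurable f)
    (hint : Integrable (fun ω => f (X ω, ξ ω)) P) :
    P[fun ω => f (X ω, ξ ω) | m] =ᵐ[P] fun ω => ∫ e, f (X ω, e) ∂(P.map ξ) := by
  have hX₀ : Measurable X := hX.mono hm le_rfl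
  have : IsProbabilityMeasure (P.map ξ) := Measure.isProbabilityMeasure_map hξ.aemeasurable
  have hφ : StronglyMeasurable fun x => ∫ e, f (x, e) ∂(P.map ξ) :=
    StronglyMeasurable.integral_prod_right (f := fun x e => f (x, e)) hf.stronglyMeasurable
  have key : ∀ s : Set Ω, MeasurableSet[m] s →
      Integrable (s.indicator fun ω => ∫ e, f (X ω, e) ∂(P.map ξ)) P ∧
      ∫ ω in s, ∫ e, f (X ω, e) ∂(P.map ξ) ∂P = ∫ ω in s, f (X ω, ξ ω) ∂P := by
    intro s hs
    have hs₀ := hm s hs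
    -- Bundling X with the indicator of the test set keeps the variable independent of ξ and turns
    -- the integral over s into one over a product measure, to which Fubini applies.
    set Z : Ω → α × ℝ := fun ω => (X ω, s.indicator (fun _ => (1 : ℝ)) ω) with hZ
    have hZm : Measurable[m] Z := hX.prodMk (measurable_const.indicator hs)
    have hZ₀ : Measurable Z := hZm.mono hm le_rfl
    have : IsProbabilityMeasure (P.map Z) := Measure.isProbabilityMeasure_map hZ₀.aemeasurable
    have hZξ : IndepFun Z ξ P := by
      rw [IndepFun_iff_Indep]
      exact indep_of_indep_of_le_left hind.symm hZm.comap_le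
    have hmap := (indepFun_iff_map_prod_eq_prod_map_map hZ₀.aemeasurable hξ.aemeasurable).1 hZξ
    set F : (α × ℝ) × Ξ → ℝ := fun q => q.1.2 * f (q.1.1, q.2) with hF
    have hFm : Measurable F := by fun_prop
    have e1 : ∀ ω, F (Z ω, ξ ω) = s.indicator (fun ω => f (X ω, ξ ω)) ω := fun ω => by
      by_cases hω : ω ∈ s <;> simp [hF, hZ, hω]
    have hi1 : Integrable F (P.map fun ω => (Z ω, ξ ω)) := by
      rw [integrable_map_measure hFm.aestronglyMeasurable (hZ₀.prodMk hξ).aemeasurable]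
      refine (hint.indicator hs₀).congr (Eventually.of_forall fun ω => (e1 ω).symm)
    have e2 : ∫ ω in s, f (X ω, ξ ω) ∂P = ∫ q, F q ∂(P.map fun ω => (Z ω, ξ ω)) := by
      rw [integral_map (hZ₀.prodMk hξ).aemeasurable hFm.aestronglyMeasurable,
        ← integral_indicator hs₀]
      exact integral_congr_ae (Eventually.of_forall fun ω => (e1 ω).symm)
    rw [hmap] at hi1 e2
    have e3 : ∀ ω, ∫ e, F (Z ω, e) ∂(P.map ξ) =
        s.indicator (fun ω => ∫ e, f (X ω, e) ∂(P.map ξ)) ω := fun ω => by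
      by_cases hω : ω ∈ s <;> simp [hF, hZ, hω]
    have hG : StronglyMeasurable fun q : α × ℝ => ∫ e, F (q, e) ∂(P.map ξ) :=
      StronglyMeasurable.integral_prod_right (f := fun x e => F (x, e)) hFm.stronglyMeasurable
    constructor
    · have := hi1.integral_prod_left
      rw [integrable_map_measure hG.aestronglyMeasurable hZ₀.aemeasurable] at this
      exact this.congr (Eventually.of_forall e3)
    · rw [e2, integral_prod _ hi1, integral_map hZ₀.aemeasurable hG.aestronglyMeasurable,
        ← integral_indicator hs₀]
      exact integral_congr_ae (Eventually.of_forall fun ω => (e3 ω).symm)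
  refine (ae_eq_condExp_of_forall_setIntegral_eq hm hint (fun s hs _ => ?_)
    (fun s hs _ => (key s hs).2) ?_).symm
  · exact (integrable_indicator_iff (hm s hs)).1 (key s hs).1
  · exact (hφ.comp_measurable hX).aestronglyMeasurable

/-- Both sides equal the integral against the law of ξ with X frozen. This transfers moment
conditions given only the query data to the full history and perturbations. -/
lemma condExp_congr_of_indep (hm₁ : m₁ ≤ m) (hm : m ≤ m₀) [IsProbabilityMeasure P] {ξ : Ω → Ξ}
    (hξ : Measurable ξ) (hind : Indep (MeasurableSpace.comap ξ inferInstance) m P) {X : Ω → α}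
    (hX : Measurable[m₁] X) {f : α × Ξ → ℝ} (hf : Measurable f)
    (hint : Integrable (fun ω => f (X ω, ξ ω)) P) :
    P[fun ω => f (X ω, ξ ω) | m] =ᵐ[P] P[fun ω => f (X ω, ξ ω) | m₁] :=
  (condExp_eq_integral_of_indep hm hξ hind (hX.mono hm₁ le_rfl) hf hint).trans
    (condExp_eq_integral_of_indep (hm₁.trans hm) hξ (indep_of_indep_of_le_right hind hm₁) hX hf
      hint).symm

end Independence

/-! ### Almost sure convergence of martingale series. -/

section Series

variable {Ω : Type*} {m₀ : MeasurableSpace Ω} {P : Measure Ω} [IsProbabilityMeasure P]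

/-- A series of martingale differences with summable variances converges almost surely. -/
theorem ae_tendsto_sum_of_summable_variance (ℱ : Filtration ℕ m₀) {d : ℕ → Ω → ℝ} {s : ℕ → ℝ}
    (hd : ∀ k, StronglyMeasurable[ℱ (k + 1)] (d k)) (hd2 : ∀ k, MemLp (d k) 2 P)
    (h0 : ∀ k, P[d k | ℱ k] =ᵐ[P] 0) (hs : ∀ k, ∫ ω, d k ω ^ 2 ∂P ≤ s k) (hsum : Summable s) :
    ∀ᵐ ω ∂P, ∃ c, Tendsto (fun n => ∑ k ∈ Finset.range n, d k ω) atTop (𝓝 c) := by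
  set M : ℕ → Ω → ℝ := fun n ω => ∑ k ∈ Finset.range n, d k ω with hM
  have hMs : ∀ n, StronglyMeasurable[ℱ n] (M n) := fun n =>
    Finset.stronglyMeasurable_fun_sum _ fun k hk =>
      (hd k).mono (ℱ.mono (by have := Finset.mem_range.1 hk; omega))
  have hM2 : ∀ n, MemLp (M n) 2 P := fun n => memLp_finsetSum _ fun k _ => hd2 k
  have hs0 : ∀ k, 0 ≤ s k := fun k => (integral_nonneg fun ω => sq_nonneg _).trans (hs k)
  have hmart : Martingale M ℱ P := by
    refine martingale_of_condExp_sub_eq_zero_nat hMs (fun n => (hM2 n).integrable (by norm_num))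
      fun n => ?_
    have : M (n + 1) - M n = d n := by
      ext ω
      simp [hM, Finset.sum_range_succ]
    rw [this]
    exact h0 n
  have hvar : ∀ n, ∫ ω, M n ω ^ 2 ∂P ≤ ∑ k ∈ Finset.range n, s k := by
    intro n
    induction n with
    | zero => simp [hM]
    | succ n ih =>
      have hprod : Integrable (M n * d n) P := (hM2 n).integrable_mul (hd2 n)
      -- Orthogonality of the increments: the cross term vanishes and the variances add up.
      have hz := integral_mul_eq_zero (ℱ.le n) (hMs n) ((hd2 n).integrable (by norm_num)) hprod
        (h0 n)
      have e : ∀ ω, M (n + 1) ω ^ 2 = M n ω ^ 2 + 2 * (M n ω * d n ω) + d n ω ^ 2 := fun ω => by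
        simp only [hM, Finset.sum_range_succ]; ring
      have hI1 : Integrable (fun ω => M n ω ^ 2) P := (hM2 n).integrable_sq
      have hI2 : Integrable (fun ω => 2 * (M n ω * d n ω)) P := hprod.const_mul 2
      have hI3 : Integrable (fun ω => d n ω ^ 2) P := (hd2 n).integrable_sq
      have hI12 : Integrable (fun ω => M n ω ^ 2 + 2 * (M n ω * d n ω)) P := hI1.add hI2
      rw [integral_congr_ae (Eventually.of_forall e), integral_add hI12 hI3,
        integral_add hI1 hI2, integral_const_mul, hz, Finset.sum_range_succ]
      linarith [hs n]
  refine hmart.submartingale.exists_ae_tendsto_of_bdd (R := (1 + ∑' k, s k).toNNReal) fun n => ?_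
  rw [eLpNorm_one_eq_lintegral_enorm,
    ← ofReal_integral_norm_eq_lintegral_enorm ((hM2 n).integrable (by norm_num))]
  refine ENNReal.ofReal_le_ofReal ?_
  -- The L¹ bound required by the convergence theorem follows from the variance bound.
  have h1 : ∫ ω, ‖M n ω‖ ∂P ≤ ∫ ω, (1 + M n ω ^ 2) ∂P := by
    refine integral_mono ((hM2 n).integrable (by norm_num)).norm
      ((integrable_const 1).add (hM2 n).integrable_sq) fun ω => ?_
    simp only [Real.norm_eq_abs]
    nlinarith [sq_nonneg (|M n ω| - 1), sq_abs (M n ω)]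
  rw [integral_add (integrable_const 1) (hM2 n).integrable_sq] at h1
  have h2 := (hvar n).trans (hsum.sum_le_tsum _ fun k _ => hs0 k)
  rw [integral_const, probReal_univ, one_smul] at h1
  linarith

/-- Series with bounded adapted coefficients. -/
theorem ae_tendsto_sum_mul (ℱ : Filtration ℕ m₀) {φ X : ℕ → Ω → ℝ} {s : ℕ → ℝ} {B : ℝ} {w : ℕ → ℝ}
    (hφ : ∀ k, StronglyMeasurable[ℱ k] (φ k)) (hB : ∀ k ω, |φ k ω| ≤ B)
    (hX : ∀ k, StronglyMeasurable[ℱ (k + 1)] (X k)) (hX2 : ∀ k, MemLp (X k) 2 P)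
    (h0 : ∀ k, P[X k | ℱ k] =ᵐ[P] 0) (hs : ∀ k, ∫ ω, X k ω ^ 2 ∂P ≤ s k)
    (hsum : Summable fun k => w k ^ 2 * s k) :
    ∀ᵐ ω ∂P, ∃ c, Tendsto (fun n => ∑ k ∈ Finset.range n, w k * (φ k ω * X k ω)) atTop (𝓝 c) := by
  have hφX : ∀ k, MemLp (φ k * X k) 2 P := fun k =>
    (hX2 k).of_le_mul (c := B) (((hφ k).mono (ℱ.le k)).aestronglyMeasurable.mul
      (hX2 k).aestronglyMeasurable) (Eventually.of_forall fun ω => by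
        rw [Pi.mul_apply, norm_mul]
        exact mul_le_mul_of_nonneg_right (hB k ω) (norm_nonneg _))
  refine ae_tendsto_sum_of_summable_variance ℱ (s := fun k => B ^ 2 * (w k ^ 2 * s k))
    (fun k => ?_) (fun k => (hφX k).const_mul (w k)) (fun k => ?_) (fun k => ?_)
    (hsum.mul_left _)
  · exact stronglyMeasurable_const.mul (((hφ k).mono (ℱ.mono k.le_succ)).mul (hX k))
  · have h1 := condExp_mul_eq_zero le_rfl (ℱ.le k) (hφ k) ((hX2 k).integrable (by norm_num))
      ((hφX k).integrable (by norm_num)) (h0 k)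
    have h2 := condExp_smul (μ := P) (w k) (φ k * X k) (ℱ k)
    filter_upwards [h1, h2] with ω h1 h2
    have h3 : (fun ω => w k * (φ k ω * X k ω)) = w k • (φ k * X k) := rfl
    rw [h3, h2, Pi.smul_apply, h1]
    simp
  · have hle : ∫ ω, (w k * (φ k ω * X k ω)) ^ 2 ∂P ≤ ∫ ω, B ^ 2 * (w k ^ 2 * X k ω ^ 2) ∂P := by
      refine integral_mono ((hφX k).const_mul (w k)).integrable_sq
        (((hX2 k).integrable_sq.const_mul _).const_mul _) fun ω => ?_
      have : φ k ω ^ 2 ≤ B ^ 2 := sq_le_sq.2 ((hB k ω).trans (le_abs_self B))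
      calc (w k * (φ k ω * X k ω)) ^ 2 = φ k ω ^ 2 * (w k ^ 2 * X k ω ^ 2) := by ring
        _ ≤ _ := mul_le_mul_of_nonneg_right this (by positivity)
    refine hle.trans ?_
    rw [integral_const_mul, integral_const_mul]
    have := hs k
    gcongr

end Series

/-! ### The localized noise series of a stochastic approximation. -/

section NoiseSeries

variable {Ω : Type*} {m₀ : MeasurableSpace Ω} {P : Measure Ω} [IsProbabilityMeasure P]

lemma summable_sq_of_summable_sq_div {w γ : ℕ → ℝ} (hγ : ∀ k, 0 < γ k)
    (hγ0 : Tendsto γ atTop (𝓝 0)) (h : Summable fun k => w k ^ 2 / γ k ^ 2) :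
    Summable fun k => w k ^ 2 := by
  refine Summable.of_norm_bounded_eventually_nat h ?_
  filter_upwards [hγ0.eventually (gt_mem_nhds one_pos)] with k hk
  have h1 : γ k ^ 2 ≤ 1 := pow_le_one₀ (hγ k).le hk.le
  have := hγ k
  rw [Real.norm_of_nonneg (sq_nonneg _), le_div_iff₀ (by positivity)]
  nlinarith [sq_nonneg (w k)]

lemma condExp_sub_condExp_eq_zero {m : MeasurableSpace Ω} (hm : m ≤ m₀) {X : Ω → ℝ}
    (hX : Integrable X P) : P[X - P[X | m] | m] =ᵐ[P] 0 := by
  filter_upwards [condExp_sub hX integrable_condExp m] with ω h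
  rw [h, condExp_of_stronglyMeasurable hm stronglyMeasurable_condExp integrable_condExp]
  simp

lemma integral_sub_condExp_sq_le {m : MeasurableSpace Ω} {X : Ω → ℝ}
    (hX : MemLp X 2 P) : ∫ ω, (X - P[X | m]) ω ^ 2 ∂P ≤ 4 * ∫ ω, X ω ^ 2 ∂P := by
  have hC : MemLp (P[X | m]) 2 P := hX.condExp (by norm_num)
  have h1 : ∫ ω, (X - P[X | m]) ω ^ 2 ∂P ≤ ∫ ω, (2 * X ω ^ 2 + 2 * (P[X | m]) ω ^ 2) ∂P := by
    refine integral_mono (hX.sub hC).integrable_sq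
      ((hX.integrable_sq.const_mul 2).add (hC.integrable_sq.const_mul 2)) fun ω => ?_
    simp only [Pi.sub_apply]
    nlinarith [sq_nonneg (X ω + (P[X | m]) ω)]
  rw [integral_add (hX.integrable_sq.const_mul 2) (hC.integrable_sq.const_mul 2),
    integral_const_mul, integral_const_mul] at h1
  linarith [integral_condExp_sq_le (m := m) hX]

open Classical in
/-- Almost sure convergence, along the visits to a set, of the noise series of a stochastic
approximation whose noise is the sum of multiplicative noise, of a noise with variance of the order
of `1 / γ ^ 2`, and of a centered remainder. -/
theorem ae_tendsto_noise_series (ℱ : Filtration ℕ m₀) {α J : Type*} [MeasurableSpace α] [Fintype J]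
    {θ : ℕ → Ω → α} (hθ : ∀ k, Measurable[ℱ k] (θ k)) {C : Set α} (hC : MeasurableSet C) (K : ℕ)
    {φ : J → α → ℝ} (hφ : ∀ j, Measurable (φ j)) {B : ℝ} (hB : ∀ j, ∀ x ∈ C, |φ j x| ≤ B)
    {Q : J → ℕ → Ω → ℝ} {N ρ : ℕ → Ω → ℝ} {A : ℝ} {w γ : ℕ → ℝ}
    (hQm : ∀ j k, StronglyMeasurable[ℱ (k + 1)] (Q j k)) (hQ2 : ∀ j k, MemLp (Q j k) 2 P)
    (hQ0 : ∀ j k, P[Q j k | ℱ k] =ᵐ[P] 0) (hQA : ∀ j k, ∫ ω, Q j k ω ^ 2 ∂P ≤ A)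
    (hNm : ∀ k, StronglyMeasurable[ℱ (k + 1)] (N k)) (hN2 : ∀ k, MemLp (N k) 2 P)
    (hN0 : ∀ k, P[N k | ℱ k] =ᵐ[P] 0) (hNA : ∀ k, ∫ ω, N k ω ^ 2 ∂P ≤ A / γ k ^ 2)
    (hρm : ∀ k, StronglyMeasurable[ℱ (k + 1)] (ρ k)) (hρ2 : ∀ k, MemLp (ρ k) 2 P)
    (hρA : ∀ k, ∫ ω, ρ k ω ^ 2 ∂P ≤ A) (hγ : ∀ k, 0 < γ k) (hγ0 : Tendsto γ atTop (𝓝 0))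
    (hsum : Summable fun k => w k ^ 2 / γ k ^ 2) :
    ∀ᵐ ω ∂P, ∃ s, Tendsto (fun n => ∑ k ∈ Finset.range n, if K ≤ k ∧ θ k ω ∈ C then
      w k * (∑ j, φ j (θ k ω) * Q j k ω + N k ω + (ρ k ω - (P[ρ k | ℱ k]) ω)) else 0)
      atTop (𝓝 s) := by
  have hw := summable_sq_of_summable_sq_div hγ hγ0 hsum
  -- The localization is moved into the coefficients. These are known before the step and bounded,
  -- so each of the three kinds of noise gives its own convergent martingale series.
  set ψ : J → ℕ → Ω → ℝ := fun j k ω => if K ≤ k ∧ θ k ω ∈ C then φ j (θ k ω) else 0 with hψ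
  set χ : ℕ → Ω → ℝ := fun k ω => if K ≤ k ∧ θ k ω ∈ C then 1 else 0 with hχ
  have hset : ∀ k, MeasurableSet[ℱ k] {ω | K ≤ k ∧ θ k ω ∈ C} := fun k => by
    by_cases hk : K ≤ k
    · have : {ω | K ≤ k ∧ θ k ω ∈ C} = θ k ⁻¹' C := by
        ext ω
        simp [hk]
      rw [this]
      exact hθ k hC
    · simp [hk]
  have hψm : ∀ j k, StronglyMeasurable[ℱ k] (ψ j k) := fun j k =>
    (Measurable.ite (hset k) ((hφ j).comp (hθ k)) measurable_const).stronglyMeasurable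
  have hχm : ∀ k, StronglyMeasurable[ℱ k] (χ k) := fun k =>
    (Measurable.ite (hset k) measurable_const measurable_const).stronglyMeasurable
  have hψB : ∀ j k ω, |ψ j k ω| ≤ |B| := fun j k ω => by
    simp only [hψ]
    split_ifs with h
    · exact (hB j _ h.2).trans (le_abs_self B)
    · simp
  have hχB : ∀ k ω, |χ k ω| ≤ 1 := fun k ω => by
    simp only [hχ]
    split_ifs <;> simp
  have s1 : ∀ j, ∀ᵐ ω ∂P, ∃ c, Tendsto (fun n => ∑ k ∈ Finset.range n,
      w k * (ψ j k ω * Q j k ω)) atTop (𝓝 c) := fun j =>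
    ae_tendsto_sum_mul ℱ (hψm j) (hψB j) (hQm j) (hQ2 j) (hQ0 j) (hQA j) (hw.mul_right A)
  have s2 := ae_tendsto_sum_mul ℱ (w := w) hχm hχB hNm hN2 hN0 hNA
    ((hsum.mul_right A).congr fun k => by ring)
  have s3 := ae_tendsto_sum_mul ℱ (w := w) (X := fun k => ρ k - P[ρ k | ℱ k]) (s := fun _ => 4 * A)
    hχm hχB (fun k => (hρm k).sub (stronglyMeasurable_condExp.mono (ℱ.mono k.le_succ)))
    (fun k => (hρ2 k).sub ((hρ2 k).condExp (by norm_num)))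
    (fun k => condExp_sub_condExp_eq_zero (ℱ.le k) ((hρ2 k).integrable (by norm_num)))
    (fun k => (integral_sub_condExp_sq_le (hρ2 k)).trans (by linarith [hρA k])) (hw.mul_right _)
  filter_upwards [ae_all_iff.2 s1, s2, s3] with ω h1 h2 h3
  choose c1 h1 using h1
  obtain ⟨c2, h2⟩ := h2
  obtain ⟨c3, h3⟩ := h3
  refine ⟨∑ j, c1 j + c2 + c3, ?_⟩
  refine (((tendsto_finsetSum Finset.univ fun j _ => h1 j).add h2).add h3).congr fun n => ?_
  rw [Finset.sum_comm, ← Finset.sum_add_distrib, ← Finset.sum_add_distrib]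
  refine Finset.sum_congr rfl fun k _ => ?_
  simp only [hψ, hχ]
  split_ifs
  · rw [← Finset.mul_sum]
    simp only [Pi.sub_apply]
    ring
  · simp

end NoiseSeries

/-! ### Histories, measurability and the oracle noise. -/

section Model

variable {p : ℕ} {Ω Ξ : Type*}

namespace Data

/-- The image of the first perturbation of step `k`. -/
def mΔ (D : Data p Ω Ξ) (k : ℕ) (ω : Ω) : E p := D.m k ω (D.Δ k ω)

/-- The image of the second perturbation of step `k`. -/
def mΔt (D : Data p Ω Ξ) (k : ℕ) (ω : Ω) : E p := D.m k ω (D.Δt k ω)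

variable [MeasurableSpace Ξ]

/-- The history before step `k` together with the first perturbation of step `k`. -/
abbrev hist₁ (D : Data p Ω Ξ) (k : ℕ) : MeasurableSpace Ω :=
  D.history k ⊔ MeasurableSpace.comap (D.Δ k) inferInstance

/-- The history before step `k` together with both perturbations of step `k`. -/
abbrev hist₂ (D : Data p Ω Ξ) (k : ℕ) : MeasurableSpace Ω :=
  D.hist₁ k ⊔ MeasurableSpace.comap (D.Δt k) inferInstance

lemma history_mono (D : Data p Ω Ξ) : Monotone D.history := fun _ _ hkl =>
  sup_le_sup le_rfl (iSup₂_le fun i hi => le_iSup₂_of_le i (lt_of_lt_of_le hi hkl) le_rfl)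

lemma measurable_step (D : Data p Ω Ξ) (k : ℕ) : Measurable[D.history (k + 1)]
    fun ω => (D.Δ k ω, D.Δt k ω, D.ξp k ω, D.ξm k ω, D.ξpp k ω, D.ξmp k ω) :=
  Measurable.of_comap_le (le_sup_of_le_right (le_iSup₂_of_le k k.lt_succ_self le_rfl))

lemma measurable_Δ_succ (D : Data p Ω Ξ) (k : ℕ) : Measurable[D.history (k + 1)] (D.Δ k) :=
  measurable_fst.comp (D.measurable_step k)

lemma measurable_Δt_succ (D : Data p Ω Ξ) (k : ℕ) : Measurable[D.history (k + 1)] (D.Δt k) :=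
  (measurable_fst.comp measurable_snd).comp (D.measurable_step k)

lemma measurable_ξ_succ (D : Data p Ω Ξ) (k : ℕ) : Measurable[D.history (k + 1)]
    fun ω => (D.ξp k ω, D.ξm k ω, D.ξpp k ω, D.ξmp k ω) :=
  (measurable_snd.comp measurable_snd).comp (D.measurable_step k)

lemma hist₁_le_succ (D : Data p Ω Ξ) (k : ℕ) : D.hist₁ k ≤ D.history (k + 1) :=
  sup_le (D.history_mono k.le_succ) (D.measurable_Δ_succ k).comap_le

lemma hist₂_le_succ (D : Data p Ω Ξ) (k : ℕ) : D.hist₂ k ≤ D.history (k + 1) :=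
  sup_le (D.hist₁_le_succ k) (D.measurable_Δt_succ k).comap_le

lemma history_le_hist₁ (D : Data p Ω Ξ) (k : ℕ) : D.history k ≤ D.hist₁ k := le_sup_left

lemma hist₁_le_hist₂ (D : Data p Ω Ξ) (k : ℕ) : D.hist₁ k ≤ D.hist₂ k := le_sup_left

lemma measurable_Δ_hist₁ (D : Data p Ω Ξ) (k : ℕ) : Measurable[D.hist₁ k] (D.Δ k) :=
  Measurable.of_comap_le le_sup_right

lemma measurable_Δt_hist₂ (D : Data p Ω Ξ) (k : ℕ) : Measurable[D.hist₂ k] (D.Δt k) :=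
  Measurable.of_comap_le le_sup_right

end Data

lemma measurable_apply_of_measurable {m m' : MeasurableSpace Ω} {M : Ω → E p → E p}
    (hM : @Measurable (Ω × E p) (E p) (@Prod.instMeasurableSpace Ω (E p) m' inferInstance)
      inferInstance (fun q => M q.1 q.2)) (hm : m' ≤ m) {δ : Ω → E p} (hδ : Measurable[m] δ) :
    Measurable[m] fun ω => M ω (δ ω) := by
  have h1 : @Measurable Ω (Ω × E p) m (@Prod.instMeasurableSpace Ω (E p) m' inferInstance)
      (fun ω => (ω, δ ω)) :=
    @Measurable.prodMk Ω m Ω (E p) m' inferInstance id δ (measurable_id'' hm) hδ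
  exact hM.comp h1

variable [mΩ : MeasurableSpace Ω] [MeasurableSpace Ξ] {P : Measure Ω} {ν : Measure Ξ} {D : Data p Ω Ξ}

lemma Perturbation.measurable_mΔ (h : Perturbation P D) (k : ℕ) :
    Measurable[D.hist₁ k] (D.mΔ k) :=
  measurable_apply_of_measurable (h.measurable_m k) (D.history_le_hist₁ k) (D.measurable_Δ_hist₁ k)

lemma Perturbation.measurable_mΔt (h : Perturbation P D) (k : ℕ) :
    Measurable[D.hist₂ k] (D.mΔt k) :=
  measurable_apply_of_measurable (h.measurable_m k) ((D.history_le_hist₁ k).trans (D.hist₁_le_hist₂ k))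
    (D.measurable_Δt_hist₂ k)

lemma IIDNoise.measurable_ξ (h : IIDNoise P ν D) (k : ℕ) :
    Measurable fun ω => (D.ξp k ω, D.ξm k ω, D.ξpp k ω, D.ξmp k ω) :=
  (h.measurable_ξp k).prodMk ((h.measurable_ξm k).prodMk
    ((h.measurable_ξpp k).prodMk (h.measurable_ξmp k)))

lemma history_le (hp : Perturbation P D) (hn : IIDNoise P ν D) (k : ℕ) : D.history k ≤ mΩ :=
  sup_le hn.measurable_θ₀.comap_le (iSup₂_le fun i _ =>
    ((hp.measurable_Δ i).prodMk ((hp.measurable_Δt i).prodMk (hn.measurable_ξ i))).comap_le)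

lemma hist₂_le (hp : Perturbation P D) (hn : IIDNoise P ν D) (k : ℕ) : D.hist₂ k ≤ mΩ :=
  (D.hist₂_le_succ k).trans (history_le hp hn (k + 1))

/-- The filtration of the histories. -/
def histFiltration (hp : Perturbation P D) (hn : IIDNoise P ν D) : Filtration ℕ mΩ where
  seq := D.history
  mono' := D.history_mono
  le' := history_le hp hn

lemma measurable_iter (hp : Perturbation P D) (hn : IIDNoise P ν D) (k : ℕ) :
    Measurable[D.history k] (D.iter k) := by
  induction k with
  | zero => exact Measurable.of_comap_le le_sup_left
  | succ k ih =>
    have hi := ih.mono (D.history_mono k.le_succ) le_rfl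
    have hΔ := D.measurable_Δ_succ k
    have hξ := D.measurable_ξ_succ k
    have hm := (hp.measurable_mΔ k).mono (D.hist₁_le_succ k) le_rfl
    have h1 := hn.measurable_ell.comp (Measurable.prodMk (hi.add (hΔ.const_smul (D.c k))) (measurable_fst.comp hξ))
    have h2 := hn.measurable_ell.comp (Measurable.prodMk (hi.sub (hΔ.const_smul (D.c k)))
      ((measurable_fst.comp measurable_snd).comp hξ))
    exact hi.sub ((((h1.sub h2).div_const (2 * D.c k)).smul hm).const_smul (D.a k))

lemma IIDNoise.measurable_loss [SFinite ν] (hn : IIDNoise P ν D) : Measurable (D.loss ν) :=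
  (StronglyMeasurable.integral_prod_right
    (f := D.ell) hn.measurable_ell.stronglyMeasurable).measurable

/-- The noise difference of the queries at `θ ± c Δ`. -/
def noise₁ (ν : Measure Ξ) (D : Data p Ω Ξ) (k : ℕ) (ω : Ω) : ℝ :=
  D.noise ν (D.qp k) (D.ξp k) ω - D.noise ν (D.qm k) (D.ξm k) ω

/-- The noise difference of the queries at `θ ± c Δ + ct Δt`. -/
def noise₂ (ν : Measure Ξ) (D : Data p Ω Ξ) (k : ℕ) (ω : Ω) : ℝ :=
  D.noise ν (D.qpp k) (D.ξpp k) ω - D.noise ν (D.qmp k) (D.ξmp k) ω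

/-- Moment conditions on a noise variable, conditionally on `m`. -/
structure NoiseCond (P : Measure Ω) (m m' : MeasurableSpace Ω) (A : ℝ) (Z : Ω → ℝ) : Prop where
  measurable : StronglyMeasurable[m'] Z
  memLp : MemLp Z 2 P
  mean : P[Z | m] =ᵐ[P] 0
  sq_le : ∀ᵐ ω ∂P, (P[fun ω => Z ω ^ 2 | m]) ω ≤ A

/-- The moments are assumed given only the iterate and perturbations entering the queries. Since the
oracle randomness is independent of all of `hist₂`, the same bounds hold given `hist₂`, so factors
depending on the perturbations and on the random map `m k` can be pulled out. -/
lemma noiseCond [IsProbabilityMeasure P] [SFinite ν] (hp : Perturbation P D)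
    (hn : IIDNoise P ν D) :
    ∃ A, ∀ k, NoiseCond P (D.hist₂ k) (D.history (k + 1)) A (noise₁ ν D k) ∧
      NoiseCond P (D.hist₂ k) (D.history (k + 1)) A (noise₂ ν D k) := by
  obtain ⟨A, hA⟩ := hn.moments
  refine ⟨A, fun k => ?_⟩
  obtain ⟨⟨h1, h2, h3⟩, h4, h5, h6⟩ := hA k
  have hle := hist₂_le hp hn k
  have hL := hn.measurable_loss
  have hell := hn.measurable_ell
  have hind : Indep (MeasurableSpace.comap
      (fun ω => (D.ξp k ω, D.ξm k ω, D.ξpp k ω, D.ξmp k ω)) inferInstance) (D.hist₂ k) P := by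
    have := hn.indep k
    have e : MeasurableSpace.comap (fun ω => (D.Δ k ω, D.Δt k ω)) inferInstance =
        MeasurableSpace.comap (D.Δ k) inferInstance ⊔ MeasurableSpace.comap (D.Δt k) inferInstance :=
      MeasurableSpace.comap_prodMk _ _
    rwa [e, ← sup_assoc] at this
  have hi : Measurable[D.hist₂ k] (D.iter k) := (measurable_iter hp hn k).mono
    ((D.history_le_hist₁ k).trans (D.hist₁_le_hist₂ k)) le_rfl
  have hΔ : Measurable[D.hist₂ k] (D.Δ k) := (D.measurable_Δ_hist₁ k).mono
    (D.hist₁_le_hist₂ k) le_rfl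
  have hΔt := D.measurable_Δt_hist₂ k
  have hmeas : ∀ {α : Type} [MeasurableSpace α] {X : Ω → α} {f : α × (Ξ × Ξ × Ξ × Ξ) → ℝ},
      Measurable[D.hist₂ k] X → Measurable f → StronglyMeasurable[D.history (k + 1)] fun ω =>
        f (X ω, (D.ξp k ω, D.ξm k ω, D.ξpp k ω, D.ξmp k ω)) := fun hX hf =>
    (hf.comp ((hX.mono (D.hist₂_le_succ k) le_rfl).prodMk
      (D.measurable_ξ_succ k))).stronglyMeasurable
  constructor
  · set f : (E p × E p) × (Ξ × Ξ × Ξ × Ξ) → ℝ := fun q =>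
      D.ell (q.1.1 + D.c k • q.1.2) q.2.1 - D.loss ν (q.1.1 + D.c k • q.1.2) -
        (D.ell (q.1.1 - D.c k • q.1.2) q.2.2.1 - D.loss ν (q.1.1 - D.c k • q.1.2)) with hf
    have hfm : Measurable f := by
      have e1 : Measurable fun q : (E p × E p) × (Ξ × Ξ × Ξ × Ξ) => q.1.1 + D.c k • q.1.2 := by
        fun_prop
      have e2 : Measurable fun q : (E p × E p) × (Ξ × Ξ × Ξ × Ξ) => q.1.1 - D.c k • q.1.2 := by
        fun_prop
      exact ((hell.comp (e1.prodMk (by fun_prop))).sub (hL.comp e1)).sub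
        ((hell.comp (e2.prodMk (by fun_prop))).sub (hL.comp e2))
    have hX := hi.prodMk hΔ
    have hX1 := hX.comap_le
    refine ⟨hmeas hX hfm, h1, ?_, ?_⟩
    · exact (condExp_congr_of_indep hX1 hle (hn.measurable_ξ k) hind (comap_measurable _) hfm
        (h1.integrable (by norm_num))).trans h2
    · filter_upwards [h3, condExp_congr_of_indep hX1 hle (hn.measurable_ξ k) hind
        (comap_measurable _) (hfm.pow_const 2) h1.integrable_sq] with ω e1 e2
      exact e2.le.trans e1
  · set f : (E p × E p × E p) × (Ξ × Ξ × Ξ × Ξ) → ℝ := fun q =>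
      D.ell (q.1.1 + D.c k • q.1.2.1 + D.ct k • q.1.2.2) q.2.2.2.1 -
        D.loss ν (q.1.1 + D.c k • q.1.2.1 + D.ct k • q.1.2.2) -
        (D.ell (q.1.1 - D.c k • q.1.2.1 + D.ct k • q.1.2.2) q.2.2.2.2 -
          D.loss ν (q.1.1 - D.c k • q.1.2.1 + D.ct k • q.1.2.2)) with hf
    have hfm : Measurable f := by
      have e1 : Measurable fun q : (E p × E p × E p) × (Ξ × Ξ × Ξ × Ξ) =>
          q.1.1 + D.c k • q.1.2.1 + D.ct k • q.1.2.2 := by fun_prop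
      have e2 : Measurable fun q : (E p × E p × E p) × (Ξ × Ξ × Ξ × Ξ) =>
          q.1.1 - D.c k • q.1.2.1 + D.ct k • q.1.2.2 := by fun_prop
      exact ((hell.comp (e1.prodMk (by fun_prop))).sub (hL.comp e1)).sub
        ((hell.comp (e2.prodMk (by fun_prop))).sub (hL.comp e2))
    have hX := hi.prodMk (hΔ.prodMk hΔt)
    have hX1 := hX.comap_le
    refine ⟨hmeas hX hfm, h4, ?_, ?_⟩
    · exact (condExp_congr_of_indep hX1 hle (hn.measurable_ξ k) hind (comap_measurable _) hfm
        (h4.integrable (by norm_num))).trans h5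
    · filter_upwards [h6, condExp_congr_of_indep hX1 hle (hn.measurable_ξ k) hind
        (comap_measurable _) (hfm.pow_const 2) h4.integrable_sq] with ω e1 e2
      exact e2.le.trans e1

end Model

/-! ### Moment bounds for the perturbations. -/

section Moments

variable {p : ℕ} {Ω : Type*} {m m₀ : MeasurableSpace Ω} {P : Measure[m₀] Ω}

/-- For n ≤ 3 one has t²ⁿ ≤ 1 + t⁶, so the square of the majorant is bounded by the sum of the two
integrands controlled by the assumption. The bound on the mean then uses t ≤ (1 + t²)/2. -/
lemma PerturbationCond.moment_bounds [IsProbabilityMeasure P] (hm : m ≤ m₀) {D₂ : ℝ}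
    {S : Ω → Matrix (Fin p) (Fin p) ℝ} {M : Ω → E p → E p} {δ : Ω → E p}
    (h : PerturbationCond P m D₂ S M δ) {X : Ω → ℝ} (hX : AEStronglyMeasurable X P) {n : ℕ}
    (hn : n ≤ 3) {C : ℝ} (hC : 0 ≤ C)
    (hb : ∀ᵐ ω ∂P, |X ω| ≤ C * (‖δ ω‖ ^ n * ‖M ω (δ ω)‖)) :
    MemLp X 2 P ∧ (∀ᵐ ω ∂P, (P[fun ω => X ω ^ 2 | m]) ω ≤ C ^ 2 * (2 * D₂)) ∧
      ∀ᵐ ω ∂P, |(P[X | m]) ω| ≤ C * (1 + D₂) := by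
  set T : Ω → ℝ := fun ω => ‖M ω (δ ω)‖ ^ 2 + ‖δ ω‖ ^ 6 * ‖M ω (δ ω)‖ ^ 2 with hT
  have hTi : Integrable T P := h.integrable_sq.add h.integrable_six
  have hTD : ∀ᵐ ω ∂P, (P[T | m]) ω ≤ 2 * D₂ := by
    filter_upwards [condExp_add h.integrable_sq h.integrable_six m, h.bound_sq, h.bound_six] with
      ω h1 h2 h3
    have : T = (fun ω => ‖M ω (δ ω)‖ ^ 2) + fun ω => ‖δ ω‖ ^ 6 * ‖M ω (δ ω)‖ ^ 2 := rfl
    rw [this, h1, Pi.add_apply]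
    linarith
  have hpow : ∀ x : ℝ, 0 ≤ x → (x ^ n) ^ 2 ≤ 1 + x ^ 6 := fun x hx => by
    rw [← pow_mul]
    rcases le_total x 1 with h1 | h1
    · have e1 : x ^ (n * 2) ≤ 1 := pow_le_one₀ hx h1
      have e2 : 0 ≤ x ^ 6 := by positivity
      linarith
    · have := pow_le_pow_right₀ h1 (show n * 2 ≤ 6 by omega)
      linarith
  have htT : ∀ ω, (‖δ ω‖ ^ n * ‖M ω (δ ω)‖) ^ 2 ≤ T ω := fun ω => by
    rw [mul_pow]
    have := mul_le_mul_of_nonneg_right (hpow ‖δ ω‖ (norm_nonneg _)) (sq_nonneg ‖M ω (δ ω)‖)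
    simp only [hT]
    linarith
  have hsq : ∀ᵐ ω ∂P, X ω ^ 2 ≤ C ^ 2 * T ω := by
    filter_upwards [hb] with ω hω
    calc X ω ^ 2 = |X ω| ^ 2 := (sq_abs _).symm
      _ ≤ (C * (‖δ ω‖ ^ n * ‖M ω (δ ω)‖)) ^ 2 := pow_le_pow_left₀ (abs_nonneg _) hω 2
      _ = C ^ 2 * (‖δ ω‖ ^ n * ‖M ω (δ ω)‖) ^ 2 := by ring
      _ ≤ _ := mul_le_mul_of_nonneg_left (htT ω) (sq_nonneg C)
  have hX2 : Integrable (fun ω => X ω ^ 2) P := by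
    refine (hTi.const_mul (C ^ 2)).mono' (hX.pow 2) ?_
    filter_upwards [hsq] with ω hω
    rwa [Real.norm_of_nonneg (sq_nonneg _)]
  have hmem : MemLp X 2 P := (memLp_two_iff_integrable_sq hX).2 hX2
  have habs : ∀ᵐ ω ∂P, |X ω| ≤ C / 2 * (1 + T ω) := by
    filter_upwards [hb] with ω hω
    refine hω.trans ?_
    have e1 := htT ω
    have e2 : ‖δ ω‖ ^ n * ‖M ω (δ ω)‖ ≤ (1 + T ω) / 2 := by
      nlinarith [sq_nonneg (‖δ ω‖ ^ n * ‖M ω (δ ω)‖ - 1)]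
    nlinarith
  refine ⟨hmem, ?_, ?_⟩
  · have h1 := condExp_mono (m := m) hX2 (hTi.const_mul (C ^ 2)) hsq
    have h2 : P[fun ω => C ^ 2 * T ω | m] =ᵐ[P] C ^ 2 • P[T | m] := condExp_smul (C ^ 2) T m
    filter_upwards [h1, h2, hTD] with ω h1 h2 h3
    rw [h2, Pi.smul_apply, smul_eq_mul] at h1
    exact h1.trans (mul_le_mul_of_nonneg_left h3 (sq_nonneg C))
  · have hXi : Integrable X P := hmem.integrable (by norm_num)
    have hUi : Integrable (fun ω => C / 2 * (1 + T ω)) P :=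
      ((integrable_const 1).add hTi).const_mul _
    have h2 : P[fun ω => C / 2 * (1 + T ω) | m] =ᵐ[P] (C / 2) • P[(fun _ => 1) + T | m] :=
      condExp_smul (C / 2) ((fun _ => (1 : ℝ)) + T) m
    have h3 : P[(fun _ => (1 : ℝ)) + T | m] =ᵐ[P] P[fun _ => (1 : ℝ) | m] + P[T | m] :=
      condExp_add (integrable_const 1) hTi m
    have h4 := condExp_mono (m := m) hXi hUi (habs.mono fun ω hω => (le_abs_self _).trans hω)
    have h5 := condExp_mono (m := m) hXi.neg hUi (habs.mono fun ω hω => (neg_le_abs _).trans hω)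
    have h6 := condExp_neg X m (μ := P)
    filter_upwards [h2, h3, h4, h5, h6, hTD] with ω h2 h3 h4 h5 h6 h7
    rw [h2, Pi.smul_apply, h3, Pi.add_apply, condExp_const hm, smul_eq_mul] at h4 h5
    rw [h6, Pi.neg_apply] at h5
    rw [abs_le]
    constructor <;> nlinarith

/-- A square integrable martingale difference with a bound on its variance. -/
structure MartDiff (P : Measure[m₀] Ω) (m m' : MeasurableSpace Ω) (A : ℝ) (X : Ω → ℝ) : Prop where
  measurable : StronglyMeasurable[m'] X
  memLp : MemLp X 2 P
  mean : P[X | m] =ᵐ[P] 0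
  sq_le : ∫ ω, X ω ^ 2 ∂P ≤ A

lemma MartDiff.integral_mul_eq_zero {m' : MeasurableSpace Ω} {A B : ℝ} {X Y : Ω → ℝ}
    [IsProbabilityMeasure P] (h : MartDiff P m m' A X) (hm : m ≤ m₀) (hY : StronglyMeasurable[m] Y)
    (hB : ∀ ω, |Y ω| ≤ B) : Integrable (fun ω => Y ω * X ω) P ∧ ∫ ω, Y ω * X ω ∂P = 0 := by
  have hX := h.memLp.integrable (by norm_num : (1 : ENNReal) ≤ 2)
  have hYX : Integrable (Y * X) P :=
    hX.bdd_mul (c := B) (hY.mono hm).aestronglyMeasurable (Eventually.of_forall hB)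
  exact ⟨hYX, HARP.integral_mul_eq_zero hm hY hX hYX h.mean⟩

end Moments

lemma exists_bound_c {p : ℕ} {Ω Ξ : Type*} {D : Data p Ω Ξ} (hstep : Stepsize D) : ∃ c₀, 0 < c₀ ∧ ∀ k, D.c k ≤ c₀ := by
  obtain ⟨c₀, hc⟩ := hstep.c_lim.bddAbove_range
  refine ⟨c₀, (hstep.c_pos 0).trans_le (hc ⟨0, rfl⟩), fun k => hc ⟨k, rfl⟩⟩

/-! ### Bias and noise of the gradient estimate. -/

section GradientNoise

variable {p : ℕ} {Ω Ξ : Type*} [mΩ : MeasurableSpace Ω] [MeasurableSpace Ξ]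
  {P : Measure Ω} {ν : Measure Ξ} {D : Data p Ω Ξ} {U : Set (E p)} {r B : ℝ} {K : ℕ}

set_option maxSynthPendingDepth 3 in
/-- The smoothness assumption with explicit parameters. -/
structure SmoothSetting (P : Measure Ω) (ν : Measure Ξ) (D : Data p Ω Ξ) (U : Set (E p)) (r B : ℝ)
    (K : ℕ) : Prop where
  isOpen : IsOpen U
  r_pos : 0 < r
  contDiffOn : ContDiffOn ℝ 3 (D.loss ν) U
  B_nonneg : 0 ≤ B
  third : ∀ θ ∈ U, ‖fderiv ℝ (fderiv ℝ (fderiv ℝ (D.loss ν))) θ‖ ≤ B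
  ball_subset : ∀ k ≥ K, ∀ᵐ ω ∂P, Metric.closedBall (D.iter k ω) r ⊆ U
  query_mem : ∀ k ≥ K, ∀ᵐ ω ∂P, ∀ s ∈ Set.Icc (-1 : ℝ) 1, ∀ t ∈ Set.Icc (0 : ℝ) 1,
    D.iter k ω + s • (D.c k • D.Δ k ω) + t • (D.ct k • D.Δt k ω) ∈ U

lemma SmoothLoss.exists_setting (h : SmoothLoss P ν D) : ∃ U r B K, SmoothSetting P ν D U r B K := by
  obtain ⟨U, D₁, r, K, hU, hr, hL, hD, hk⟩ := h
  refine ⟨U, r, |p * (p * (p * D₁))|, K, hU, hr, hL, abs_nonneg _, fun θ hθ =>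
    (norm_fderiv_fderiv_fderiv_le (hD θ hθ)).trans (le_abs_self _), fun k hK => ?_, fun k hK => ?_⟩
  · filter_upwards [hk k hK] with ω hω using hω.1
  · filter_upwards [hk k hK] with ω hω
    simpa only [smul_smul] using hω.2

/-- The gradient of the loss on `U`, extended by zero. -/
def gradOn (D : Data p Ω Ξ) (ν : Measure Ξ) (U : Set (E p)) : E p → E p :=
  U.indicator (gradient (D.loss ν))

lemma SmoothSetting.continuousOn_gradient (h : SmoothSetting P ν D U r B K) :
    ContinuousOn (gradient (D.loss ν)) U :=
  (InnerProductSpace.toDual ℝ (E p)).symm.continuous.comp_continuousOn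
    (h.contDiffOn.continuousOn_fderiv_of_isOpen h.isOpen (by norm_num))

lemma SmoothSetting.measurable_gradOn (h : SmoothSetting P ν D U r B K) :
    Measurable (gradOn D ν U) := by
  classical
  rw [gradOn, ← Set.piecewise_eq_indicator]
  exact h.continuousOn_gradient.measurable_piecewise continuousOn_const h.isOpen.measurableSet

lemma SmoothSetting.exists_gradOn_bound (h : SmoothSetting P ν D U r B K) (R : ℝ) :
    ∃ A, ∀ x ∈ core U r R, ‖gradOn D ν U x‖ ≤ A := by
  obtain ⟨A, hA⟩ := (isCompact_core (U := U) (r := r) R).exists_bound_of_continuousOn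
    (h.continuousOn_gradient.mono (core_subset h.r_pos R))
  refine ⟨A, fun x hx => ?_⟩
  rw [gradOn, Set.indicator_of_mem (core_subset h.r_pos R hx)]
  exact hA x hx

/-- The multiplicative noise of the gradient estimate. -/
def gradQ (D : Data p Ω Ξ) (i j : Fin p) (k : ℕ) (ω : Ω) : ℝ :=
  D.mΔ k ω i * D.Δ k ω j - (1 : Matrix (Fin p) (Fin p) ℝ) i j

/-- The oracle noise of the gradient estimate. -/
def gradN (D : Data p Ω Ξ) (ν : Measure Ξ) (i : Fin p) (k : ℕ) (ω : Ω) : ℝ :=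
  D.mΔ k ω i * (noise₁ ν D k ω / (2 * D.c k))

/-- The finite difference error of the gradient estimate. -/
def gradR (D : Data p Ω Ξ) (ν : Measure Ξ) (U : Set (E p)) (K : ℕ) (i : Fin p) (k : ℕ)
    (ω : Ω) : ℝ :=
  if K ≤ k then (D.loss ν (D.qp k ω) - D.loss ν (D.qm k ω) -
    2 * (inner ℝ (gradOn D ν U (D.iter k ω)) (D.c k • D.Δ k ω))) / (2 * D.c k) * D.mΔ k ω i
  else 0

/-- The bias of the gradient estimate. -/
def gradBias (P : Measure Ω) (D : Data p Ω Ξ) (ν : Measure Ξ) (U : Set (E p)) (K : ℕ) (k : ℕ)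
    (ω : Ω) : E p :=
  WithLp.toLp 2 fun i => (P[gradR D ν U K i k | D.history k]) ω

/-- The noise of the gradient estimate. -/
def gradNoise (P : Measure Ω) (D : Data p Ω Ξ) (ν : Measure Ξ) (U : Set (E p)) (K : ℕ) (k : ℕ)
    (ω : Ω) : E p :=
  WithLp.toLp 2 fun i => ∑ j, gradOn D ν U (D.iter k ω) j * gradQ D i j k ω + gradN D ν i k ω +
    (gradR D ν U K i k ω - (P[gradR D ν U K i k | D.history k]) ω)

omit mΩ in
lemma inner_gradOn (x u : E p) : inner ℝ x u = ∑ j, x j * u j := by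
  simp [PiLp.inner_apply, mul_comm]

/-- The identity is algebraic: the main term, the loss differences and the conditional mean are
added and subtracted, so it holds at every sample point and for any set `U`. -/
lemma gradEst_eq (hc : ∀ k, 0 < D.c k) {k : ℕ} (hk : K ≤ k) (ω : Ω) :
    D.gradEst k ω (D.iter k ω) = gradOn D ν U (D.iter k ω) + gradBias P D ν U K k ω +
      gradNoise P D ν U K k ω := by
  have hck := (hc k).ne'
  ext i
  simp only [Data.gradEst, gradBias, gradNoise, gradQ, gradN, gradR, if_pos hk, PiLp.add_apply,
    PiLp.smul_apply, smul_eq_mul, inner_smul_right, inner_gradOn, mul_sub, Finset.sum_sub_distrib,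
    Matrix.one_apply, mul_ite, mul_one, mul_zero, Finset.sum_ite_eq, Finset.mem_univ, if_true,
    noise₁, Data.noise, Data.qp, Data.qm, Data.mΔ]
  have h1 : ∀ x : E p, ∑ j, x j * (D.m k ω (D.Δ k ω) i * D.Δ k ω j) =
      D.m k ω (D.Δ k ω) i * ∑ j, x j * D.Δ k ω j := fun x => by
    rw [Finset.mul_sum]
    exact Finset.sum_congr rfl fun j _ => by ring
  rw [h1]
  field_simp
  ring

variable [IsProbabilityMeasure P]

lemma abs_apply_le_norm (x : E p) (i : Fin p) : |x i| ≤ ‖x‖ := PiLp.norm_apply_le x i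

lemma exists_gradQ_martDiff (hp : Perturbation P D) (hn : IIDNoise P ν D) :
    ∃ A, ∀ i j k, MartDiff P (D.history k) (D.history (k + 1)) A (gradQ D i j k) := by
  obtain ⟨D₂, hD⟩ := hp.moments
  refine ⟨2 * (2 * D₂) + 2, fun i j k => ?_⟩
  have hle := history_le hp hn k
  have hX : StronglyMeasurable[D.history (k + 1)] fun ω => D.mΔ k ω i * D.Δ k ω j := by
    have h1 := (hp.measurable_mΔ k).mono (D.hist₁_le_succ k) le_rfl
    have h2 := D.measurable_Δ_succ k
    exact Measurable.stronglyMeasurable (by fun_prop)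
  obtain ⟨h2, h3, -⟩ := (hD k).1.moment_bounds hle (n := 1) (C := 1)
    (hX.mono (history_le hp hn (k + 1))).aestronglyMeasurable (by norm_num) zero_le_one
    (Eventually.of_forall fun ω => by
      rw [abs_mul, one_mul, pow_one, mul_comm]
      exact mul_le_mul (abs_apply_le_norm _ _) (abs_apply_le_norm _ _) (abs_nonneg _)
        (norm_nonneg _))
  have hconst : MemLp (fun _ : Ω => (1 : Matrix (Fin p) (Fin p) ℝ) i j) 2 P := memLp_const _
  refine ⟨hX.sub stronglyMeasurable_const, h2.sub hconst, ?_, ?_⟩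
  · have e1 := condExp_sub (h2.integrable (by norm_num)) (hconst.integrable (by norm_num))
      (D.history k)
    filter_upwards [e1, (hD k).1.unit i j] with ω e1 e2
    have e3 : gradQ D i j k = (fun ω => D.mΔ k ω i * D.Δ k ω j) -
      fun _ => (1 : Matrix (Fin p) (Fin p) ℝ) i j := rfl
    rw [e3, e1, Pi.sub_apply, condExp_const hle]
    have e4 : (P[fun ω => D.mΔ k ω i * D.Δ k ω j | D.history k]) ω =
      (1 : Matrix (Fin p) (Fin p) ℝ) i j := e2
    rw [e4]
    simp
  · have e1 : ∫ ω, gradQ D i j k ω ^ 2 ∂P ≤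
        ∫ ω, (2 * (D.mΔ k ω i * D.Δ k ω j) ^ 2 + 2) ∂P := by
      refine integral_mono (h2.sub hconst).integrable_sq
        ((h2.integrable_sq.const_mul 2).add (integrable_const 2)) fun ω => ?_
      have e2 : ((1 : Matrix (Fin p) (Fin p) ℝ) i j) ^ 2 ≤ 1 := by
        rw [Matrix.one_apply]
        split_ifs <;> norm_num
      simp only [gradQ]
      nlinarith [sq_nonneg (D.mΔ k ω i * D.Δ k ω j + (1 : Matrix (Fin p) (Fin p) ℝ) i j)]
    rw [integral_add (h2.integrable_sq.const_mul 2) (integrable_const 2), integral_const_mul] at e1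
    have e2 := integral_le_of_condExp_le hle h3
    simp only [integral_const, probReal_univ, smul_eq_mul] at e1
    linarith

lemma memLp_mΔ (hp : Perturbation P D) (hn : IIDNoise P ν D) :
    ∃ A, 0 ≤ A ∧ ∀ i k, MemLp (fun ω => D.mΔ k ω i) 2 P ∧ ∫ ω, D.mΔ k ω i ^ 2 ∂P ≤ A := by
  obtain ⟨D₂, hD⟩ := hp.moments
  refine ⟨|2 * D₂|, abs_nonneg _, fun i k => ?_⟩
  have hX : AEStronglyMeasurable (fun ω => D.mΔ k ω i) P := by
    have h1 := (hp.measurable_mΔ k).mono ((D.hist₁_le_hist₂ k).trans (hist₂_le hp hn k)) le_rfl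
    exact Measurable.aestronglyMeasurable (by fun_prop)
  obtain ⟨h2, h3, -⟩ := (hD k).1.moment_bounds (history_le hp hn k) (n := 0) (C := 1) hX
    (by norm_num) zero_le_one (Eventually.of_forall fun ω => by
      rw [pow_zero, one_mul, one_mul]
      exact abs_apply_le_norm _ _)
  refine ⟨h2, (integral_le_of_condExp_le (history_le hp hn k) h3).trans ?_⟩
  rw [one_pow, one_mul]
  exact le_abs_self _

variable [IsProbabilityMeasure ν]

/-- Given `hist₂`, the image of the perturbation is known and the oracle noise is centred with
bounded variance; division by 2c gives the order 1/c². -/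
lemma exists_gradN_martDiff (hp : Perturbation P D) (hn : IIDNoise P ν D) (hstep : Stepsize D) :
    ∃ A, ∀ i k, MartDiff P (D.history k) (D.history (k + 1)) (A / D.c k ^ 2) (gradN D ν i k) := by
  obtain ⟨A₁, hA₁⟩ := noiseCond hp hn
  obtain ⟨A₂, hA₂0, hA₂⟩ := memLp_mΔ hp hn
  refine ⟨max A₁ 0 * A₂ / 4, fun i k => ?_⟩
  obtain ⟨hZ, -⟩ := hA₁ k
  obtain ⟨hm2, hmA⟩ := hA₂ i k
  have hc := hstep.c_pos k
  have hmm : StronglyMeasurable[D.hist₂ k] fun ω => D.mΔ k ω i := by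
    have h1 := (hp.measurable_mΔ k).mono (D.hist₁_le_hist₂ k) le_rfl
    exact Measurable.stronglyMeasurable (by fun_prop)
  have hle := hist₂_le hp hn k
  obtain ⟨h1, h2⟩ := memLp_mul_of_condExp_sq_le hle hZ.memLp hZ.sq_le hmm hm2
  have heq : gradN D ν i k = (1 / (2 * D.c k)) • ((fun ω => D.mΔ k ω i) * noise₁ ν D k) := by
    ext ω
    simp only [gradN, Pi.smul_apply, Pi.mul_apply, smul_eq_mul]
    ring
  have h0 := condExp_mul_eq_zero ((D.history_le_hist₁ k).trans (D.hist₁_le_hist₂ k)) hle hmm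
    (hZ.memLp.integrable (by norm_num)) (h1.integrable (by norm_num)) hZ.mean
  refine ⟨?_, ?_, ?_, ?_⟩
  · rw [heq]
    exact ((hmm.mono (D.hist₂_le_succ k)).mul hZ.measurable).const_smul _
  · rw [heq]
    exact h1.const_smul _
  · rw [heq]
    filter_upwards [condExp_smul (μ := P) (1 / (2 * D.c k))
      ((fun ω => D.mΔ k ω i) * noise₁ ν D k) (D.history k), h0] with ω e1 e2
    rw [e1, Pi.smul_apply, e2]
    simp
  · have e : ∀ ω, gradN D ν i k ω ^ 2 =
        1 / (4 * D.c k ^ 2) * (D.mΔ k ω i * noise₁ ν D k ω) ^ 2 := fun ω => by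
      simp only [gradN]
      field_simp
      ring
    rw [integral_congr_ae (Eventually.of_forall e), integral_const_mul]
    calc _ ≤ 1 / (4 * D.c k ^ 2) * (max A₁ 0 * A₂) := by
          refine mul_le_mul_of_nonneg_left (h2.trans ?_) (by positivity)
          exact mul_le_mul_of_nonneg_left hmA (le_max_right _ _)
      _ = _ := by field_simp

/-- The central difference error is of order c³‖Δ‖³. Dividing by 2c leaves c²‖Δ‖³‖m(Δ)‖, whose
square is what the sixth-moment condition controls. -/
lemma exists_gradR_bound (hp : Perturbation P D) (hn : IIDNoise P ν D) (hstep : Stepsize D)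
    (hs : SmoothSetting P ν D U r B K) :
    ∃ A, 0 ≤ A ∧ ∀ i k, StronglyMeasurable[D.history (k + 1)] (gradR D ν U K i k) ∧
      MemLp (gradR D ν U K i k) 2 P ∧ ∫ ω, gradR D ν U K i k ω ^ 2 ∂P ≤ A ∧
      ∀ᵐ ω ∂P, |(P[gradR D ν U K i k | D.history k]) ω| ≤ A * D.c k ^ 2 := by
  obtain ⟨D₂, hD⟩ := hp.moments
  obtain ⟨c₀, hc₀, hc⟩ := exists_bound_c hstep
  refine ⟨max |(B * c₀ ^ 2) ^ 2 * (2 * D₂)| |B * (1 + D₂)|, le_max_of_le_left (abs_nonneg _),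
    fun i k => ?_⟩
  -- Before step K the query points may leave `U`; the error term is set to zero there, so the
  -- bounds hold for all k.
  by_cases hk : K ≤ k
  swap
  · have h0 : gradR D ν U K i k = 0 := by
      ext ω
      simp [gradR, hk]
    rw [h0, condExp_zero]
    refine ⟨stronglyMeasurable_zero, MemLp.zero, ?_, ?_⟩
    · simp only [Pi.zero_apply, ne_eq, OfNat.ofNat_ne_zero, not_false_eq_true, zero_pow,
        integral_zero]
      exact le_max_of_le_left (abs_nonneg _)
    filter_upwards with ω
    simp only [Pi.zero_apply, abs_zero]
    positivity
  have hck := hstep.c_pos k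
  have hi := (measurable_iter hp hn k).mono (D.history_mono k.le_succ) le_rfl
  have hΔ := D.measurable_Δ_succ k
  have hm := (hp.measurable_mΔ k).mono (D.hist₁_le_succ k) le_rfl
  have hL := hn.measurable_loss
  have hg := hs.measurable_gradOn.comp hi
  have hSM : StronglyMeasurable[D.history (k + 1)] (gradR D ν U K i k) := by
    have h1 : Measurable[D.history (k + 1)] fun ω => D.loss ν (D.qp k ω) :=
      hL.comp (hi.add (hΔ.const_smul (D.c k)))
    have h2 : Measurable[D.history (k + 1)] fun ω => D.loss ν (D.qm k ω) :=
      hL.comp (hi.sub (hΔ.const_smul (D.c k)))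
    have h3 : Measurable[D.history (k + 1)] fun ω =>
        (inner ℝ (gradOn D ν U (D.iter k ω)) (D.c k • D.Δ k ω) : ℝ) :=
      hg.inner (hΔ.const_smul (D.c k))
    have h4 : Measurable[D.history (k + 1)] fun ω => D.mΔ k ω i := by fun_prop
    have : gradR D ν U K i k = fun ω => (D.loss ν (D.qp k ω) - D.loss ν (D.qm k ω) -
      2 * (inner ℝ (gradOn D ν U (D.iter k ω)) (D.c k • D.Δ k ω))) / (2 * D.c k) * D.mΔ k ω i := by
      ext ω
      rw [gradR, if_pos hk]
    rw [this]
    exact ((((h1.sub h2).sub (h3.const_mul 2)).div_const _).mul h4).stronglyMeasurable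
  have hb : ∀ᵐ ω ∂P, |gradR D ν U K i k ω| ≤
      B * D.c k ^ 2 * (‖D.Δ k ω‖ ^ 3 * ‖D.m k ω (D.Δ k ω)‖) := by
    filter_upwards [hs.ball_subset k hk, hs.query_mem k hk] with ω h1 h2
    have hU : D.iter k ω ∈ U := h1 (Metric.mem_closedBall_self hs.r_pos.le)
    have h3 := central_difference_le hs.isOpen hs.contDiffOn (x := D.iter k ω)
      (u := D.c k • D.Δ k ω) (fun s hs => by simpa using h2 s hs 0 (by norm_num)) hs.third
    rw [← inner_gradient, norm_smul, Real.norm_of_nonneg hck.le] at h3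
    have h4 : gradOn D ν U (D.iter k ω) = gradient (D.loss ν) (D.iter k ω) :=
      Set.indicator_of_mem hU _
    rw [gradR, if_pos hk, h4, abs_mul, abs_div, abs_of_pos (show 0 < 2 * D.c k by positivity)]
    calc _ ≤ 2 * B * (D.c k * ‖D.Δ k ω‖) ^ 3 / (2 * D.c k) * ‖D.m k ω (D.Δ k ω)‖ := by
          refine mul_le_mul ?_ (abs_apply_le_norm _ _) (abs_nonneg _) ?_
          · exact div_le_div_of_nonneg_right h3 (by positivity)
          · have := hs.B_nonneg
            positivity
      _ = _ := by
          field_simp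
  obtain ⟨h2, h3, h4⟩ := (hD k).1.moment_bounds (history_le hp hn k) (n := 3)
    (hSM.mono (history_le hp hn (k + 1))).aestronglyMeasurable le_rfl
    (mul_nonneg hs.B_nonneg (sq_nonneg _)) hb
  refine ⟨hSM, h2, ?_, ?_⟩
  · have e1 := integral_le_of_condExp_le (history_le hp hn k) h3
    refine e1.trans (le_max_of_le_left ?_)
    rw [abs_mul, abs_of_nonneg (sq_nonneg (B * c₀ ^ 2))]
    have e2 : (B * D.c k ^ 2) ^ 2 ≤ (B * c₀ ^ 2) ^ 2 := by
      have := hs.B_nonneg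
      have := hc k
      gcongr
    exact mul_le_mul e2 (le_abs_self _) (by
      by_contra hcon
      have e3 : 0 ≤ ∫ ω, ‖D.m k ω (D.Δ k ω)‖ ^ 2 ∂P := integral_nonneg fun ω => sq_nonneg _
      have := integral_le_of_condExp_le (history_le hp hn k) (hD k).1.bound_sq
      linarith) (sq_nonneg _)
  · filter_upwards [h4] with ω h4
    refine h4.trans ?_
    calc B * D.c k ^ 2 * (1 + D₂) = B * (1 + D₂) * D.c k ^ 2 := by ring
      _ ≤ _ := mul_le_mul_of_nonneg_right ((le_abs_self _).trans (le_max_right _ _)) (sq_nonneg _)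

end GradientNoise

lemma norm_le_sum_abs {p : ℕ} (x : E p) : ‖x‖ ≤ ∑ i, |x i| := by
  have hx : x = ∑ i, x i • EuclideanSpace.single i (1 : ℝ) := by
    ext j
    simp [Finset.sum_apply, Pi.single_apply]
  calc ‖x‖ = ‖∑ i, x i • EuclideanSpace.single i (1 : ℝ)‖ := congrArg _ hx
    _ ≤ ∑ i, |x i| := norm_sum_le_of_le _ fun i _ => by simp [norm_smul]

lemma tendsto_of_tendsto_apply {p : ℕ} {S : ℕ → E p}
    (h : ∀ i, ∃ c, Tendsto (fun n => S n i) atTop (𝓝 c)) : ∃ s, Tendsto S atTop (𝓝 s) := by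
  choose c hc using h
  exact ⟨WithLp.toLp 2 c,
    ((PiLp.continuous_toLp 2 _).tendsto c).comp (tendsto_pi_nhds.2 hc)⟩

/-! ### Almost every trajectory is a descent path. -/

section GradientPath

variable {p : ℕ} {Ω Ξ : Type*} [mΩ : MeasurableSpace Ω] [MeasurableSpace Ξ]
  {P : Measure Ω} {ν : Measure Ξ} {D : Data p Ω Ξ} {U : Set (E p)} {r B : ℝ} {K : ℕ}
  [IsProbabilityMeasure P] [IsProbabilityMeasure ν]

lemma measurableSet_core {R : ℝ} : MeasurableSet (core U r R) :=
  (isClosed_closure.inter Metric.isClosed_closedBall).measurableSet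

lemma exists_gradBias_bound (hp : Perturbation P D) (hn : IIDNoise P ν D) (hstep : Stepsize D)
    (hs : SmoothSetting P ν D U r B K) :
    ∃ A, 0 ≤ A ∧ ∀ k, ∀ᵐ ω ∂P, ‖gradBias P D ν U K k ω‖ ≤ A * D.c k ^ 2 := by
  obtain ⟨A, hA0, hA⟩ := exists_gradR_bound hp hn hstep hs
  refine ⟨p * A, by positivity, fun k => ?_⟩
  filter_upwards [ae_all_iff.2 fun i => (hA i k).2.2.2] with ω hω
  refine (norm_le_sum_abs _).trans ?_
  calc _ ≤ ∑ i : Fin p, A * D.c k ^ 2 := Finset.sum_le_sum fun i _ => hω i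
    _ = _ := by simp; ring

open Classical in
lemma ae_tendsto_gradNoise (hp : Perturbation P D) (hn : IIDNoise P ν D) (hstep : Stepsize D)
    (hs : SmoothSetting P ν D U r B K) (R : ℕ) :
    ∀ᵐ ω ∂P, ∃ s, Tendsto (fun n => ∑ k ∈ Finset.range n,
      if K ≤ k ∧ D.iter k ω ∈ core U r R then D.a k • gradNoise P D ν U K k ω else 0)
      atTop (𝓝 s) := by
  obtain ⟨A₁, hA₁⟩ := exists_gradQ_martDiff hp hn
  obtain ⟨A₂, hA₂⟩ := exists_gradN_martDiff hp hn hstep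
  obtain ⟨A₃, -, hA₃⟩ := exists_gradR_bound hp hn hstep hs
  obtain ⟨A₄, hA₄⟩ := hs.exists_gradOn_bound R
  set A := max A₁ (max A₂ A₃) with hA
  have hmain : ∀ i, ∀ᵐ ω ∂P, ∃ s, Tendsto (fun n => ∑ k ∈ Finset.range n,
      if K ≤ k ∧ D.iter k ω ∈ core U r R then
      D.a k * (∑ j, gradOn D ν U (D.iter k ω) j * gradQ D i j k ω + gradN D ν i k ω +
        (gradR D ν U K i k ω - (P[gradR D ν U K i k | D.history k]) ω)) else 0) atTop (𝓝 s) :=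
    fun i => ae_tendsto_noise_series (histFiltration hp hn) (measurable_iter hp hn)
      measurableSet_core K (φ := fun j x => gradOn D ν U x j) (B := A₄) (A := A)
      (fun j => by
        have := hs.measurable_gradOn
        fun_prop)
      (fun j x hx => (abs_apply_le_norm _ j).trans (hA₄ x hx))
      (fun j k => (hA₁ i j k).measurable) (fun j k => (hA₁ i j k).memLp)
      (fun j k => (hA₁ i j k).mean) (fun j k => (hA₁ i j k).sq_le.trans (le_max_left _ _))
      (fun k => (hA₂ i k).measurable) (fun k => (hA₂ i k).memLp) (fun k => (hA₂ i k).mean)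
      (fun k => (hA₂ i k).sq_le.trans (div_le_div_of_nonneg_right
        ((le_max_left _ _).trans (le_max_right _ _)) (sq_nonneg _)))
      (fun k => (hA₃ i k).1) (fun k => (hA₃ i k).2.1)
      (fun k => (hA₃ i k).2.2.1.trans ((le_max_right _ _).trans (le_max_right _ _)))
      hstep.c_pos hstep.c_lim hstep.ac_sum
  filter_upwards [ae_all_iff.2 hmain] with ω hω
  refine tendsto_of_tendsto_apply fun i => ?_
  obtain ⟨s, hs⟩ := hω i
  refine ⟨s, hs.congr fun n => ?_⟩
  rw [WithLp.ofLp_sum, Finset.sum_apply]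
  refine Finset.sum_congr rfl fun k _ => ?_
  split_ifs
  · simp [gradNoise]
  · simp

/-- Almost every path of the parameter recursion is a descent path. -/
theorem ae_descentPath (hp : Perturbation P D) (hn : IIDNoise P ν D) (hstep : Stepsize D)
    (hs : SmoothSetting P ν D U r B K) :
    ∀ᵐ ω ∂P, DescentPath (D.loss ν) U r K D.a (fun k => D.iter k ω)
      (fun k => gradBias P D ν U K k ω) (fun k => gradNoise P D ν U K k ω) := by
  obtain ⟨A, -, hA⟩ := exists_gradBias_bound hp hn hstep hs
  have hball : ∀ᵐ ω ∂P, ∀ k ≥ K, Metric.closedBall (D.iter k ω) r ⊆ U :=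
    ae_all_iff.2 fun k => ae_all_iff.2 fun hk => hs.ball_subset k hk
  filter_upwards [ae_all_iff.2 hA, hball, ae_all_iff.2 (ae_tendsto_gradNoise hp hn hstep hs)] with
    ω h1 h2 h3
  refine ⟨hs.isOpen, hs.contDiffOn, hs.r_pos, h2, hstep.a_pos, hstep.a_lim, hstep.a_sum,
    fun k hk => ?_, ?_, h3⟩
  · have hU : D.iter k ω ∈ U := h2 k hk (Metric.mem_closedBall_self hs.r_pos.le)
    have h4 : gradOn D ν U (D.iter k ω) = gradient (D.loss ν) (D.iter k ω) :=
      Set.indicator_of_mem hU _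
    rw [← h4, ← gradEst_eq hstep.c_pos hk ω]
    rfl
  · refine squeeze_zero_norm h1 ?_
    simpa using (hstep.c_lim.pow 2).const_mul A

end GradientPath

/-! ### First and second moments of one step on history events. -/

section Energy

variable {p : ℕ} {Ω Ξ : Type*} [mΩ : MeasurableSpace Ω] [MeasurableSpace Ξ]
  {P : Measure Ω} {ν : Measure Ξ} {D : Data p Ω Ξ} {U : Set (E p)} {r B : ℝ} {K : ℕ}

lemma measurable_gradEst_iter (hp : Perturbation P D) (hn : IIDNoise P ν D) (k : ℕ) :
    Measurable[D.history (k + 1)] fun ω => D.gradEst k ω (D.iter k ω) := by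
  have hi := (measurable_iter hp hn k).mono (D.history_mono k.le_succ) le_rfl
  have hΔ := D.measurable_Δ_succ k
  have hξ := D.measurable_ξ_succ k
  have hm := (hp.measurable_mΔ k).mono (D.hist₁_le_succ k) le_rfl
  have h1 := hn.measurable_ell.comp (Measurable.prodMk (hi.add (hΔ.const_smul (D.c k)))
    (measurable_fst.comp hξ))
  have h2 := hn.measurable_ell.comp (Measurable.prodMk (hi.sub (hΔ.const_smul (D.c k)))
    ((measurable_fst.comp measurable_snd).comp hξ))
  exact ((h1.sub h2).div_const (2 * D.c k)).smul hm

omit mΩ in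
lemma gradEst_apply {k : ℕ} (hck : 0 < D.c k) (hk : K ≤ k) (ω : Ω) (i : Fin p) :
    D.gradEst k ω (D.iter k ω) i = inner ℝ (gradOn D ν U (D.iter k ω)) (D.Δ k ω) * D.mΔ k ω i +
      gradN D ν i k ω + gradR D ν U K i k ω := by
  simp only [Data.gradEst, gradN, gradR, if_pos hk, PiLp.smul_apply, smul_eq_mul,
    inner_smul_right, noise₁, Data.noise, Data.qp, Data.qm, Data.mΔ]
  have := hck.ne'
  field_simp
  ring

variable [IsProbabilityMeasure P] [IsProbabilityMeasure ν]

/-- On the event the gradient is bounded and known before the step, so each summand is a martingale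
difference with a bounded known coefficient. The restriction to a core is what secures
integrability. -/
lemma setIntegral_inner_gradNoise (hp : Perturbation P D) (hn : IIDNoise P ν D)
    (hstep : Stepsize D) (hs : SmoothSetting P ν D U r B K) {R : ℝ} {k : ℕ} {S : Set Ω}
    (hS : MeasurableSet[D.history k] S) (hSR : ∀ ω ∈ S, D.iter k ω ∈ core U r R) :
    IntegrableOn (fun ω => inner ℝ (gradOn D ν U (D.iter k ω)) (gradNoise P D ν U K k ω)) S P ∧
      ∫ ω in S, inner ℝ (gradOn D ν U (D.iter k ω)) (gradNoise P D ν U K k ω) ∂P = 0 := by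
  obtain ⟨A₁, hA₁⟩ := exists_gradQ_martDiff hp hn
  obtain ⟨A₂, hA₂⟩ := exists_gradN_martDiff hp hn hstep
  obtain ⟨A₃, -, hA₃⟩ := exists_gradR_bound hp hn hstep hs
  obtain ⟨A₄, hA₄⟩ := hs.exists_gradOn_bound R
  have hle := history_le hp hn k
  have hgm : Measurable[D.history k] fun ω => gradOn D ν U (D.iter k ω) :=
    hs.measurable_gradOn.comp (measurable_iter hp hn k)
  set Y₁ : Fin p → Ω → ℝ := fun i => S.indicator fun ω => gradOn D ν U (D.iter k ω) i with hY₁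
  set Y₂ : Fin p → Fin p → Ω → ℝ := fun i j => S.indicator fun ω =>
    gradOn D ν U (D.iter k ω) i * gradOn D ν U (D.iter k ω) j with hY₂
  have hgi : ∀ i, Measurable[D.history k] fun ω => gradOn D ν U (D.iter k ω) i := fun i => by
    fun_prop
  have hY₁m : ∀ i, StronglyMeasurable[D.history k] (Y₁ i) := fun i =>
    ((hgi i).indicator hS).stronglyMeasurable
  have hY₂m : ∀ i j, StronglyMeasurable[D.history k] (Y₂ i j) := fun i j =>
    (((hgi i).mul (hgi j)).indicator hS).stronglyMeasurable
  have hY₁B : ∀ i ω, |Y₁ i ω| ≤ |A₄| := fun i ω => by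
    by_cases hω : ω ∈ S
    · simp only [hY₁, Set.indicator_of_mem hω]
      exact (abs_apply_le_norm _ i).trans ((hA₄ _ (hSR ω hω)).trans (le_abs_self _))
    · simp [hY₁, hω]
  have hY₂B : ∀ i j ω, |Y₂ i j ω| ≤ |A₄| * |A₄| := fun i j ω => by
    by_cases hω : ω ∈ S
    · simp only [hY₂, Set.indicator_of_mem hω, abs_mul]
      exact mul_le_mul ((abs_apply_le_norm _ i).trans ((hA₄ _ (hSR ω hω)).trans (le_abs_self _)))
        ((abs_apply_le_norm _ j).trans ((hA₄ _ (hSR ω hω)).trans (le_abs_self _)))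
        (abs_nonneg _) (abs_nonneg _)
    · simp only [hY₂, Set.indicator_of_notMem hω, abs_zero]
      positivity
  have i1 := fun i j => (hA₁ i j k).integral_mul_eq_zero hle (hY₂m i j) (hY₂B i j)
  have i2 := fun i => (hA₂ i k).integral_mul_eq_zero hle (hY₁m i) (hY₁B i)
  have hR : ∀ i, MartDiff P (D.history k) (D.history (k + 1)) (4 * A₃)
      (gradR D ν U K i k - P[gradR D ν U K i k | D.history k]) := fun i =>
    ⟨(hA₃ i k).1.sub (stronglyMeasurable_condExp.mono (D.history_mono k.le_succ)),
      (hA₃ i k).2.1.sub ((hA₃ i k).2.1.condExp (by norm_num)),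
      condExp_sub_condExp_eq_zero hle ((hA₃ i k).2.1.integrable (by norm_num)),
      (integral_sub_condExp_sq_le (hA₃ i k).2.1).trans (by linarith [(hA₃ i k).2.2.1])⟩
  have i3 := fun i => (hR i).integral_mul_eq_zero hle (hY₁m i) (hY₁B i)
  set f : Fin p → Ω → ℝ := fun i ω => ∑ j, Y₂ i j ω * gradQ D i j k ω +
    Y₁ i ω * gradN D ν i k ω +
    Y₁ i ω * (gradR D ν U K i k - P[gradR D ν U K i k | D.history k]) ω with hf
  have hfi : ∀ i, Integrable (f i) P ∧ ∫ ω, f i ω ∂P = 0 := fun i => by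
    have e1 : Integrable (fun ω => ∑ j, Y₂ i j ω * gradQ D i j k ω) P :=
      integrable_finsetSum _ fun j _ => (i1 i j).1
    have e2 : Integrable (fun ω => ∑ j, Y₂ i j ω * gradQ D i j k ω +
      Y₁ i ω * gradN D ν i k ω) P := e1.add (i2 i).1
    refine ⟨e2.add (i3 i).1, ?_⟩
    simp only [hf]
    rw [integral_add e2 (i3 i).1, integral_add e1 (i2 i).1,
      integral_finsetSum _ fun j _ => (i1 i j).1, (i2 i).2, (i3 i).2]
    simp [(i1 i _).2]
  have heq : ∀ ω, S.indicator (fun ω => (inner ℝ (gradOn D ν U (D.iter k ω))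
      (gradNoise P D ν U K k ω) : ℝ)) ω = ∑ i, f i ω := fun ω => by
    by_cases hω : ω ∈ S
    · rw [Set.indicator_of_mem hω, inner_gradOn]
      refine Finset.sum_congr rfl fun i _ => ?_
      simp only [hf, hY₁, hY₂, Set.indicator_of_mem hω, gradNoise, Pi.sub_apply, mul_add,
        Finset.mul_sum, mul_assoc]
    · simp [hf, hY₁, hY₂, hω]
  constructor
  · rw [← integrable_indicator_iff (hle S hS)]
    exact (integrable_finsetSum _ fun i _ => (hfi i).1).congr
      (Eventually.of_forall fun ω => (heq ω).symm)
  · rw [← integral_indicator (hle S hS), integral_congr_ae (Eventually.of_forall heq),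
      integral_finsetSum _ fun i _ => (hfi i).1]
    simp [(hfi _).2]

-- Each coordinate is ⟨g, Δ⟩ m(Δ) plus oracle noise plus finite difference error; the first has
-- second moment at most a constant times that of g, the others O(1/c²). The constant does not
-- depend on R: the bound of the gradient on the core serves only integrability. This makes the
-- passage R → ∞ possible later.
set_option maxHeartbeats 400000 in
lemma exists_setIntegral_gradEst_sq_le (hp : Perturbation P D) (hn : IIDNoise P ν D)
    (hstep : Stepsize D) (hs : SmoothSetting P ν D U r B K) :
    ∃ A, 0 ≤ A ∧ ∀ (R : ℝ) (k : ℕ), K ≤ k → ∀ S : Set Ω, MeasurableSet[D.history k] S →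
      (∀ ω ∈ S, D.iter k ω ∈ core U r R) →
      IntegrableOn (fun ω => ‖D.gradEst k ω (D.iter k ω)‖ ^ 2) S P ∧
      ∫ ω in S, ‖D.gradEst k ω (D.iter k ω)‖ ^ 2 ∂P ≤
        A * (∫ ω in S, ‖gradOn D ν U (D.iter k ω)‖ ^ 2 ∂P + 1 / D.c k ^ 2) := by
  obtain ⟨D₂, hD⟩ := hp.moments
  obtain ⟨A₂, hA₂⟩ := exists_gradN_martDiff hp hn hstep
  obtain ⟨A₃, hA₃0, hA₃⟩ := exists_gradR_bound hp hn hstep hs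
  obtain ⟨c₀, hc₀, hc⟩ := exists_bound_c hstep
  set M := max (max (2 * D₂) 0) (|A₂| + A₃ * c₀ ^ 2) with hM
  have hM0 : 0 ≤ M := le_max_of_le_left (le_max_right _ _)
  refine ⟨p * (3 * M), by positivity, fun R k hk S hS hSR => ?_⟩
  have hle := history_le hp hn k
  obtain ⟨A₄, hA₄⟩ := hs.exists_gradOn_bound R
  have hck := hstep.c_pos k
  have hgm : Measurable[D.history k] fun ω => gradOn D ν U (D.iter k ω) :=
    hs.measurable_gradOn.comp (measurable_iter hp hn k)
  set Y : Ω → ℝ := S.indicator fun ω => ‖gradOn D ν U (D.iter k ω)‖ with hY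
  have hYm : StronglyMeasurable[D.history k] Y := ((measurable_norm.comp hgm).indicator hS).stronglyMeasurable
  have hY2 : MemLp Y 2 P := MemLp.of_bound (hYm.mono hle).aestronglyMeasurable |A₄|
    (Eventually.of_forall fun ω => by
      by_cases hω : ω ∈ S
      · simp only [hY, Set.indicator_of_mem hω, norm_norm]
        exact (hA₄ _ (hSR ω hω)).trans (le_abs_self _)
      · simp [hY, hω])
  set X : Ω → ℝ := fun ω => ‖D.Δ k ω‖ * ‖D.mΔ k ω‖ with hX
  have hmΔ := (hp.measurable_mΔ k).mono ((D.hist₁_le_hist₂ k).trans (hist₂_le hp hn k)) le_rfl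
  have hXm : AEStronglyMeasurable X P := by
    have h2 := hp.measurable_Δ k
    exact Measurable.aestronglyMeasurable (by fun_prop)
  obtain ⟨hX2, hXD, -⟩ := (hD k).1.moment_bounds hle (n := 1) (C := 1) hXm (by norm_num)
    zero_le_one (Eventually.of_forall fun ω => by
      rw [one_mul, pow_one, abs_of_nonneg (by positivity)]
      rfl)
  obtain ⟨hYX, hYXle⟩ := memLp_mul_of_condExp_sq_le hle hX2 hXD hYm hY2
  rw [one_pow, one_mul] at hYXle
  have hYint : ∫ ω, Y ω ^ 2 ∂P = ∫ ω in S, ‖gradOn D ν U (D.iter k ω)‖ ^ 2 ∂P := by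
    rw [← integral_indicator (hle S hS)]
    refine integral_congr_ae (Eventually.of_forall fun ω => ?_)
    by_cases hω : ω ∈ S <;> simp [hY, hω]
  set G : Fin p → Ω → ℝ := fun i ω => S.indicator (fun ω => D.gradEst k ω (D.iter k ω) i) ω with hG
  set T : Fin p → Ω → ℝ := fun i ω =>
    3 * ((Y * X) ω ^ 2 + gradN D ν i k ω ^ 2 + gradR D ν U K i k ω ^ 2) with hT
  have hTi : ∀ i, Integrable (T i) P := fun i =>
    ((hYX.integrable_sq.add (hA₂ i k).memLp.integrable_sq).add
      (hA₃ i k).2.1.integrable_sq).const_mul 3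
  have hGT : ∀ i ω, G i ω ^ 2 ≤ T i ω := fun i ω => by
    by_cases hω : ω ∈ S
    · have h1 : G i ω = inner ℝ (gradOn D ν U (D.iter k ω)) (D.Δ k ω) * D.mΔ k ω i +
          gradN D ν i k ω + gradR D ν U K i k ω := by
        simp only [hG, Set.indicator_of_mem hω]
        exact gradEst_apply hck hk ω i
      have h2 : |inner ℝ (gradOn D ν U (D.iter k ω)) (D.Δ k ω) * D.mΔ k ω i| ≤ (Y * X) ω := by
        rw [abs_mul, Pi.mul_apply]
        simp only [hY, hX, Set.indicator_of_mem hω]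
        rw [← mul_assoc]
        exact mul_le_mul (abs_real_inner_le_norm _ _) (abs_apply_le_norm _ _) (abs_nonneg _)
          (by positivity)
      have h3 := sq_le_sq.2 (h2.trans (le_abs_self _))
      rw [h1]
      simp only [hT]
      set x := inner ℝ (gradOn D ν U (D.iter k ω)) (D.Δ k ω) * D.mΔ k ω i
      nlinarith [sq_nonneg (x - gradN D ν i k ω), sq_nonneg (x - gradR D ν U K i k ω),
        sq_nonneg (gradN D ν i k ω - gradR D ν U K i k ω)]
    · have : G i ω = 0 := by simp [hG, hω]
      rw [this, zero_pow two_ne_zero]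
      simp only [hT]
      positivity
  have hGm : ∀ i, AEStronglyMeasurable (G i) P := fun i => by
    have h1 := measurable_gradEst_iter hp hn k
    have h2 := h1.mono (history_le hp hn (k + 1)) le_rfl
    have h3 : Measurable fun ω => D.gradEst k ω (D.iter k ω) i :=
      (EuclideanSpace.proj i : E p →L[ℝ] ℝ).continuous.measurable.comp h2
    exact (h3.indicator (hle S hS)).aestronglyMeasurable
  have hGi : ∀ i, Integrable (fun ω => G i ω ^ 2) P := fun i =>
    (hTi i).mono' ((hGm i).pow 2) (Eventually.of_forall fun ω => by
      rw [Real.norm_of_nonneg (sq_nonneg _)]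
      exact hGT i ω)
  have heq : ∀ ω, S.indicator (fun ω => ‖D.gradEst k ω (D.iter k ω)‖ ^ 2) ω = ∑ i, G i ω ^ 2 :=
    fun ω => by
      by_cases hω : ω ∈ S
      · simp only [hG, Set.indicator_of_mem hω]
        rw [EuclideanSpace.norm_sq_eq]
        simp
      · simp [hG, hω]
  constructor
  · rw [← integrable_indicator_iff (hle S hS)]
    exact (integrable_finsetSum _ fun i _ => hGi i).congr
      (Eventually.of_forall fun ω => (heq ω).symm)
  · rw [← integral_indicator (hle S hS), integral_congr_ae (Eventually.of_forall heq),
      integral_finsetSum _ fun i _ => hGi i]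
    have hb : ∀ i, ∫ ω, G i ω ^ 2 ∂P ≤
        3 * M * (∫ ω in S, ‖gradOn D ν U (D.iter k ω)‖ ^ 2 ∂P + 1 / D.c k ^ 2) := fun i => by
      refine (integral_mono (hGi i) (hTi i) (hGT i)).trans ?_
      simp only [hT]
      have e12 : Integrable (fun ω => (Y * X) ω ^ 2 + gradN D ν i k ω ^ 2) P :=
        hYX.integrable_sq.add (hA₂ i k).memLp.integrable_sq
      rw [integral_const_mul, integral_add e12 (hA₃ i k).2.1.integrable_sq,
        integral_add hYX.integrable_sq (hA₂ i k).memLp.integrable_sq]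
      set I := ∫ ω in S, ‖gradOn D ν U (D.iter k ω)‖ ^ 2 ∂P with hI
      have hI0 : 0 ≤ I := integral_nonneg fun ω => sq_nonneg _
      have f1 : ∫ ω, (Y * X) ω ^ 2 ∂P ≤ M * I := by
        rw [hYint] at hYXle
        exact hYXle.trans (mul_le_mul_of_nonneg_right (le_max_left _ _) hI0)
      have f2 : ∫ ω, gradN D ν i k ω ^ 2 ∂P ≤ |A₂| / D.c k ^ 2 :=
        (hA₂ i k).sq_le.trans (div_le_div_of_nonneg_right (le_abs_self _) (sq_nonneg _))
      have f3 : ∫ ω, gradR D ν U K i k ω ^ 2 ∂P ≤ A₃ * c₀ ^ 2 / D.c k ^ 2 := by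
        refine (hA₃ i k).2.2.1.trans ?_
        rw [le_div_iff₀ (by positivity)]
        have := hc k
        gcongr
      have f4 : (|A₂| + A₃ * c₀ ^ 2) / D.c k ^ 2 ≤ M / D.c k ^ 2 :=
        div_le_div_of_nonneg_right (le_max_right _ _) (sq_nonneg _)
      rw [add_div] at f4
      have f5 : 3 * M * (I + 1 / D.c k ^ 2) = 3 * (M * I + M / D.c k ^ 2) := by ring
      rw [f5]
      linarith
    calc _ ≤ ∑ i : Fin p,
        3 * M * (∫ ω in S, ‖gradOn D ν U (D.iter k ω)‖ ^ 2 ∂P + 1 / D.c k ^ 2) :=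
          Finset.sum_le_sum fun i _ => hb i
      _ = _ := by simp; ring

end Energy

/-! ### The loss does not tend to infinity in the unique minimizer case. -/

section NonExplosion

variable {p : ℕ} {Ω Ξ : Type*} [mΩ : MeasurableSpace Ω] [MeasurableSpace Ξ]
  {P : Measure Ω} {ν : Measure Ξ} {D : Data p Ω Ξ} {U : Set (E p)} {r B : ℝ} {K : ℕ} {θs : E p}

lemma UniqueMin.loss_le (h : UniqueMin P ν D θs) (x : E p) : D.loss ν θs ≤ D.loss ν x := by
  rcases eq_or_ne x θs with rfl | hx
  · exact le_rfl
  · exact (h.unique_min x hx).le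

lemma UniqueMin.exists_taylor (h : UniqueMin P ν D θs) :
    ∃ H K', 0 ≤ H ∧ ∀ k ≥ K', ∀ᵐ ω ∂P, D.loss ν (D.iter (k + 1) ω) ≤ D.loss ν (D.iter k ω) -
      D.a k * inner ℝ (gradient (D.loss ν) (D.iter k ω)) (D.gradEst k ω (D.iter k ω)) +
      H * (D.a k ^ 2 * ‖D.gradEst k ω (D.iter k ω)‖ ^ 2) := by
  obtain ⟨V, D₄, K', hV, hL, hD₄, hseg⟩ := h.hess
  refine ⟨|p * (p * D₄)|, K', abs_nonneg _, fun k hk => ?_⟩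
  filter_upwards [hseg k hk] with ω hω
  have h1 := taylor_one_segment hV hL hω (B := |p * (p * D₄)|) fun z hz =>
    (norm_fderiv_fderiv_le fun i j => (hD₄ z (hω hz) i j).le).trans (le_abs_self _)
  have h2 : D.iter (k + 1) ω - D.iter k ω = -(D.a k • D.gradEst k ω (D.iter k ω)) := by
    rw [Data.iter, sub_sub_cancel_left]
  rw [← inner_gradient, h2, inner_neg_right, inner_smul_right, norm_neg, norm_smul, mul_pow,
    Real.norm_eq_abs, sq_abs] at h1
  linarith [(abs_le.1 h1).2]

variable [IsProbabilityMeasure P] [IsProbabilityMeasure ν]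

/-- The values cannot increase much in mean away from the minimizer. -/
lemma exists_lintegral_succ_le (hp : Perturbation P D) (hn : IIDNoise P ν D) (hstep : Stepsize D)
    (hs : SmoothSetting P ν D U r B K) (hu : UniqueMin P ν D θs) :
    ∃ A k₀, 0 ≤ A ∧ ∀ (R : ℝ) (k : ℕ), k₀ ≤ k → ∀ S : Set Ω, MeasurableSet[D.history k] S →
      (∀ ω ∈ S, D.iter k ω ∈ core U r R ∧ D.loss ν θs + 1 ≤ D.loss ν (D.iter k ω)) →
      ∫⁻ ω in S, ENNReal.ofReal (D.loss ν (D.iter (k + 1) ω) - D.loss ν θs) ∂P ≤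
        ∫⁻ ω in S, ENNReal.ofReal (D.loss ν (D.iter k ω) - D.loss ν θs) ∂P +
          ENNReal.ofReal (A * (D.a k ^ 2 / D.c k ^ 2)) := by
  obtain ⟨H, K', hH0, hH⟩ := hu.exists_taylor
  obtain ⟨A₁, hA₁0, hA₁⟩ := exists_gradBias_bound hp hn hstep hs
  obtain ⟨A₂, hA₂0, hA₂⟩ := exists_setIntegral_gradEst_sq_le hp hn hstep hs
  obtain ⟨η, hη, hηx⟩ := DescentPath.exists_gradient_bound hs.isOpen
    hs.contDiffOn.continuousOn hs.r_pos hu.grad one_pos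
  -- The first inequality makes the bias at most half the gradient norm; the second lets the
  -- remaining drift -a‖g‖²/2 absorb the part of the second-order term proportional to ‖g‖².
  have hsmall : ∀ᶠ k in atTop, A₁ * D.c k ^ 2 < η / 2 ∧ H * A₂ * D.a k < 1 / 2 := by
    have t1 : Tendsto (fun k => A₁ * D.c k ^ 2) atTop (𝓝 0) := by
      simpa using (hstep.c_lim.pow 2).const_mul A₁
    have t2 : Tendsto (fun k => H * A₂ * D.a k) atTop (𝓝 0) := by
      simpa using hstep.a_lim.const_mul (H * A₂)
    exact (t1.eventually (gt_mem_nhds (by positivity))).and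
      (t2.eventually (gt_mem_nhds (by norm_num)))
  obtain ⟨k₁, hk₁⟩ := eventually_atTop.1 hsmall
  refine ⟨H * A₂, max k₁ (max K K'), by positivity, fun R k hk S hS hSR => ?_⟩
  have hkK : K ≤ k := (le_max_left _ _).trans ((le_max_right _ _).trans hk)
  have hkK' : K' ≤ k := (le_max_right _ _).trans ((le_max_right _ _).trans hk)
  obtain ⟨hsm1, hsm2⟩ := hk₁ k ((le_max_left _ _).trans hk)
  have hle := history_le hp hn k
  have hS₀ := hle S hS
  have hak := hstep.a_pos k
  have hck := hstep.c_pos k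
  obtain ⟨A₄, hA₄⟩ := hs.exists_gradOn_bound R
  obtain ⟨A₅, hA₅⟩ := (isCompact_core (U := U) (r := r) R).exists_bound_of_continuousOn
    (hs.contDiffOn.continuousOn.mono (core_subset hs.r_pos R))
  have hi := measurable_iter hp hn k
  have hgm : Measurable[D.history k] fun ω => gradOn D ν U (D.iter k ω) :=
    hs.measurable_gradOn.comp hi
  obtain ⟨hN1, hN2⟩ := setIntegral_inner_gradNoise hp hn hstep hs hS fun ω hω => (hSR ω hω).1
  obtain ⟨hG1, hG2⟩ := hA₂ R k hkK S hS fun ω hω => (hSR ω hω).1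
  set g : Ω → E p := fun ω => gradOn D ν U (D.iter k ω) with hg
  set G : Ω → E p := fun ω => D.gradEst k ω (D.iter k ω) with hGdef
  set e : Ω → E p := fun ω => gradNoise P D ν U K k ω with he
  have hVm : Measurable fun ω => D.loss ν (D.iter k ω) :=
    hn.measurable_loss.comp (hi.mono hle le_rfl)
  have hVi : IntegrableOn (fun ω => D.loss ν (D.iter k ω) - D.loss ν θs) S P := by
    refine Integrable.sub ?_ (integrable_const _)
    refine Integrable.of_bound hVm.aestronglyMeasurable A₅ ?_
    exact (ae_restrict_iff' hS₀).2 (Eventually.of_forall fun ω hω => hA₅ _ (hSR ω hω).1)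
  have hgi : IntegrableOn (fun ω => ‖g ω‖ ^ 2) S P := by
    refine Integrable.of_bound ((measurable_norm.comp (hgm.mono hle le_rfl)).pow_const
      2).aestronglyMeasurable (A₄ ^ 2) ?_
    refine (ae_restrict_iff' hS₀).2 (Eventually.of_forall fun ω hω => ?_)
    rw [Real.norm_of_nonneg (sq_nonneg _)]
    exact pow_le_pow_left₀ (norm_nonneg _) (hA₄ _ (hSR ω hω).1) 2
  -- An integrable majorant of the next excess: half of the squared gradient has already been spent
  -- on the bias, and the noise term integrates to zero over the event.
  set W : Ω → ℝ := fun ω => D.loss ν (D.iter k ω) - D.loss ν θs -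
    D.a k * (‖g ω‖ ^ 2 / 2 + inner ℝ (g ω) (e ω)) + H * (D.a k ^ 2 * ‖G ω‖ ^ 2) with hW
  have hWi : IntegrableOn W S P :=
    (hVi.sub (((hgi.div_const 2).add hN1).const_mul (D.a k))).add
      ((hG1.const_mul (D.a k ^ 2)).const_mul H)
  have hWle : ∀ᵐ ω ∂P.restrict S, D.loss ν (D.iter (k + 1) ω) - D.loss ν θs ≤ W ω := by
    rw [ae_restrict_iff' hS₀]
    filter_upwards [hH k hkK', hA₁ k, hs.ball_subset k hkK] with ω h1 h2 h3 hω
    have hU : D.iter k ω ∈ U := h3 (Metric.mem_closedBall_self hs.r_pos.le)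
    have hgω : g ω = gradient (D.loss ν) (D.iter k ω) := Set.indicator_of_mem hU _
    have hge : η ≤ ‖g ω‖ := by
      rw [hgω]
      exact hηx _ h3 (hSR ω hω).2
    have hGω : G ω = g ω + gradBias P D ν U K k ω + e ω := gradEst_eq hstep.c_pos hkK ω
    rw [← hgω] at h1
    have h4 : inner ℝ (g ω) (G ω) = ‖g ω‖ ^ 2 + inner ℝ (g ω) (gradBias P D ν U K k ω) +
        inner ℝ (g ω) (e ω) := by
      rw [hGω, inner_add_right, inner_add_right, real_inner_self_eq_norm_sq]
    have h5 := (abs_le.1 (abs_real_inner_le_norm (g ω) (gradBias P D ν U K k ω))).1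
    have h6 : ‖g ω‖ * ‖gradBias P D ν U K k ω‖ ≤ ‖g ω‖ * (‖g ω‖ / 2) :=
      mul_le_mul_of_nonneg_left (by linarith) (norm_nonneg _)
    have h7 : ‖g ω‖ ^ 2 / 2 + inner ℝ (g ω) (e ω) ≤ inner ℝ (g ω) (G ω) := by
      rw [h4]
      nlinarith
    have h8 := mul_le_mul_of_nonneg_left h7 hak.le
    change _ ≤ D.loss ν (D.iter k ω) - D.a k * inner ℝ (g ω) (G ω) + H * (D.a k ^ 2 * ‖G ω‖ ^ 2)
      at h1
    simp only [hW]
    linarith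
  have hW0 : 0 ≤ᵐ[P.restrict S] W := by
    filter_upwards [hWle] with ω h1
    have := hu.loss_le (D.iter (k + 1) ω)
    simp only [Pi.zero_apply]
    linarith
  have hWint : ∫ ω in S, W ω ∂P ≤ ∫ ω in S, (D.loss ν (D.iter k ω) - D.loss ν θs) ∂P +
      H * A₂ * (D.a k ^ 2 / D.c k ^ 2) := by
    set I := ∫ ω in S, ‖g ω‖ ^ 2 ∂P with hI
    have hI0 : 0 ≤ I := integral_nonneg fun ω => sq_nonneg _
    have e1 : ∫ ω in S, W ω ∂P = ∫ ω in S, (D.loss ν (D.iter k ω) - D.loss ν θs) ∂P -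
        D.a k * (I / 2) + H * (D.a k ^ 2 * ∫ ω in S, ‖G ω‖ ^ 2 ∂P) := by
      have i1 : IntegrableOn (fun ω => ‖g ω‖ ^ 2 / 2 + inner ℝ (g ω) (e ω)) S P :=
        (hgi.div_const 2).add hN1
      have i2 : IntegrableOn (fun ω => D.loss ν (D.iter k ω) - D.loss ν θs -
        D.a k * (‖g ω‖ ^ 2 / 2 + inner ℝ (g ω) (e ω))) S P := hVi.sub (i1.const_mul _)
      simp only [hW]
      rw [integral_add i2 ((hG1.const_mul (D.a k ^ 2)).const_mul H),
        integral_sub hVi (i1.const_mul _), integral_const_mul, integral_const_mul,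
        integral_const_mul, integral_add (hgi.div_const 2) hN1, hN2, integral_div, add_zero]
    rw [e1]
    have e2 : H * (D.a k ^ 2 * ∫ ω in S, ‖G ω‖ ^ 2 ∂P) ≤
        H * (D.a k ^ 2 * (A₂ * (I + 1 / D.c k ^ 2))) := by gcongr
    have e3 : H * A₂ * D.a k * (D.a k * I) ≤ 1 / 2 * (D.a k * I) :=
      mul_le_mul_of_nonneg_right hsm2.le (by positivity)
    have e4 : H * (D.a k ^ 2 * (A₂ * (I + 1 / D.c k ^ 2))) =
        H * A₂ * D.a k * (D.a k * I) + H * A₂ * (D.a k ^ 2 / D.c k ^ 2) := by ring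
    linarith
  have hV0 : 0 ≤ᵐ[P.restrict S] fun ω => D.loss ν (D.iter k ω) - D.loss ν θs :=
    Eventually.of_forall fun ω => sub_nonneg.2 (hu.loss_le _)
  calc _ ≤ ∫⁻ ω in S, ENNReal.ofReal (W ω) ∂P :=
        lintegral_mono_ae (hWle.mono fun ω hω => ENNReal.ofReal_le_ofReal hω)
    _ = ENNReal.ofReal (∫ ω in S, W ω ∂P) := (ofReal_integral_eq_lintegral_ofReal hWi hW0).symm
    _ ≤ ENNReal.ofReal (∫ ω in S, (D.loss ν (D.iter k ω) - D.loss ν θs) ∂P +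
      H * A₂ * (D.a k ^ 2 / D.c k ^ 2)) := ENNReal.ofReal_le_ofReal hWint
    _ = _ := by
      rw [ENNReal.ofReal_add (integral_nonneg_of_ae hV0) (by positivity),
        ofReal_integral_eq_lintegral_ofReal hVi hV0]

/-- Almost surely, the values along the iterates do not tend to infinity. -/
theorem ae_frequently_lt (hp : Perturbation P D) (hn : IIDNoise P ν D) (hstep : Stepsize D)
    (hs : SmoothSetting P ν D U r B K) (hu : UniqueMin P ν D θs) :
    ∀ᵐ ω ∂P, ∃ c > 0, ∃ᶠ k in atTop, D.loss ν (D.iter k ω) < D.loss ν θs + c := by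
  obtain ⟨A, k₀, hA0, hA⟩ := exists_lintegral_succ_le hp hn hstep hs hu
  set F := {x | Metric.closedBall x r ⊆ U} with hF
  set V : ℕ → Ω → ENNReal := fun k ω =>
    ENNReal.ofReal (D.loss ν (D.iter k ω) - D.loss ν θs) with hV
  have him : ∀ k, Measurable (D.iter k) := fun k =>
    (measurable_iter hp hn k).mono (history_le hp hn k) le_rfl
  have hVm : ∀ k, Measurable (V k) := fun k =>
    ((hn.measurable_loss.comp (him k)).sub_const _).ennreal_ofReal
  have hmain : ∀ n ≥ k₀, ∀ N : ℕ, ∀ᵐ ω ∂P, ¬ (D.loss ν (D.iter n ω) - D.loss ν θs ≤ N ∧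
      (∀ j ≥ n, D.iter j ω ∈ closure F ∧ D.loss ν θs + 1 ≤ D.loss ν (D.iter j ω)) ∧
      Tendsto (fun k => D.loss ν (D.iter k ω) - D.loss ν θs) atTop atTop) := by
    intro n hn₀ N
    set M : ENNReal := ENNReal.ofReal N + ENNReal.ofReal (A * ∑' k, D.a k ^ 2 / D.c k ^ 2) with hM
    -- The event that up to time k the path has stayed in the core and above level 1. It is known at
    -- time k and decreases in k, so shrinking it only lowers the integral of a nonnegative excess.
    set S : ℕ → ℕ → Set Ω := fun R k => {ω | D.loss ν (D.iter n ω) - D.loss ν θs ≤ N} ∩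
      ⋂ j ∈ Finset.Icc n k, {ω | D.iter j ω ∈ core U r R ∧
        D.loss ν θs + 1 ≤ D.loss ν (D.iter j ω)} with hS
    have hSm : ∀ R, ∀ k ≥ n, MeasurableSet[D.history k] (S R k) := by
      intro R k hk
      have hit : ∀ j ≤ k, Measurable[D.history k] (D.iter j) := fun j hj =>
        (measurable_iter hp hn j).mono (D.history_mono hj) le_rfl
      refine MeasurableSet.inter ?_ (Finset.measurableSet_biInter _ fun j hj => ?_)
      · have h1 : Measurable[D.history k] fun ω => D.loss ν (D.iter n ω) - D.loss ν θs :=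
          (hn.measurable_loss.comp (hit n hk)).sub_const _
        exact h1 measurableSet_Iic
      · have hj' := hit j (Finset.mem_Icc.1 hj).2
        exact (hj' measurableSet_core).inter
          ((hn.measurable_loss.comp hj') (measurableSet_Ici (a := D.loss ν θs + 1)))
    have hbound : ∀ R, ∀ k ≥ n, ∫⁻ ω in S R k, V k ω ∂P ≤
        ENNReal.ofReal N + ENNReal.ofReal (A * ∑ i ∈ Finset.range k, D.a i ^ 2 / D.c i ^ 2) := by
      intro R k hk
      induction k, hk using Nat.le_induction with
      | base =>
        refine le_add_right ?_
        calc _ ≤ ∫⁻ _ in S R n, ENNReal.ofReal N ∂P :=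
              setLIntegral_mono' (history_le hp hn n _ (hSm R n le_rfl)) fun ω hω =>
                ENNReal.ofReal_le_ofReal hω.1
          _ = ENNReal.ofReal N * P (S R n) := by simp
          _ ≤ ENNReal.ofReal N * 1 := by gcongr; exact prob_le_one
          _ = _ := mul_one _
      | succ k hk ih =>
        have hsub : S R (k + 1) ⊆ S R k := Set.inter_subset_inter_right _
          (Set.biInter_subset_biInter_left (Finset.coe_subset.2
            (Finset.Icc_subset_Icc le_rfl k.le_succ)))
        have h1 := hA R k (hn₀.trans hk) (S R k) (hSm R k hk) fun ω hω =>
          Set.mem_iInter₂.1 hω.2 k (Finset.mem_Icc.2 ⟨hk, le_rfl⟩)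
        refine (lintegral_mono_set hsub).trans (h1.trans ((add_le_add_left ih _).trans ?_))
        rw [add_assoc, ← ENNReal.ofReal_add, ← mul_add, Finset.sum_range_succ]
        · have : ∀ i, 0 ≤ D.a i ^ 2 / D.c i ^ 2 := fun i => by positivity
          exact mul_nonneg hA0 (Finset.sum_nonneg fun i _ => this i)
        · positivity
    -- The closure of the admissible set is used because it is Borel.
    set T : Set Ω := {ω | D.loss ν (D.iter n ω) - D.loss ν θs ≤ N} ∩ ⋂ j, ⋂ (_ : n ≤ j),
      {ω | D.iter j ω ∈ closure F ∧ D.loss ν θs + 1 ≤ D.loss ν (D.iter j ω)} with hT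
    have hTm : MeasurableSet T := by
      refine MeasurableSet.inter ?_ (MeasurableSet.iInter fun j => MeasurableSet.iInter fun _ => ?_)
      · exact ((hn.measurable_loss.comp (him n)).sub_const _) measurableSet_Iic
      · exact ((him j) isClosed_closure.measurableSet).inter
          ((hn.measurable_loss.comp (him j)) (measurableSet_Ici (a := D.loss ν θs + 1)))
    have hTbound : ∀ k ≥ n, ∫⁻ ω in T, V k ω ∂P ≤ M := by
      intro k hk
      -- Up to a fixed time only finitely many iterates matter, so some R works for each sample
      -- point. The bound is uniform in R, and monotone convergence removes the localization.
      have hcover : T ⊆ ⋃ R, S R k := by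
        intro ω hω
        obtain ⟨R, hR⟩ := exists_nat_ge (∑ j ∈ Finset.Icc n k, ‖D.iter j ω‖)
        refine Set.mem_iUnion.2 ⟨R, hω.1, Set.mem_iInter₂.2 fun j hj => ?_⟩
        obtain ⟨h1, h2⟩ := Set.mem_iInter₂.1 hω.2 j (Finset.mem_Icc.1 hj).1
        refine ⟨⟨h1, ?_⟩, h2⟩
        rw [mem_closedBall_zero_iff]
        exact (Finset.single_le_sum (f := fun j => ‖D.iter j ω‖)
          (fun i _ => norm_nonneg _) hj).trans hR
      have hdir : Directed (· ⊆ ·) fun R => S R k := by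
        refine Monotone.directed_le (f := fun R => S R k) fun R R' hRR' => ?_
        refine Set.inter_subset_inter_right _ (Set.iInter₂_mono fun j _ ω hω => ⟨⟨hω.1.1, ?_⟩, hω.2⟩)
        exact Metric.closedBall_subset_closedBall (by exact_mod_cast hRR') hω.1.2
      calc _ ≤ ∫⁻ ω in ⋃ R, S R k, V k ω ∂P := lintegral_mono_set hcover
        _ = ⨆ R, ∫⁻ ω in S R k, V k ω ∂P := setLIntegral_iUnion_of_directed _ hdir
        _ ≤ M := iSup_le fun R => (hbound R k hk).trans (add_le_add_right
          (ENNReal.ofReal_le_ofReal (mul_le_mul_of_nonneg_left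
            (hstep.ac_sum.sum_le_tsum _ fun i _ => by positivity) hA0)) _)
    have hMtop : M < ⊤ := ENNReal.add_lt_top.2 ⟨ENNReal.ofReal_lt_top, ENNReal.ofReal_lt_top⟩
    -- By Fatou's lemma the lower limit of the excess is almost surely finite on `T`, which excludes
    -- divergence to infinity there.
    have hfatou : ∫⁻ ω in T, liminf (fun k => V k ω) atTop ∂P ≤ M :=
      (lintegral_liminf_le hVm).trans (liminf_le_of_frequently_le'
        ((eventually_ge_atTop n).mono fun k hk => hTbound k hk).frequently)
    have hfin := ae_lt_top (Measurable.liminf hVm) (hfatou.trans_lt hMtop).ne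
    rw [ae_restrict_iff' hTm] at hfin
    filter_upwards [hfin] with ω hω hcon
    obtain ⟨h1, h2, h3⟩ := hcon
    have h4 := hω ⟨h1, Set.mem_iInter₂.2 h2⟩
    have h5 : Tendsto (fun k => V k ω) atTop (𝓝 ⊤) := ENNReal.tendsto_ofReal_nhds_top.2 h3
    rw [h5.liminf_eq] at h4
    exact lt_irrefl _ h4
  have hball : ∀ᵐ ω ∂P, ∀ k ≥ K, Metric.closedBall (D.iter k ω) r ⊆ U :=
    ae_all_iff.2 fun k => ae_all_iff.2 fun hk => hs.ball_subset k hk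
  have hall : ∀ᵐ ω ∂P, ∀ n ≥ k₀, ∀ N : ℕ, ¬ (D.loss ν (D.iter n ω) - D.loss ν θs ≤ N ∧
      (∀ j ≥ n, D.iter j ω ∈ closure F ∧ D.loss ν θs + 1 ≤ D.loss ν (D.iter j ω)) ∧
      Tendsto (fun k => D.loss ν (D.iter k ω) - D.loss ν θs) atTop atTop) :=
    ae_all_iff.2 fun n => ae_all_iff.2 fun hn => ae_all_iff.2 fun N => hmain n hn N
  filter_upwards [hball, hall] with ω hω1 hω2
  by_contra hcon
  push Not at hcon
  have htop : Tendsto (fun k => D.loss ν (D.iter k ω) - D.loss ν θs) atTop atTop := by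
    rw [tendsto_atTop]
    intro c
    have := hcon (max c 1) (by positivity)
    filter_upwards [this] with k hk
    linarith [le_max_left c 1]
  obtain ⟨n₁, hn₁⟩ := eventually_atTop.1 (hcon 1 one_pos)
  set n := max n₁ (max k₀ K) with hn'
  obtain ⟨N, hN⟩ := exists_nat_ge (D.loss ν (D.iter n ω) - D.loss ν θs)
  refine hω2 n ((le_max_left _ _).trans (le_max_right _ _)) N ⟨hN, fun j hj => ⟨?_, ?_⟩, htop⟩
  · exact subset_closure (hω1 j (((le_max_right _ _).trans (le_max_right _ _)).trans hj))
  · exact hn₁ j ((le_max_left _ _).trans hj)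

end NonExplosion

/-! ### Bias and noise of the Hessian estimate. -/

section HessianNoise

variable {p : ℕ} {Ω Ξ : Type*} [mΩ : MeasurableSpace Ω] [MeasurableSpace Ξ]
  {P : Measure Ω} {ν : Measure Ξ} {D : Data p Ω Ξ} {U : Set (E p)} {r B : ℝ} {K : ℕ}

lemma sum_hessian_mul (f : E p → ℝ) (x u v : E p) :
    ∑ q : Fin p × Fin p, hessian f x q.1 q.2 * (u q.1 * v q.2) = fderiv ℝ (fderiv ℝ f) x u v := by
  have hx : ∀ u : E p, u = ∑ i, u i • EuclideanSpace.single i (1 : ℝ) := fun u => by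
    ext j
    simp [Finset.sum_apply, Pi.single_apply]
  conv_rhs => rw [hx u, hx v]
  rw [Fintype.sum_prod_type]
  simp only [map_sum, map_smul, sum_apply, smul_apply,
    smul_eq_mul, hessian, Matrix.of_apply, iteratedFDeriv_two_apply, Matrix.cons_val_zero,
    Matrix.cons_val_one, Finset.mul_sum]
  rw [Finset.sum_comm]
  refine Finset.sum_congr rfl fun i _ => Finset.sum_congr rfl fun j _ => ?_
  ring

lemma continuousAt_hessian {f : E p → ℝ} {x : E p} (h : ContDiffAt ℝ 2 f x) (i j : Fin p) :
    ContinuousAt (fun θ => hessian f θ i j) x := by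
  simp only [hessian, Matrix.of_apply, iteratedFDeriv_two_apply, Matrix.cons_val_zero,
    Matrix.cons_val_one]
  have h1 : ContinuousAt (fderiv ℝ (fderiv ℝ f)) x :=
    ((h.fderiv_right (m := 1) (by norm_num)).fderiv_right (m := 0) (by norm_num)).continuousAt
  exact (h1.clm_apply continuousAt_const).clm_apply continuousAt_const

lemma hessian_comm {f : E p → ℝ} {x : E p} (h : ContDiffAt ℝ 2 f x) (i j : Fin p) :
    hessian f x i j = hessian f x j i := by
  simp only [hessian, Matrix.of_apply, iteratedFDeriv_two_apply, Matrix.cons_val_zero,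
    Matrix.cons_val_one]
  exact (h.isSymmSndFDerivAt (by simp)) _ _

/-- The entries of the Hessian of the loss on `U`, extended by zero. -/
def hessOn (D : Data p Ω Ξ) (ν : Measure Ξ) (U : Set (E p)) (i j : Fin p) : E p → ℝ :=
  U.indicator fun θ => hessian (D.loss ν) θ i j

lemma SmoothSetting.contDiffAt (h : SmoothSetting P ν D U r B K) {x : E p} (hx : x ∈ U) :
    ContDiffAt ℝ 2 (D.loss ν) x :=
  (contDiffAt_of_contDiffOn_isOpen h.isOpen h.contDiffOn hx).of_le (by norm_num)

lemma SmoothSetting.continuousOn_hessian (h : SmoothSetting P ν D U r B K) (i j : Fin p) :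
    ContinuousOn (fun θ => hessian (D.loss ν) θ i j) U := fun _ hx =>
  (continuousAt_hessian (h.contDiffAt hx) i j).continuousWithinAt

lemma SmoothSetting.measurable_hessOn (h : SmoothSetting P ν D U r B K) (i j : Fin p) :
    Measurable (hessOn D ν U i j) := by
  classical
  rw [hessOn, ← Set.piecewise_eq_indicator]
  exact (h.continuousOn_hessian i j).measurable_piecewise continuousOn_const h.isOpen.measurableSet

lemma SmoothSetting.exists_hessOn_bound (h : SmoothSetting P ν D U r B K) (R : ℝ) :
    ∃ A, ∀ i j, ∀ x ∈ core U r R, |hessOn D ν U i j x| ≤ A := by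
  have h1 : ∀ q : Fin p × Fin p, ∃ A, ∀ x ∈ core U r R, |hessOn D ν U q.1 q.2 x| ≤ A := fun q => by
    obtain ⟨A, hA⟩ := (isCompact_core (U := U) (r := r) R).exists_bound_of_continuousOn
      ((h.continuousOn_hessian q.1 q.2).mono (core_subset h.r_pos R))
    refine ⟨A, fun x hx => ?_⟩
    rw [hessOn, Set.indicator_of_mem (core_subset h.r_pos R hx)]
    exact hA x hx
  choose A hA using h1
  exact ⟨∑ q, |A q|, fun i j x hx => (hA (i, j) x hx).trans ((le_abs_self _).trans
    (Finset.single_le_sum (f := fun q => |A q|) (fun q _ => abs_nonneg _) (Finset.mem_univ (i, j))))⟩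

/-- One of the two summands of the Hessian estimate, up to a factor `2`. -/
def hessEst (D : Data p Ω Ξ) (i j : Fin p) (k : ℕ) (ω : Ω) : ℝ :=
  D.ellBar k ω / (2 * D.c k * D.ct k) * (D.mΔ k ω j * D.mΔt k ω i)

omit mΩ [MeasurableSpace Ξ] in
lemma hBar_succ_apply (D : Data p Ω Ξ) (k : ℕ) (ω : Ω) (i j : Fin p) :
    D.hBar (k + 1) ω i j = (1 - D.w k) * D.hBar k ω i j +
      D.w k * ((hessEst D i j k ω + hessEst D j i k ω) / 2) := by
  simp only [Data.hBar, Matrix.add_apply, Matrix.smul_apply, Matrix.vecMulVec_apply, smul_eq_mul,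
    hessEst, Data.mΔ, Data.mΔt]
  have : D.ellBar k ω / (4 * D.c k * D.ct k) = D.ellBar k ω / (2 * D.c k * D.ct k) / 2 := by
    rw [div_div]
    congr 1
    ring
  rw [this]
  ring

/-- The multiplicative noise of the Hessian estimate. -/
def hessQ (D : Data p Ω Ξ) (i j : Fin p) (q : Fin p × Fin p) (k : ℕ) (ω : Ω) : ℝ :=
  (D.mΔ k ω j * D.Δ k ω q.2) * (D.mΔt k ω i * D.Δt k ω q.1) -
    (1 : Matrix (Fin p) (Fin p) ℝ) i q.1 * (1 : Matrix (Fin p) (Fin p) ℝ) j q.2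

/-- The oracle noise of the Hessian estimate. -/
def hessN (D : Data p Ω Ξ) (ν : Measure Ξ) (i j : Fin p) (k : ℕ) (ω : Ω) : ℝ :=
  1 / (2 * D.c k * D.ct k) * ((D.mΔ k ω j * D.mΔt k ω i) * noise₂ ν D k ω -
    (D.mΔ k ω j * D.mΔt k ω i) * noise₁ ν D k ω)

/-- The finite difference error of the Hessian estimate. -/
def hessR (D : Data p Ω Ξ) (ν : Measure Ξ) (U : Set (E p)) (K : ℕ) (i j : Fin p) (k : ℕ)
    (ω : Ω) : ℝ :=
  if K ≤ k then (D.loss ν (D.qpp k ω) - D.loss ν (D.qp k ω) - D.loss ν (D.qmp k ω) +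
    D.loss ν (D.qm k ω) - 2 * ∑ q : Fin p × Fin p, hessOn D ν U q.1 q.2 (D.iter k ω) *
      ((D.ct k • D.Δt k ω) q.1 * (D.c k • D.Δ k ω) q.2)) / (2 * D.c k * D.ct k) *
        (D.mΔ k ω j * D.mΔt k ω i)
  else 0

lemma hessEst_eq (hc : ∀ k, 0 < D.c k) (hct : ∀ k, 0 < D.ct k) {k : ℕ} (hk : K ≤ k) (ω : Ω)
    (i j : Fin p) :
    hessEst D i j k ω = hessOn D ν U i j (D.iter k ω) +
      (P[hessR D ν U K i j k | D.history k]) ω +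
      (∑ q : Fin p × Fin p, hessOn D ν U q.1 q.2 (D.iter k ω) * hessQ D i j q k ω +
        hessN D ν i j k ω +
        (hessR D ν U K i j k ω - (P[hessR D ν U K i j k | D.history k]) ω)) := by
  have hck := (hc k).ne'
  have hctk := (hct k).ne'
  have h1 : ∑ q : Fin p × Fin p, hessOn D ν U q.1 q.2 (D.iter k ω) * hessQ D i j q k ω =
      (D.mΔ k ω j * D.mΔt k ω i) * ∑ q : Fin p × Fin p, hessOn D ν U q.1 q.2 (D.iter k ω) *
        (D.Δt k ω q.1 * D.Δ k ω q.2) - hessOn D ν U i j (D.iter k ω) := by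
    have h2 : ∑ q : Fin p × Fin p, hessOn D ν U q.1 q.2 (D.iter k ω) *
        ((1 : Matrix (Fin p) (Fin p) ℝ) i q.1 * (1 : Matrix (Fin p) (Fin p) ℝ) j q.2) =
        hessOn D ν U i j (D.iter k ω) := by
      rw [Fintype.sum_prod_type]
      simp [Matrix.one_apply]
    rw [← h2, Finset.mul_sum, ← Finset.sum_sub_distrib]
    refine Finset.sum_congr rfl fun q _ => ?_
    simp only [hessQ]
    ring
  have h3 : ∑ q : Fin p × Fin p, hessOn D ν U q.1 q.2 (D.iter k ω) *
      ((D.ct k • D.Δt k ω) q.1 * (D.c k • D.Δ k ω) q.2) = D.c k * D.ct k *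
      ∑ q : Fin p × Fin p, hessOn D ν U q.1 q.2 (D.iter k ω) *
        (D.Δt k ω q.1 * D.Δ k ω q.2) := by
    rw [Finset.mul_sum]
    refine Finset.sum_congr rfl fun q _ => ?_
    simp only [PiLp.smul_apply, smul_eq_mul]
    ring
  rw [h1]
  simp only [hessEst, hessN, hessR, if_pos hk, h3, Data.ellBar, noise₁, noise₂, Data.noise]
  field_simp
  ring

/-- The product of the moments of the two perturbations of step `k`. -/
def crossMoment (D : Data p Ω Ξ) (n n' k : ℕ) (ω : Ω) : ℝ :=
  (‖D.Δ k ω‖ ^ n * ‖D.mΔ k ω‖) * (‖D.Δt k ω‖ ^ n' * ‖D.mΔt k ω‖)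

variable [IsProbabilityMeasure P]

lemma condExp_mul_tower {m₁ m : MeasurableSpace Ω} (hm₁ : m₁ ≤ m) (hm : m ≤ mΩ) {X Y : Ω → ℝ}
    (hY : StronglyMeasurable[m] Y) (hX : Integrable X P) (hYX : Integrable (Y * X) P) :
    P[Y * X | m₁] =ᵐ[P] P[Y * P[X | m] | m₁] :=
  (condExp_condExp_of_le hm₁ hm).symm.trans
    (condExp_congr_ae (condExp_mul_of_stronglyMeasurable_left hY hYX hX))

/-- The factor of the second perturbation is integrated out given `hist₁`, where the first
perturbation is known; then the factor of the first one given the history. -/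
lemma exists_crossMoment_bound (hp : Perturbation P D) (hn : IIDNoise P ν D) :
    ∃ A, 0 ≤ A ∧ ∀ n ≤ 3, ∀ n' ≤ 3, ∀ k, MemLp (crossMoment D n n' k) 2 P ∧
      ∫ ω, crossMoment D n n' k ω ^ 2 ∂P ≤ A ∧
      ∀ᵐ ω ∂P, (P[crossMoment D n n' k | D.history k]) ω ≤ A := by
  obtain ⟨D₂, hD⟩ := hp.moments
  have hD0 : 0 ≤ D₂ := (integral_nonneg fun ω => sq_nonneg _).trans
    (integral_le_of_condExp_le (history_le hp hn 0) (hD 0).1.bound_sq)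
  refine ⟨max (2 * D₂ * (2 * D₂)) ((1 + D₂) * (1 + D₂)),
    le_max_of_le_left (by positivity), fun n hn3 n' hn3' k => ?_⟩
  have hle := history_le hp hn k
  have hle₂ := hist₂_le hp hn k
  have hle₁ := (D.hist₁_le_hist₂ k).trans hle₂
  set Y : Ω → ℝ := fun ω => ‖D.Δ k ω‖ ^ n * ‖D.mΔ k ω‖ with hY
  set X : Ω → ℝ := fun ω => ‖D.Δt k ω‖ ^ n' * ‖D.mΔt k ω‖ with hX
  have hYm : StronglyMeasurable[D.hist₁ k] Y := by
    have h1 := hp.measurable_mΔ k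
    have h2 := D.measurable_Δ_hist₁ k
    exact Measurable.stronglyMeasurable (by fun_prop)
  have hXm : StronglyMeasurable[D.hist₂ k] X := by
    have h1 := hp.measurable_mΔt k
    have h2 := D.measurable_Δt_hist₂ k
    exact Measurable.stronglyMeasurable (by fun_prop)
  obtain ⟨y1, y2, y3⟩ := (hD k).1.moment_bounds hle (n := n) (C := 1)
    (hYm.mono hle₁).aestronglyMeasurable hn3 zero_le_one (Eventually.of_forall fun ω => by
      rw [one_mul, abs_of_nonneg (by positivity)]
      rfl)
  obtain ⟨x1, x2, x3⟩ := (hD k).2.moment_bounds hle₁ (n := n') (C := 1)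
    (hXm.mono hle₂).aestronglyMeasurable hn3' zero_le_one (Eventually.of_forall fun ω => by
      rw [one_mul, abs_of_nonneg (by positivity)]
      rfl)
  rw [one_pow, one_mul] at x2 y2
  rw [one_mul] at x3 y3
  obtain ⟨h1, h2⟩ := memLp_mul_of_condExp_sq_le hle₁ x1 x2 hYm y1
  have hYX : crossMoment D n n' k = Y * X := rfl
  refine ⟨hYX ▸ h1, ?_, ?_⟩
  · refine (h2.trans ?_).trans (le_max_left _ _)
    rw [max_eq_left (by positivity)]
    exact mul_le_mul_of_nonneg_left (integral_le_of_condExp_le hle y2) (by positivity)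
  · have hY1 := y1.integrable (by norm_num : (1 : ENNReal) ≤ 2)
    have hX1 := x1.integrable (by norm_num : (1 : ENNReal) ≤ 2)
    have hYX1 := h1.integrable (by norm_num : (1 : ENNReal) ≤ 2)
    have e1 := condExp_mul_tower (D.history_le_hist₁ k) hle₁ hYm hX1 hYX1
    have e2 : Y * P[X | D.hist₁ k] ≤ᵐ[P] (1 + D₂) • Y := by
      filter_upwards [x3] with ω hω
      rw [Pi.mul_apply, Pi.smul_apply, smul_eq_mul, mul_comm]
      exact mul_le_mul_of_nonneg_right ((le_abs_self _).trans hω) (by positivity)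
    have e3 := condExp_mono (m := D.history k) (integrable_condExp.congr
      (condExp_mul_of_stronglyMeasurable_left hYm hYX1 hX1)) (hY1.smul (1 + D₂)) e2
    filter_upwards [e1, e3, condExp_smul (μ := P) (1 + D₂) Y (D.history k), y3] with ω e1 e3 e4 e5
    rw [e4, Pi.smul_apply, smul_eq_mul] at e3
    rw [hYX, e1]
    refine (e3.trans ?_).trans (le_max_right _ _)
    exact mul_le_mul_of_nonneg_left ((le_abs_self _).trans e5) (by positivity)

omit [IsProbabilityMeasure P] in
lemma memLp_of_abs_le {X Y : Ω → ℝ} (hX : AEStronglyMeasurable X P) (hY : MemLp Y 2 P)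
    (h : ∀ᵐ ω ∂P, |X ω| ≤ Y ω) : MemLp X 2 P ∧ ∫ ω, X ω ^ 2 ∂P ≤ ∫ ω, Y ω ^ 2 ∂P := by
  have hX2 : MemLp X 2 P := hY.mono hX (h.mono fun ω hω => by
    rw [Real.norm_eq_abs, Real.norm_eq_abs]
    exact hω.trans (le_abs_self _))
  refine ⟨hX2, integral_mono_ae hX2.integrable_sq hY.integrable_sq (h.mono fun ω hω => ?_)⟩
  exact sq_le_sq.2 (hω.trans (le_abs_self _))

omit [IsProbabilityMeasure P] in
lemma MartDiff.sub {m m' : MeasurableSpace Ω} {A A' : ℝ} {X Y : Ω → ℝ} [IsProbabilityMeasure P]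
    (hX : MartDiff P m m' A X) (hY : MartDiff P m m' A' Y) :
    MartDiff P m m' (2 * A + 2 * A') (X - Y) := by
  refine ⟨hX.measurable.sub hY.measurable, hX.memLp.sub hY.memLp, ?_, ?_⟩
  · filter_upwards [condExp_sub (hX.memLp.integrable (by norm_num))
      (hY.memLp.integrable (by norm_num)) m, hX.mean, hY.mean] with ω h1 h2 h3
    rw [h1, Pi.sub_apply, h2, h3]
    simp
  · have h1 : ∫ ω, (X - Y) ω ^ 2 ∂P ≤ ∫ ω, (2 * X ω ^ 2 + 2 * Y ω ^ 2) ∂P := by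
      refine integral_mono (hX.memLp.sub hY.memLp).integrable_sq
        ((hX.memLp.integrable_sq.const_mul 2).add (hY.memLp.integrable_sq.const_mul 2))
        fun ω => ?_
      simp only [Pi.sub_apply]
      nlinarith [sq_nonneg (X ω + Y ω)]
    rw [integral_add (hX.memLp.integrable_sq.const_mul 2) (hY.memLp.integrable_sq.const_mul 2),
      integral_const_mul, integral_const_mul] at h1
    linarith [hX.sq_le, hY.sq_le]

omit [IsProbabilityMeasure P] in
lemma MartDiff.const_mul {m m' : MeasurableSpace Ω} {A : ℝ} {X : Ω → ℝ} [IsProbabilityMeasure P]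
    (hX : MartDiff P m m' A X) (c : ℝ) : MartDiff P m m' (c ^ 2 * A) (c • X) := by
  refine ⟨hX.measurable.const_smul c, hX.memLp.const_smul c, ?_, ?_⟩
  · filter_upwards [condExp_smul (μ := P) c X m, hX.mean] with ω h1 h2
    rw [h1, Pi.smul_apply, h2]
    simp
  · simp only [Pi.smul_apply, smul_eq_mul, mul_pow]
    rw [integral_const_mul]
    exact mul_le_mul_of_nonneg_left hX.sq_le (sq_nonneg c)

/-- The normalization is used twice through the tower property: given `hist₁` for the second
perturbation and then given the history for the first, producing a product of two entries of the
identity matrix. -/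
lemma exists_hessQ_martDiff (hp : Perturbation P D) (hn : IIDNoise P ν D) :
    ∃ A, ∀ i j q k, MartDiff P (D.history k) (D.history (k + 1)) A (hessQ D i j q k) := by
  obtain ⟨A, hA0, hA⟩ := exists_crossMoment_bound hp hn
  obtain ⟨D₂, hD⟩ := hp.moments
  refine ⟨2 * A + 2, fun i j q k => ?_⟩
  have hle := history_le hp hn k
  have hle₁ := (D.hist₁_le_hist₂ k).trans (hist₂_le hp hn k)
  set Y : Ω → ℝ := fun ω => D.mΔ k ω j * D.Δ k ω q.2 with hY
  set X : Ω → ℝ := fun ω => D.mΔt k ω i * D.Δt k ω q.1 with hX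
  have hYm : StronglyMeasurable[D.hist₁ k] Y := by
    have h1 := hp.measurable_mΔ k
    have h2 := D.measurable_Δ_hist₁ k
    exact Measurable.stronglyMeasurable (by fun_prop)
  have hXm : StronglyMeasurable[D.hist₂ k] X := by
    have h1 := hp.measurable_mΔt k
    have h2 := D.measurable_Δt_hist₂ k
    exact Measurable.stronglyMeasurable (by fun_prop)
  have hYXm : StronglyMeasurable[D.history (k + 1)] (Y * X) :=
    (hYm.mono (D.hist₁_le_succ k)).mul (hXm.mono (D.hist₂_le_succ k))
  obtain ⟨c1, c2, -⟩ := hA 1 (by norm_num) 1 (by norm_num) k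
  have hYb : ∀ ω, |Y ω| ≤ ‖D.Δ k ω‖ ^ 1 * ‖D.mΔ k ω‖ := fun ω => by
    simp only [hY]
    rw [abs_mul, pow_one, mul_comm]
    exact mul_le_mul (abs_apply_le_norm _ _) (abs_apply_le_norm _ _) (abs_nonneg _) (norm_nonneg _)
  have hXb : ∀ ω, |X ω| ≤ ‖D.Δt k ω‖ ^ 1 * ‖D.mΔt k ω‖ := fun ω => by
    simp only [hX]
    rw [abs_mul, pow_one, mul_comm]
    exact mul_le_mul (abs_apply_le_norm _ _) (abs_apply_le_norm _ _) (abs_nonneg _) (norm_nonneg _)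
  obtain ⟨h1, h2⟩ := memLp_of_abs_le (hYXm.mono (history_le hp hn (k + 1))).aestronglyMeasurable c1
    (Eventually.of_forall fun ω => by
      rw [Pi.mul_apply, abs_mul]
      exact mul_le_mul (hYb ω) (hXb ω) (abs_nonneg _) (by positivity))
  obtain ⟨y1, -, -⟩ := (hD k).1.moment_bounds hle (n := 1) (C := 1)
    (hYm.mono hle₁).aestronglyMeasurable (by norm_num) zero_le_one
    (Eventually.of_forall fun ω => by
      rw [one_mul]
      exact hYb ω)
  obtain ⟨x1, -, -⟩ := (hD k).2.moment_bounds hle₁ (n := 1) (C := 1)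
    (hXm.mono (hist₂_le hp hn k)).aestronglyMeasurable (by norm_num) zero_le_one
    (Eventually.of_forall fun ω => by
      rw [one_mul]
      exact hXb ω)
  set a : ℝ := (1 : Matrix (Fin p) (Fin p) ℝ) i q.1 with ha
  set b : ℝ := (1 : Matrix (Fin p) (Fin p) ℝ) j q.2 with hb
  have heq : hessQ D i j q k = Y * X - fun _ => a * b := rfl
  have hconst : MemLp (fun _ : Ω => a * b) 2 P := memLp_const _
  refine ⟨heq ▸ hYXm.sub stronglyMeasurable_const, heq ▸ h1.sub hconst, ?_, ?_⟩
  · have hX1 := x1.integrable (by norm_num : (1 : ENNReal) ≤ 2)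
    have hYX1 := h1.integrable (by norm_num : (1 : ENNReal) ≤ 2)
    have e1 := condExp_mul_tower (D.history_le_hist₁ k) hle₁ hYm hX1 hYX1
    have e2 : Y * P[X | D.hist₁ k] =ᵐ[P] a • Y := by
      have e3 : P[X | D.hist₁ k] =ᵐ[P] fun _ => a := (hD k).2.unit i q.1
      filter_upwards [e3] with ω e3
      rw [Pi.mul_apply, e3, Pi.smul_apply, smul_eq_mul, mul_comm]
    have e4 := condExp_congr_ae (m := D.history k) e2
    have e5 : P[Y | D.history k] =ᵐ[P] fun _ => b := (hD k).1.unit j q.2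
    filter_upwards [e1, e4, condExp_smul (μ := P) a Y (D.history k), e5,
      condExp_sub hYX1 (hconst.integrable (by norm_num)) (D.history k)] with ω e1 e4 e6 e5 e7
    rw [heq, e7, Pi.sub_apply, e1, e4, e6, Pi.smul_apply, e5, condExp_const hle]
    simp
  · have ha1 : (a * b) ^ 2 ≤ 1 := by
      rw [ha, hb, Matrix.one_apply, Matrix.one_apply]
      split_ifs <;> norm_num
    have e1 : ∫ ω, hessQ D i j q k ω ^ 2 ∂P ≤ ∫ ω, (2 * (Y * X) ω ^ 2 + 2) ∂P := by
      refine integral_mono (heq ▸ (h1.sub hconst).integrable_sq)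
        ((h1.integrable_sq.const_mul 2).add (integrable_const 2)) fun ω => ?_
      rw [heq]
      simp only [Pi.sub_apply]
      nlinarith [sq_nonneg ((Y * X) ω + a * b)]
    rw [integral_add (h1.integrable_sq.const_mul 2) (integrable_const 2), integral_const_mul] at e1
    simp only [integral_const, probReal_univ, smul_eq_mul] at e1
    linarith

variable [IsProbabilityMeasure ν]

lemma exists_hessN_martDiff (hp : Perturbation P D) (hn : IIDNoise P ν D) :
    ∃ A, ∀ i j k, MartDiff P (D.history k) (D.history (k + 1)) (A / (D.c k * D.ct k) ^ 2)
      (hessN D ν i j k) := by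
  obtain ⟨A₁, hA₁⟩ := noiseCond hp hn
  obtain ⟨A₂, hA₂0, hA₂⟩ := exists_crossMoment_bound hp hn
  refine ⟨max A₁ 0 * A₂, fun i j k => ?_⟩
  have hle := hist₂_le hp hn k
  set F : Ω → ℝ := fun ω => D.mΔ k ω j * D.mΔt k ω i with hF
  have hFm : StronglyMeasurable[D.hist₂ k] F := by
    have h1 := (hp.measurable_mΔ k).mono (D.hist₁_le_hist₂ k) le_rfl
    have h2 := hp.measurable_mΔt k
    exact Measurable.stronglyMeasurable (by fun_prop)
  obtain ⟨c1, c2, -⟩ := hA₂ 0 (by norm_num) 0 (by norm_num) k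
  obtain ⟨f1, f2⟩ := memLp_of_abs_le (hFm.mono hle).aestronglyMeasurable c1
    (Eventually.of_forall fun ω => by
      simp only [hF, crossMoment, pow_zero, one_mul, abs_mul]
      exact mul_le_mul (abs_apply_le_norm _ _) (abs_apply_le_norm _ _) (abs_nonneg _)
        (norm_nonneg _))
  have hZ : ∀ Z : Ω → ℝ, NoiseCond P (D.hist₂ k) (D.history (k + 1)) A₁ Z →
      MartDiff P (D.history k) (D.history (k + 1)) (max A₁ 0 * A₂) (F * Z) := fun Z hZ => by
    obtain ⟨h1, h2⟩ := memLp_mul_of_condExp_sq_le hle hZ.memLp hZ.sq_le hFm f1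
    refine ⟨(hFm.mono (D.hist₂_le_succ k)).mul hZ.measurable, h1, ?_, ?_⟩
    · exact condExp_mul_eq_zero ((D.history_le_hist₁ k).trans (D.hist₁_le_hist₂ k)) hle hFm
        (hZ.memLp.integrable (by norm_num)) (h1.integrable (by norm_num)) hZ.mean
    · exact h2.trans (mul_le_mul_of_nonneg_left (f2.trans c2) (le_max_right _ _))
  have h := ((hZ _ (hA₁ k).2).sub (hZ _ (hA₁ k).1)).const_mul (1 / (2 * D.c k * D.ct k))
  have e : (1 / (2 * D.c k * D.ct k)) ^ 2 * (2 * (max A₁ 0 * A₂) + 2 * (max A₁ 0 * A₂)) =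
      max A₁ 0 * A₂ / (D.c k * D.ct k) ^ 2 := by
    -- Positivity of the differencing magnitudes is not assumed here; if their product vanishes,
    -- both sides are zero by the convention for division.
    by_cases h0 : D.c k * D.ct k = 0
    · rw [mul_assoc, h0]
      simp
    · rw [mul_assoc]
      field_simp
      ring
  rw [e] at h
  exact h

/-- After division by 2 c c̃, the mixed difference error is at most B(c‖Δ‖²‖Δ̃‖ + c̃‖Δ‖‖Δ̃‖²) times
‖m(Δ)‖‖m(Δ̃)‖. These are the cross moments of orders (2, 1) and (1, 2), so the bias is of first
order in c and c̃. -/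
lemma exists_hessR_bound (hp : Perturbation P D) (hn : IIDNoise P ν D) (hstep : Stepsize D)
    (hct : ∀ k, 0 < D.ct k) {c₁ : ℝ} (hc₁ : ∀ k, D.ct k ≤ c₁)
    (hs : SmoothSetting P ν D U r B K) :
    ∃ A, 0 ≤ A ∧ ∀ i j k, StronglyMeasurable[D.history (k + 1)] (hessR D ν U K i j k) ∧
      MemLp (hessR D ν U K i j k) 2 P ∧ ∫ ω, hessR D ν U K i j k ω ^ 2 ∂P ≤ A ∧
      ∀ᵐ ω ∂P, |(P[hessR D ν U K i j k | D.history k]) ω| ≤ A * (D.c k + D.ct k) := by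
  obtain ⟨A, hA0, hA⟩ := exists_crossMoment_bound hp hn
  obtain ⟨c₀, hc₀, hc⟩ := exists_bound_c hstep
  have hc₁0 : 0 < c₁ := (hct 0).trans_le (hc₁ 0)
  refine ⟨max (2 * ((B * c₀) ^ 2 * A) + 2 * ((B * c₁) ^ 2 * A)) (B * A),
    le_max_of_le_left (by positivity), fun i j k => ?_⟩
  by_cases hk : K ≤ k
  swap
  · have h0 : hessR D ν U K i j k = 0 := by
      ext ω
      simp [hessR, hk]
    rw [h0, condExp_zero]
    refine ⟨stronglyMeasurable_zero, MemLp.zero, ?_, ?_⟩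
    · simp only [Pi.zero_apply, ne_eq, OfNat.ofNat_ne_zero, not_false_eq_true, zero_pow,
        integral_zero]
      exact le_max_of_le_left (by positivity)
    filter_upwards with ω
    have := (hstep.c_pos k).le
    have := (hct k).le
    have : 0 ≤ max (2 * ((B * c₀) ^ 2 * A) + 2 * ((B * c₁) ^ 2 * A)) (B * A) :=
      le_max_of_le_left (by positivity)
    simp only [Pi.zero_apply, abs_zero]
    positivity
  have hck := hstep.c_pos k
  have hctk := hct k
  have hB := hs.B_nonneg
  have hle := history_le hp hn k
  have hi := (measurable_iter hp hn k).mono (D.history_mono k.le_succ) le_rfl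
  have hΔ := D.measurable_Δ_succ k
  have hΔt := D.measurable_Δt_succ k
  have hm := (hp.measurable_mΔ k).mono (D.hist₁_le_succ k) le_rfl
  have hmt := (hp.measurable_mΔt k).mono (D.hist₂_le_succ k) le_rfl
  have hL := hn.measurable_loss
  have hSM : StronglyMeasurable[D.history (k + 1)] (hessR D ν U K i j k) := by
    have h1 : Measurable[D.history (k + 1)] fun ω => D.loss ν (D.qp k ω) :=
      hL.comp (hi.add (hΔ.const_smul (D.c k)))
    have h2 : Measurable[D.history (k + 1)] fun ω => D.loss ν (D.qm k ω) :=
      hL.comp (hi.sub (hΔ.const_smul (D.c k)))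
    have h3 : Measurable[D.history (k + 1)] fun ω => D.loss ν (D.qpp k ω) :=
      hL.comp ((hi.add (hΔ.const_smul (D.c k))).add (hΔt.const_smul (D.ct k)))
    have h4 : Measurable[D.history (k + 1)] fun ω => D.loss ν (D.qmp k ω) :=
      hL.comp ((hi.sub (hΔ.const_smul (D.c k))).add (hΔt.const_smul (D.ct k)))
    have h5 : Measurable[D.history (k + 1)] fun ω =>
        ∑ q : Fin p × Fin p, hessOn D ν U q.1 q.2 (D.iter k ω) *
          ((D.ct k • D.Δt k ω) q.1 * (D.c k • D.Δ k ω) q.2) := by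
      refine Finset.measurable_fun_sum _ fun q _ => ?_
      have e1 := (hs.measurable_hessOn q.1 q.2).comp hi
      have e2 : Measurable[D.history (k + 1)] fun ω =>
          (D.ct k • D.Δt k ω) q.1 * (D.c k • D.Δ k ω) q.2 := by fun_prop
      exact e1.mul e2
    have h6 : Measurable[D.history (k + 1)] fun ω => D.mΔ k ω j * D.mΔt k ω i := by fun_prop
    have : hessR D ν U K i j k = fun ω => (D.loss ν (D.qpp k ω) - D.loss ν (D.qp k ω) -
        D.loss ν (D.qmp k ω) + D.loss ν (D.qm k ω) - 2 * ∑ q : Fin p × Fin p,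
        hessOn D ν U q.1 q.2 (D.iter k ω) * ((D.ct k • D.Δt k ω) q.1 * (D.c k • D.Δ k ω) q.2)) /
        (2 * D.c k * D.ct k) * (D.mΔ k ω j * D.mΔt k ω i) := by
      ext ω
      rw [hessR, if_pos hk]
    rw [this]
    exact (((((h3.sub h1).sub h4).add h2).sub (h5.const_mul 2)).div_const _).mul h6
      |>.stronglyMeasurable
  set T : Ω → ℝ := (B * D.c k) • crossMoment D 2 1 k + (B * D.ct k) • crossMoment D 1 2 k with hT
  have hb : ∀ᵐ ω ∂P, |hessR D ν U K i j k ω| ≤ T ω := by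
    filter_upwards [hs.ball_subset k hk, hs.query_mem k hk] with ω h1 h2
    have hU : D.iter k ω ∈ U := h1 (Metric.mem_closedBall_self hs.r_pos.le)
    have h3 := mixed_difference_le hs.isOpen hs.contDiffOn (x := D.iter k ω)
      (u := D.c k • D.Δ k ω) (w := D.ct k • D.Δt k ω) h2 hs.third
    rw [← sum_hessian_mul, norm_smul, norm_smul, Real.norm_of_nonneg hck.le,
      Real.norm_of_nonneg hctk.le] at h3
    have h4 : ∀ a b, hessOn D ν U a b (D.iter k ω) = hessian (D.loss ν) (D.iter k ω) a b :=
      fun a b => Set.indicator_of_mem hU _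
    have h5 : |D.mΔ k ω j * D.mΔt k ω i| ≤ ‖D.mΔ k ω‖ * ‖D.mΔt k ω‖ := by
      rw [abs_mul]
      exact mul_le_mul (abs_apply_le_norm _ _) (abs_apply_le_norm _ _) (abs_nonneg _)
        (norm_nonneg _)
    simp only [hessR, if_pos hk, h4]
    rw [abs_mul, abs_div, abs_of_pos (show 0 < 2 * D.c k * D.ct k by positivity)]
    calc _ ≤ 2 * B * (D.c k * ‖D.Δ k ω‖ + D.ct k * ‖D.Δt k ω‖) * (D.c k * ‖D.Δ k ω‖) *
          (D.ct k * ‖D.Δt k ω‖) / (2 * D.c k * D.ct k) * (‖D.mΔ k ω‖ * ‖D.mΔt k ω‖) := by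
          refine mul_le_mul ?_ h5 (abs_nonneg _) (by positivity)
          exact div_le_div_of_nonneg_right h3 (by positivity)
      _ = _ := by
          simp only [hT, Pi.add_apply, Pi.smul_apply, smul_eq_mul, crossMoment]
          field_simp
  obtain ⟨a1, a2, a3⟩ := hA 2 (by norm_num) 1 (by norm_num) k
  obtain ⟨b1, b2, b3⟩ := hA 1 (by norm_num) 2 (by norm_num) k
  have hT2 : MemLp T 2 P := (a1.const_smul _).add (b1.const_smul _)
  obtain ⟨h1, h2⟩ := memLp_of_abs_le
    (hSM.mono (history_le hp hn (k + 1))).aestronglyMeasurable hT2 hb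
  refine ⟨hSM, h1, ?_, ?_⟩
  · refine (h2.trans ?_).trans (le_max_left _ _)
    have e1 : ∫ ω, T ω ^ 2 ∂P ≤ ∫ ω, (2 * ((B * D.c k) ^ 2 * crossMoment D 2 1 k ω ^ 2) +
        2 * ((B * D.ct k) ^ 2 * crossMoment D 1 2 k ω ^ 2)) ∂P := by
      refine integral_mono hT2.integrable_sq (((a1.integrable_sq.const_mul _).const_mul 2).add
        ((b1.integrable_sq.const_mul _).const_mul 2)) fun ω => ?_
      simp only [hT, Pi.add_apply, Pi.smul_apply, smul_eq_mul]
      nlinarith [sq_nonneg (B * D.c k * crossMoment D 2 1 k ω -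
        B * D.ct k * crossMoment D 1 2 k ω)]
    rw [integral_add ((a1.integrable_sq.const_mul _).const_mul 2)
        ((b1.integrable_sq.const_mul _).const_mul 2), integral_const_mul, integral_const_mul,
        integral_const_mul, integral_const_mul] at e1
    have := hc k
    have := hc₁ k
    refine e1.trans ?_
    gcongr
  · have hi1 := h1.integrable (by norm_num : (1 : ENNReal) ≤ 2)
    have hiT := hT2.integrable (by norm_num : (1 : ENNReal) ≤ 2)
    have ia := (a1.const_smul (B * D.c k)).integrable (by norm_num : (1 : ENNReal) ≤ 2)
    have ib := (b1.const_smul (B * D.ct k)).integrable (by norm_num : (1 : ENNReal) ≤ 2)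
    filter_upwards [condExp_mono (m := D.history k) hi1 hiT
        (hb.mono fun ω hω => (le_abs_self _).trans hω),
      condExp_mono (m := D.history k) hi1.neg hiT (hb.mono fun ω hω => (neg_le_abs _).trans hω),
      condExp_neg (μ := P) (hessR D ν U K i j k) (D.history k),
      condExp_add ia ib (D.history k),
      condExp_smul (μ := P) (B * D.c k) (crossMoment D 2 1 k) (D.history k),
      condExp_smul (μ := P) (B * D.ct k) (crossMoment D 1 2 k) (D.history k), a3, b3] with
      ω e1 e2 e3 e4 e5 e6 e7 e8
    rw [e4, Pi.add_apply, e5, e6, Pi.smul_apply, Pi.smul_apply, smul_eq_mul, smul_eq_mul] at e1 e2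
    rw [e3, Pi.neg_apply] at e2
    have f1 := mul_le_mul_of_nonneg_left e7 (show 0 ≤ B * D.c k by positivity)
    have f2 := mul_le_mul_of_nonneg_left e8 (show 0 ≤ B * D.ct k by positivity)
    have f3 : |(P[hessR D ν U K i j k | D.history k]) ω| ≤ B * A * (D.c k + D.ct k) := by
      rw [abs_le]
      constructor <;> nlinarith
    exact f3.trans (mul_le_mul_of_nonneg_right (le_max_right _ _) (by positivity))

open Classical in
lemma ae_tendsto_hessNoise (hp : Perturbation P D) (hn : IIDNoise P ν D) (hstep : Stepsize D)
    (hw : Weights D) (hct : ∀ k, 0 < D.ct k) (hct0 : Tendsto D.ct atTop (𝓝 0))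
    (hs : SmoothSetting P ν D U r B K) (R : ℕ) (i j : Fin p) :
    ∀ᵐ ω ∂P, ∃ s, Tendsto (fun n => ∑ k ∈ Finset.range n,
      if K ≤ k ∧ D.iter k ω ∈ core U r R then D.w k *
        (∑ q : Fin p × Fin p, hessOn D ν U q.1 q.2 (D.iter k ω) * hessQ D i j q k ω +
        hessN D ν i j k ω +
        (hessR D ν U K i j k ω - (P[hessR D ν U K i j k | D.history k]) ω)) else 0)
      atTop (𝓝 s) := by
  obtain ⟨c₁, hc₁⟩ := hct0.bddAbove_range
  obtain ⟨A₁, hA₁⟩ := exists_hessQ_martDiff hp hn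
  obtain ⟨A₂, hA₂⟩ := exists_hessN_martDiff hp hn
  obtain ⟨A₃, -, hA₃⟩ := exists_hessR_bound hp hn hstep hct (fun k => hc₁ ⟨k, rfl⟩) hs
  obtain ⟨A₄, hA₄⟩ := hs.exists_hessOn_bound R
  set A := max A₁ (max A₂ A₃) with hA
  exact ae_tendsto_noise_series (histFiltration hp hn) (measurable_iter hp hn)
    measurableSet_core K (φ := fun q : Fin p × Fin p => hessOn D ν U q.1 q.2) (B := A₄) (A := A)
    (γ := fun k => D.c k * D.ct k)
    (fun q => hs.measurable_hessOn q.1 q.2) (fun q x hx => hA₄ q.1 q.2 x hx)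
    (fun q k => (hA₁ i j q k).measurable) (fun q k => (hA₁ i j q k).memLp)
    (fun q k => (hA₁ i j q k).mean) (fun q k => (hA₁ i j q k).sq_le.trans (le_max_left _ _))
    (fun k => (hA₂ i j k).measurable) (fun k => (hA₂ i j k).memLp) (fun k => (hA₂ i j k).mean)
    (fun k => (hA₂ i j k).sq_le.trans (div_le_div_of_nonneg_right
      ((le_max_left _ _).trans (le_max_right _ _)) (sq_nonneg _)))
    (fun k => (hA₃ i j k).1) (fun k => (hA₃ i j k).2.1)
    (fun k => (hA₃ i j k).2.2.1.trans ((le_max_right _ _).trans (le_max_right _ _)))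
    (fun k => mul_pos (hstep.c_pos k) (hct k))
    (by simpa using hstep.c_lim.mul hct0)
    (hw.wc_sum.congr fun k => by rw [mul_pow])

end HessianNoise

/-! ### Deterministic weighted averaging. -/

/-- Once w < 1 and y < ε/2, the excess of v over ε/2 is multiplied by at most 1 - w ≤ exp(-w) at
each step, and the divergence of Σ w removes it. The absolute value allows early weights above 1. -/
lemma tendsto_zero_of_le_averaging {v y w : ℕ → ℝ} (hv : ∀ k, 0 ≤ v k) (hw0 : ∀ k, 0 ≤ w k)
    (hw : Tendsto w atTop (𝓝 0))
    (hsum : Tendsto (fun n => ∑ k ∈ Finset.range n, w k) atTop atTop)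
    (hy : Tendsto y atTop (𝓝 0)) {K : ℕ} (h : ∀ k ≥ K, v (k + 1) ≤ |1 - w k| * v k + w k * y k) :
    Tendsto v atTop (𝓝 0) := by
  refine Metric.tendsto_nhds.2 fun ε hε => ?_
  obtain ⟨N, hN⟩ := eventually_atTop.1 ((hw.eventually (gt_mem_nhds one_pos)).and
    ((hy.eventually (gt_mem_nhds (half_pos hε))).and (eventually_ge_atTop K)))
  set M := |v N - ε / 2| with hM
  have hdec : ∀ n ≥ N, v n - ε / 2 ≤
      Real.exp (∑ k ∈ Finset.range N, w k - ∑ k ∈ Finset.range n, w k) * M := fun n hn => by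
    induction n, hn using Nat.le_induction with
    | base =>
      rw [sub_self, Real.exp_zero, one_mul]
      exact le_abs_self _
    | succ n hn ih =>
      obtain ⟨h1, h2, h3⟩ := hN n hn
      have h4 := h n h3
      rw [abs_of_nonneg (by linarith)] at h4
      have h5 : v (n + 1) - ε / 2 ≤ (1 - w n) * (v n - ε / 2) := by
        nlinarith [mul_le_mul_of_nonneg_left h2.le (hw0 n)]
      refine h5.trans ?_
      have h6 : ∑ k ∈ Finset.range N, w k - ∑ k ∈ Finset.range (n + 1), w k =
          -w n + (∑ k ∈ Finset.range N, w k - ∑ k ∈ Finset.range n, w k) := by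
        rw [Finset.sum_range_succ]
        ring
      rw [h6, Real.exp_add, mul_assoc]
      calc (1 - w n) * (v n - ε / 2) ≤ (1 - w n) *
            (Real.exp (∑ k ∈ Finset.range N, w k - ∑ k ∈ Finset.range n, w k) * M) :=
            mul_le_mul_of_nonneg_left ih (by linarith)
        _ ≤ Real.exp (-w n) *
            (Real.exp (∑ k ∈ Finset.range N, w k - ∑ k ∈ Finset.range n, w k) * M) :=
            mul_le_mul_of_nonneg_right (Real.one_sub_le_exp_neg _) (by positivity)
  have hlim : Tendsto (fun n => Real.exp (∑ k ∈ Finset.range N, w k -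
      ∑ k ∈ Finset.range n, w k) * M) atTop (𝓝 0) := by
    have h1 : Tendsto (fun n => ∑ k ∈ Finset.range N, w k - ∑ k ∈ Finset.range n, w k)
        atTop atBot :=
      (tendsto_atBot_add_const_left _ (∑ k ∈ Finset.range N, w k)
        (tendsto_neg_atTop_atBot.comp hsum)).congr fun n => (sub_eq_add_neg _ _).symm
    simpa using (Real.tendsto_exp_atBot.comp h1).mul_const M
  filter_upwards [hlim.eventually (gt_mem_nhds (half_pos hε)), eventually_ge_atTop N] with n h1 h2
  rw [Real.dist_0_eq_abs, abs_of_nonneg (hv n)]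
  linarith [hdec n h2]

/-- Convergence of a weighted average with a summable perturbation. -/
lemma tendsto_of_averaging {h x e w : ℕ → ℝ} {z : ℝ} {K : ℕ} (hw0 : ∀ k, 0 ≤ w k)
    (hw : Tendsto w atTop (𝓝 0))
    (hsum : Tendsto (fun n => ∑ k ∈ Finset.range n, w k) atTop atTop)
    (hx : Tendsto x atTop (𝓝 z))
    (hstep : ∀ k ≥ K, h (k + 1) = (1 - w k) * h k + w k * (x k + e k))
    {s : ℝ} (he : Tendsto (fun n => ∑ k ∈ Finset.range n, w k * e k) atTop (𝓝 s)) :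
    Tendsto h atTop (𝓝 z) := by
  -- Subtracting the centred partial sums from h leaves the same recursion without noise, with x
  -- replaced by x - τ.
  set τ : ℕ → ℝ := fun n => ∑ k ∈ Finset.range n, w k * e k - s with hτ
  have hτ0 : Tendsto τ atTop (𝓝 0) := by simpa using he.sub_const s
  have hy : Tendsto (fun k => |x k - τ k - z|) atTop (𝓝 0) := by
    simpa using ((hx.sub hτ0).sub_const z).abs
  have h1 : Tendsto (fun k => |h k - τ k - z|) atTop (𝓝 0) := by
    refine tendsto_zero_of_le_averaging (fun k => abs_nonneg _) hw0 hw hsum hy (K := K)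
      fun k hk => ?_
    have h2 : h (k + 1) - τ (k + 1) - z =
        (1 - w k) * (h k - τ k - z) + w k * (x k - τ k - z) := by
      simp only [hτ, Finset.sum_range_succ]
      rw [hstep k hk]
      ring
    rw [h2]
    refine (abs_add_le _ _).trans ?_
    rw [abs_mul, abs_mul, abs_of_nonneg (hw0 k)]
  have h3 : Tendsto (fun k => h k - τ k - z) atTop (𝓝 0) := by
    rwa [tendsto_zero_iff_abs_tendsto_zero]
  have h4 := (h3.add hτ0).add_const z
  rw [add_zero, zero_add] at h4
  exact h4.congr fun k => by ring

/-! ### Convergence of the iterates and of the Hessian estimates. -/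

section Main

variable {p : ℕ} {Ω Ξ : Type*} [mΩ : MeasurableSpace Ω] [MeasurableSpace Ξ]
  {P : Measure Ω} {ν : Measure Ξ} {D : Data p Ω Ξ} {U : Set (E p)} {r B : ℝ} {K : ℕ}
  [IsProbabilityMeasure P] [IsProbabilityMeasure ν] {θs : E p}

theorem ae_tendsto_iter (hp : Perturbation P D) (hn : IIDNoise P ν D) (hstep : Stepsize D)
    (hs : SmoothSetting P ν D U r B K) (h : BoundedODE P ν D θs ∨ UniqueMin P ν D θs) :
    ∀ᵐ ω ∂P, Tendsto (fun k => D.iter k ω) atTop (𝓝 θs) := by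
  rcases h with ⟨hbdd, hstab, A, hA, hAz, hfreq⟩ | hu
  · filter_upwards [ae_descentPath hp hn hstep hs, hbdd, hfreq] with ω h1 ⟨R, hR⟩ h3
    exact h1.tendsto_of_bounded hR hstab hA hAz h3
  · filter_upwards [ae_descentPath hp hn hstep hs, ae_frequently_lt hp hn hstep hs hu] with
      ω h1 ⟨c, hc, h2⟩
    exact h1.tendsto_of_frequently_lt hu.grad hu.sublevel hu.gap hc h2

omit [IsProbabilityMeasure ν] in
-- One sample point suffices: its iterates converge to θs with a uniform margin inside `U`, so the
-- limit lies in `U`, where the loss is smooth.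
lemma SmoothSetting.mem_of_ae_tendsto (hs : SmoothSetting P ν D U r B K)
    (h : ∀ᵐ ω ∂P, Tendsto (fun k => D.iter k ω) atTop (𝓝 θs)) : θs ∈ U := by
  have hball : ∀ᵐ ω ∂P, ∀ k ≥ K, Metric.closedBall (D.iter k ω) r ⊆ U :=
    ae_all_iff.2 fun k => ae_all_iff.2 fun hk => hs.ball_subset k hk
  obtain ⟨ω, h1, h2⟩ := (h.and hball).exists
  exact closure_subset_of_pos hs.r_pos
    (mem_closure_of_tendsto h1 ((eventually_ge_atTop K).mono h2))

/-- A convergent path is bounded and hence, from step K on, lies in a single core. Its localized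
noise series is then the full one, and averaging applies entrywise. -/
theorem ae_tendsto_hBar (hp : Perturbation P D) (hn : IIDNoise P ν D) (hstep : Stepsize D)
    (hw : Weights D) (hct : ∀ k, 0 < D.ct k) (hct0 : Tendsto D.ct atTop (𝓝 0))
    (hs : SmoothSetting P ν D U r B K)
    (h : ∀ᵐ ω ∂P, Tendsto (fun k => D.iter k ω) atTop (𝓝 θs)) :
    ∀ᵐ ω ∂P, Tendsto (fun k => D.hBar k ω) atTop (𝓝 (hessian (D.loss ν) θs)) := by
  classical
  have hθU := hs.mem_of_ae_tendsto h
  obtain ⟨c₁, hc₁⟩ := hct0.bddAbove_range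
  obtain ⟨A, -, hA⟩ := exists_hessR_bound hp hn hstep hct (fun k => hc₁ ⟨k, rfl⟩) hs
  have hball : ∀ᵐ ω ∂P, ∀ k ≥ K, Metric.closedBall (D.iter k ω) r ⊆ U :=
    ae_all_iff.2 fun k => ae_all_iff.2 fun hk => hs.ball_subset k hk
  have hbias : ∀ᵐ ω ∂P, ∀ i j k,
      |(P[hessR D ν U K i j k | D.history k]) ω| ≤ A * (D.c k + D.ct k) :=
    ae_all_iff.2 fun i => ae_all_iff.2 fun j => ae_all_iff.2 fun k => (hA i j k).2.2.2
  have hnoise := ae_all_iff.2 fun R : ℕ => ae_all_iff.2 fun i => ae_all_iff.2 fun j =>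
    ae_tendsto_hessNoise hp hn hstep hw hct hct0 hs R i j
  -- The weights vanish because their squares remain summable without the denominators, which tend
  -- to zero.
  have hw0 : Tendsto D.w atTop (𝓝 0) := by
    have h1 := (summable_sq_of_summable_sq_div (w := D.w) (γ := fun k => D.c k * D.ct k)
      (fun k => mul_pos (hstep.c_pos k) (hct k)) (by simpa using hstep.c_lim.mul hct0)
      (hw.wc_sum.congr fun k => by rw [mul_pow])).tendsto_atTop_zero
    have h2 := (Real.continuous_sqrt.tendsto 0).comp h1
    rw [Real.sqrt_zero] at h2
    exact h2.congr fun k => Real.sqrt_sq (hw.w_nonneg k)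
  filter_upwards [h, hball, hbias, hnoise] with ω h1 h2 h3 h4
  -- The radius depends on the sample point; restricting to integer radii keeps the exceptional null
  -- sets countable.
  obtain ⟨R, hR⟩ : ∃ R : ℕ, ∀ k, ‖D.iter k ω‖ ≤ R := by
    obtain ⟨R, hR⟩ := h1.norm.bddAbove_range
    obtain ⟨N, hN⟩ := exists_nat_ge R
    exact ⟨N, fun k => (hR ⟨k, rfl⟩).trans hN⟩
  set e : Fin p → Fin p → ℕ → ℝ := fun i j k => if K ≤ k then
    ∑ q : Fin p × Fin p, hessOn D ν U q.1 q.2 (D.iter k ω) * hessQ D i j q k ω +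
      hessN D ν i j k ω +
      (hessR D ν U K i j k ω - (P[hessR D ν U K i j k | D.history k]) ω) else 0 with he
  set b : Fin p → Fin p → ℕ → ℝ := fun i j k =>
    (P[hessR D ν U K i j k | D.history k]) ω with hb
  have hsum : ∀ i j, ∃ s, Tendsto (fun n => ∑ k ∈ Finset.range n, D.w k * e i j k)
      atTop (𝓝 s) := fun i j => by
    obtain ⟨s, hs'⟩ := h4 R i j
    refine ⟨s, hs'.congr fun n => Finset.sum_congr rfl fun k _ => ?_⟩
    by_cases hk : K ≤ k
    · have hmem : D.iter k ω ∈ core U r R := mem_core (h2 k hk) (hR k)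
      simp only [he, if_pos hk, if_pos (And.intro hk hmem)]
    · simp [he, hk]
  have hblim : ∀ i j, Tendsto (b i j) atTop (𝓝 0) := fun i j => by
    refine squeeze_zero_norm (h3 i j) ?_
    simpa using (hstep.c_lim.add hct0).const_mul A
  have hHlim : ∀ i j, Tendsto (fun k => hessOn D ν U i j (D.iter k ω)) atTop
      (𝓝 (hessian (D.loss ν) θs i j)) := fun i j => by
    refine ((continuousAt_hessian (hs.contDiffAt hθU) i j).tendsto.comp h1).congr' ?_
    filter_upwards [h1.eventually (hs.isOpen.mem_nhds hθU)] with k hk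
    rw [hessOn, Set.indicator_of_mem hk]
    rfl
  refine tendsto_pi_nhds.2 fun i => tendsto_pi_nhds.2 fun j => ?_
  obtain ⟨s, hs₁⟩ := hsum i j
  obtain ⟨s', hs₂⟩ := hsum j i
  -- The update averages the (i, j) and (j, i) estimates; symmetry of the Hessian at θs gives both
  -- the same limit.
  refine tendsto_of_averaging (K := K) (x := fun k =>
      (hessOn D ν U i j (D.iter k ω) + b i j k + (hessOn D ν U j i (D.iter k ω) + b j i k)) / 2)
    (e := fun k => (e i j k + e j i k) / 2) (s := (s + s') / 2) hw.w_nonneg hw0 hw.w_sum ?_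
    (fun k hk => ?_) ?_
  · have h5 := (((hHlim i j).add (hblim i j)).add ((hHlim j i).add (hblim j i))).div_const 2
    rw [hessian_comm (hs.contDiffAt hθU) j i, add_zero, add_self_div_two] at h5
    exact h5
  · rw [hBar_succ_apply, hessEst_eq (P := P) (ν := ν) (U := U) hstep.c_pos hct hk ω i j,
      hessEst_eq (P := P) (ν := ν) (U := U) hstep.c_pos hct hk ω j i]
    simp only [he, if_pos hk, hb]
    ring
  · refine ((hs₁.add hs₂).div_const 2).congr fun n => ?_
    rw [← Finset.sum_add_distrib, Finset.sum_div]
    exact Finset.sum_congr rfl fun k _ => by ring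

end Main

end HARP

end

theorem theorem2 {p : ℕ} {Ω Ξ : Type*} [MeasurableSpace Ω] [MeasurableSpace Ξ]
    (P : Measure Ω) [IsProbabilityMeasure P] (ν : Measure Ξ) [IsProbabilityMeasure ν]
    (D : HARP.Data p Ω Ξ) (θs : HARP.E p)
    (hloss : HARP.SmoothLoss P ν D)
    (hpert : HARP.Perturbation P D)
    (hnoise : HARP.IIDNoise P ν D)
    (hstar : HARP.BoundedODE P ν D θs ∨ HARP.UniqueMin P ν D θs)
    (hstep : HARP.Stepsize D)
    (hweight : HARP.Weights D)
    (hct_pos : ∀ k, 0 < D.ct k)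
    (hct : D.ct =O[atTop] D.c) :
    ContDiffAt ℝ 2 (D.loss ν) θs ∧
      ∀ᵐ ω ∂P, Tendsto (fun k => D.hBar k ω) atTop (𝓝 (HARP.hessian (D.loss ν) θs)) := by
  obtain ⟨U, r, B, K, hs⟩ := hloss.exists_setting
  have hct0 : Tendsto D.ct atTop (𝓝 0) := hct.trans_tendsto hstep.c_lim
  have h := HARP.ae_tendsto_iter hpert hnoise hstep hs hstar
  exact ⟨hs.contDiffAt (hs.mem_of_ae_tendsto h),
    HARP.ae_tendsto_hBar hpert hnoise hstep hweight hct_pos hct0 hs h⟩
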